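/- Let $k=k_1\times\cdots\times k_n$ ($1\le n<\infty$) be a finite product of fields, and let $\mathrm{Ch}_k^{\ge 0}$ be the category of non-negatively graded chain complexes of $k$-modules, with the usual tensor product $\otimes=\otimes_k$ and the symmetry $x\otimes y\mapsto(-1)^{|x||y|}y\otimes x$. Let $C$ be a dg-coalgebra over $k$, that is, a (coassociative, counital) comonoid in $\mathrm{Ch}_k^{\ge0}$, which is cocommutative and simply connected, meaning that $C_0=k$ and $C_1=0$. Let $\mathsf{CoMod}_C$ be the category of right $C$-comodules in $\mathrm{Ch}_k^{\ge 0}$. By cocommutativity, each right comodule $X$ is also a left comodule, via its coaction $X\to X\otimes C$ followed by the symmetry. The cotensor product $X\square_C Y$ is the equalizer of the two maps $X\otimes Y\rightrightarrows X\otimes C\otimes Y$ given by the coaction of $X$ and the left coaction of $Y$, with the coaction induced by that of $Y$. It makes $(\mathsf{CoMod}_C,\square_C,C)$ a symmetric monoidal category whose associativity and symmetry are restricted from those of $\otimes$ and whose unit isomorphisms are induced by the coactions. Then $\mathsf{CoMod}_C$ has a (unique) model structure in which the weak equivalences are the comodule maps that are quasi-isomorphisms of chain complexes and the cofibrations are the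 comodule maps that are monomorphisms of chain complexes, and with this model structure $(\mathsf{CoMod}_C,\square_C,C)$ is a symmetric comonoidal model category with fibrant unit. That is: 1. for every fibrant comodule $X$, the functors $X\square_C-$ and $-\square_C X$ preserve fibrant objects and weak equivalences between fibrant objects; 2. for every fibrant replacement $C\to fC$ of the unit (a weak equivalence with fibrant target) and every fibrant comodule $X$, the induced map $X\cong C\square_C X\to fC\,\square_C X$ is a weak equivalence; 3. the unit $C$ is fibrant. -/

import Mathlib

open CategoryTheory MonoidalCategory Limits

universe u v

set_option linter.unusedSectionVars false
set_option linter.unusedSimpArgs false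

namespace DGComod

section Braiding

open HomologicalComplex

lemma zsmul_whiskerRight {D : Type u} [Category.{v} D] [Preadditive D] [MonoidalCategory D]
    [MonoidalPreadditive D] (n : ℤ) {X Y : D} (f : X ⟶ Y) (Z : D) : (n • f) ▷ Z = n • (f ▷ Z) :=
  (tensorRight Z).map_zsmul

lemma whiskerLeft_zsmul {D : Type u} [Category.{v} D] [Preadditive D] [MonoidalCategory D]
    [MonoidalPreadditive D] (n : ℤ) {X Y : D} (f : X ⟶ Y) (Z : D) : Z ◁ (n • f) = n • (Z ◁ f) :=
  (tensorLeft Z).map_zsmul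

variable {D : Type u} [Category.{v} D] [Preadditive D] [MonoidalCategory D] [SymmetricCategory D]
  [MonoidalPreadditive D]
  [HasZeroObject D] [HasFiniteCoproducts D]
  [∀ X : D, PreservesFiniteCoproducts ((curriedTensor D).obj X)]
  [∀ X : D, PreservesFiniteCoproducts ((curriedTensor D).flip.obj X)]

open GradedObject GradedObject.Monoidal

/-- The Koszul twist on graded objects: `x ⊗ y ↦ (-1)^{|x||y|} y ⊗ x`. -/
noncomputable def gradedTwist (X Y : GradedObject ℕ D) :
    GradedObject.Monoidal.tensorObj X Y ⟶ GradedObject.Monoidal.tensorObj Y X :=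
  fun n => tensorObjDesc (fun i j hij => ((-1 : ℤ) ^ (i * j)) • ((β_ (X i) (Y j)).hom ≫
    ιTensorObj Y X j i n (by rw [add_comm, hij])))

lemma ι_gradedTwist (X Y : GradedObject ℕ D) (i j n : ℕ) (h : i + j = n) :
    ιTensorObj X Y i j n h ≫ gradedTwist X Y n =
      ((-1 : ℤ) ^ (i * j)) • ((β_ (X i) (Y j)).hom ≫
        ιTensorObj Y X j i n (by rw [add_comm, h])) := by
  simp [gradedTwist]

lemma gradedTwist_twist (X Y : GradedObject ℕ D) :
    gradedTwist X Y ≫ gradedTwist Y X = 𝟙 _ := by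
  ext n i j h
  simp only [categoryOfGradedObjects_comp, reassoc_of% @ι_gradedTwist, Linear.smul_comp,
    Preadditive.zsmul_comp, Category.assoc, ι_gradedTwist, Preadditive.comp_zsmul,
    SymmetricCategory.symmetry_assoc, smul_smul, categoryOfGradedObjects_id, Category.comp_id]
  rw [mul_comm j i, ← pow_add, ← two_mul, pow_mul]
  simp

lemma gradedTwist_naturality {X X' Y Y' : GradedObject ℕ D} (f : X ⟶ X') (g : Y ⟶ Y') :
    GradedObject.Monoidal.tensorHom f g ≫ gradedTwist X' Y' =
      gradedTwist X Y ≫ GradedObject.Monoidal.tensorHom g f := by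
  ext n i j h
  simp only [categoryOfGradedObjects_comp, ι_tensorHom_assoc, reassoc_of% @ι_gradedTwist, ι_gradedTwist,
    Preadditive.zsmul_comp, Preadditive.comp_zsmul, Category.assoc, ι_tensorHom,
    BraidedCategory.braiding_naturality_assoc]

lemma gradedTwist_hexagon (X Y Z : GradedObject ℕ D) :
    (GradedObject.Monoidal.associator X Y Z).hom ≫ gradedTwist X (GradedObject.Monoidal.tensorObj Y Z) ≫
      (GradedObject.Monoidal.associator Y Z X).hom =
      GradedObject.Monoidal.whiskerRight (gradedTwist X Y) Z ≫ (GradedObject.Monoidal.associator Y X Z).hom ≫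
        GradedObject.Monoidal.whiskerLeft Y (gradedTwist X Z) := by
  ext k i₁ i₂ i₃ h
  dsimp
  conv_lhs => rw [ιTensorObj₃'_associator_hom_assoc, ιTensorObj₃_eq X Y Z i₁ i₂ i₃ k h _ rfl,
    Category.assoc, reassoc_of% @ι_gradedTwist, Preadditive.zsmul_comp, Preadditive.comp_zsmul, Preadditive.comp_zsmul, Category.assoc, ← MonoidalCategory.id_tensorHom,
    BraidedCategory.braiding_naturality_assoc,
    BraidedCategory.braiding_tensor_right_hom, Category.assoc, Category.assoc, Category.assoc, Category.assoc, Iso.hom_inv_id_assoc,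
    MonoidalCategory.tensorHom_id,
    ← ιTensorObj₃'_eq_assoc Y Z X i₂ i₃ i₁ k (by rw [add_comm _ i₁, ← add_assoc, h]) _ rfl,
    ιTensorObj₃'_associator_hom, Iso.inv_hom_id_assoc]
  conv_rhs => rw [ιTensorObj₃'_eq X Y Z i₁ i₂ i₃ k h _ rfl, Category.assoc, ι_tensorHom_assoc,
    ← MonoidalCategory.tensorHom_id,
    MonoidalCategory.tensorHom_comp_tensorHom_assoc, Category.id_comp, ι_gradedTwist,
    categoryOfGradedObjects_id, MonoidalCategory.tensorHom_id, zsmul_whiskerRight,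
    ← MonoidalCategory.tensorHom_id, MonoidalCategory.comp_tensor_id,
    MonoidalCategory.tensorHom_id, MonoidalCategory.tensorHom_id, Preadditive.zsmul_comp, Category.assoc,
    ← ιTensorObj₃'_eq_assoc Y X Z i₂ i₁ i₃ k
      (by rw [add_comm i₂ i₁, h]) (i₁ + i₂) (add_comm i₂ i₁),
    ιTensorObj₃'_associator_hom_assoc,
    ιTensorObj₃_eq Y X Z i₂ i₁ i₃ k (by rw [add_comm i₂ i₁, h]) _ rfl, Category.assoc,
    ι_tensorHom, categoryOfGradedObjects_id, MonoidalCategory.id_tensorHom,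
    ← MonoidalCategory.whiskerLeft_comp_assoc,
    ι_gradedTwist, whiskerLeft_zsmul, Preadditive.zsmul_comp, Preadditive.comp_zsmul, Preadditive.comp_zsmul,
    MonoidalCategory.whiskerLeft_comp, Category.assoc,
    ← ιTensorObj₃_eq Y Z X i₂ i₃ i₁ k (by rw [add_comm _ i₁, ← add_assoc, h])
      (i₁ + i₃) (add_comm _ _), smul_smul]
  rw [mul_add, pow_add]



/-- The Koszul twist of a tensor product of two complexes, in a single degree. -/
noncomputable def twistX (K L : ChainComplex D ℕ) (n : ℕ) :
    (HomologicalComplex.tensorObj K L).X n ⟶ (HomologicalComplex.tensorObj L K).X n :=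
  gradedTwist K.X L.X n

lemma ι_twistX (K L : ChainComplex D ℕ) (i j n : ℕ) (h : i + j = n) (h' : j + i = n) :
    HomologicalComplex.ιTensorObj K L i j n h ≫ twistX K L n =
      ((-1 : ℤ) ^ (i * j)) • ((β_ (K.X i) (L.X j)).hom ≫
        HomologicalComplex.ιTensorObj L K j i n h') :=
  ι_gradedTwist K.X L.X i j n h

lemma d₁_twistX (K L : ChainComplex D ℕ) (i j n m : ℕ) (h : i + j = n) (hm : m + 1 = n) :
    mapBifunctor.d₁ K L (curriedTensor D) (ComplexShape.down ℕ) i j m ≫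
      twistX K L m = ((-1 : ℤ) ^ (i * j)) • ((β_ (K.X i) (L.X j)).hom ≫
        mapBifunctor.d₂ L K (curriedTensor D) (ComplexShape.down ℕ) j i m) := by
  obtain _ | i := i
  · rw [mapBifunctor.d₁_eq_zero _ _ _ _ _ _ _ (by simp),
      mapBifunctor.d₂_eq_zero _ _ _ _ _ _ _ (by simp), zero_comp]
    simp
  · have h₁ : i + j = m := by lia
    have h₂ : j + i = m := by lia
    rw [mapBifunctor.d₁_eq _ _ _ _ (i₁' := i) (by simp) _ _ h₁,
      mapBifunctor.d₂_eq _ _ _ _ _ (i₂' := i) (by simp) _ h₂]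
    dsimp [ComplexShape.ε₁, ComplexShape.ε₂]
    rw [Units.smul_def, Units.smul_def, Preadditive.zsmul_comp, Category.assoc, ι_twistX _ _ _ _ _ _ h₂,
      Preadditive.comp_zsmul, BraidedCategory.braiding_naturality_left_assoc, Preadditive.comp_zsmul,
      smul_smul, smul_smul]
    congr 1
    simp
    rw [← pow_add, show (i+1)*j + j = i * j + 2 * j by ring, pow_add, pow_mul _ 2 j]
    simp

lemma d₂_twistX (K L : ChainComplex D ℕ) (i j n m : ℕ) (h : i + j = n) (hm : m + 1 = n) :
    mapBifunctor.d₂ K L (curriedTensor D) (ComplexShape.down ℕ) i j m ≫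
      twistX K L m = ((-1 : ℤ) ^ (i * j)) • ((β_ (K.X i) (L.X j)).hom ≫
        mapBifunctor.d₁ L K (curriedTensor D) (ComplexShape.down ℕ) j i m) := by
  obtain _ | j := j
  · rw [mapBifunctor.d₁_eq_zero _ _ _ _ _ _ _ (by simp),
      mapBifunctor.d₂_eq_zero _ _ _ _ _ _ _ (by simp), zero_comp]
    simp
  · have h₁ : i + j = m := by lia
    have h₂ : j + i = m := by lia
    rw [mapBifunctor.d₁_eq _ _ _ _ (i₁' := j) (by simp) _ _ h₂,
      mapBifunctor.d₂_eq _ _ _ _ _ (i₂' := j) (by simp) _ h₁]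
    dsimp [ComplexShape.ε₁, ComplexShape.ε₂]
    rw [Units.smul_def, Units.smul_def, Preadditive.zsmul_comp, Category.assoc, ι_twistX _ _ _ _ _ _ h₂,
      Preadditive.comp_zsmul, BraidedCategory.braiding_naturality_right_assoc, Preadditive.comp_zsmul,
      smul_smul, smul_smul]
    congr 1
    simp
    rw [← pow_add, show i * (j + 1) = i + i * j by ring]

/-- The Koszul twist of chain complexes, `x ⊗ y ↦ (-1)^{|x||y|} y ⊗ x`. -/
noncomputable def twistHom (K L : ChainComplex D ℕ) :
    HomologicalComplex.tensorObj K L ⟶ HomologicalComplex.tensorObj L K where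
  f := twistX K L
  comm' := by
    intro n m (hnm : m + 1 = n)
    refine HomologicalComplex.mapBifunctor.hom_ext (fun i j (h : i + j = n) => ?_)
    rw [mapBifunctor.d_eq, mapBifunctor.d_eq, Preadditive.add_comp, Preadditive.comp_add,
      Preadditive.comp_add, Preadditive.comp_add, mapBifunctor.ι_D₁_assoc, mapBifunctor.ι_D₂_assoc, d₁_twistX K L i j n m h hnm,
      d₂_twistX K L i j n m h hnm, reassoc_of% (ι_twistX K L i j n h (by lia)),
      reassoc_of% (ι_twistX K L i j n h (by lia)), Preadditive.zsmul_comp, Preadditive.zsmul_comp, Category.assoc,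
      Category.assoc, mapBifunctor.ι_D₁, mapBifunctor.ι_D₂, add_comm]

/-- The Koszul twist as an isomorphism. -/
noncomputable def twist (K L : ChainComplex D ℕ) :
    HomologicalComplex.tensorObj K L ≅ HomologicalComplex.tensorObj L K where
  hom := twistHom K L
  inv := twistHom L K
  hom_inv_id := by
    ext n : 1
    exact congrFun (gradedTwist_twist K.X L.X) n
  inv_hom_id := by
    ext n : 1
    exact congrFun (gradedTwist_twist L.X K.X) n

lemma twist_naturality {K K' L L' : ChainComplex D ℕ} (f : K ⟶ K') (g : L ⟶ L') :
    HomologicalComplex.tensorHom f g ≫ (twist K' L').hom =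
      (twist K L).hom ≫ HomologicalComplex.tensorHom g f := by
  ext n i j h
  dsimp [twist, twistHom]
  rw [ι_mapBifunctorMap_assoc, ι_twistX _ _ _ _ _ _ (by rw [← h]; exact add_comm _ _),
    reassoc_of% (ι_twistX K L i j n h (by rw [← h]; exact add_comm _ _)), Preadditive.zsmul_comp, Category.assoc,
    ι_mapBifunctorMap]
  dsimp
  simp only [Preadditive.comp_zsmul, BraidedCategory.braiding_naturality_left_assoc,
    BraidedCategory.braiding_naturality_right_assoc, ← whisker_exchange_assoc]

lemma twist_hexagon (X Y Z : ChainComplex D ℕ) :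
    (α_ X Y Z).hom ≫ (twist X (Y ⊗ Z)).hom ≫ (α_ Y Z X).hom =
      (twist X Y).hom ▷ Z ≫ (α_ Y X Z).hom ≫ Y ◁ (twist X Z).hom := by
  ext n : 1
  exact congrFun (gradedTwist_hexagon X.X Y.X Z.X) n

/-- The symmetric monoidal structure on nonnegatively graded chain complexes: the tensor product of
complexes of Mathlib, together with the Koszul twist. -/
noncomputable instance chainComplexSymmetricCategory : SymmetricCategory (ChainComplex D ℕ) where
  braiding := twist
  braiding_naturality_right X Y Z f := by
    have := twist_naturality (𝟙 X) f
    exact this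
  braiding_naturality_left f Z := by
    have := twist_naturality f (𝟙 Z)
    exact this
  hexagon_forward := twist_hexagon
  hexagon_reverse X Y Z := by
    have h : (twist Z (X ⊗ Y)).symm = twist (X ⊗ Y) Z := rfl
    have := congrArg Iso.inv (Iso.ext (twist_hexagon Z X Y) : (α_ Z X Y) ≪≫ twist Z (X ⊗ Y) ≪≫ α_ X Y Z =
      whiskerRightIso (twist Z X) Y ≪≫ α_ X Z Y ≪≫ whiskerLeftIso X (twist Z Y))
    simp at this
    exact this
  symmetry X Y := (twist X Y).hom_inv_id

end Braiding

section Comodules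

variable {V : Type u} [Category.{v} V] [MonoidalCategory V]

/-- The comonad `- ⊗ C` of a coalgebra `C` (comonoid object) in a monoidal category: its counit is
`A ⊗ C ⟶ A ⊗ 𝟙 ≅ A`, its comultiplication `A ⊗ C ⟶ A ⊗ (C ⊗ C) ≅ (A ⊗ C) ⊗ C`. -/
def tensorComonad (C : V) [ComonObj C] : Comonad V where
  toFunctor := tensorRight C
  ε := { app := fun A => A ◁ ComonObj.counit ≫ (ρ_ A).hom
         naturality := fun A B f => by
          dsimp
          rw [← whisker_exchange_assoc, rightUnitor_naturality, Category.assoc] }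
  δ := { app := fun A => A ◁ ComonObj.comul ≫ (α_ A C C).inv
         naturality := fun A B f => by
          dsimp
          rw [← whisker_exchange_assoc, Category.assoc, whiskerRight_tensor]
          simp }
  coassoc A := by
    dsimp
    simp only [comp_whiskerRight, whisker_assoc, Category.assoc, ← associator_inv_naturality_right_assoc,
      ← whiskerLeft_comp_assoc]
    simp
  left_counit A := by
    dsimp
    simp only [Category.assoc, ← associator_inv_naturality_right_assoc, ← whiskerLeft_comp_assoc,
      ComonObj.comul_counit]
    simp
  right_counit A := by
    dsimp
    simp only [comp_whiskerRight, whisker_assoc, Category.assoc, Iso.inv_hom_id_assoc,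
      ← whiskerLeft_comp_assoc, ComonObj.counit_comul]
    simp

open scoped ComonObj

/-- The category of right comodules over `C`, i.e. of objects `X` with a coassociative and counital
map `X ⟶ X ⊗ C`: these are the coalgebras over the comonad `- ⊗ C`. -/
abbrev Comod (C : V) [ComonObj C] := (tensorComonad C).Coalgebra

namespace Comod

variable {C : V} [ComonObj C]

/-- The right coaction. -/
def coact (X : Comod C) : X.A ⟶ X.A ⊗ C := X.a

@[simp]
lemma coact_counit (X : Comod C) : X.coact ≫ X.A ◁ ε[C] = (ρ_ X.A).inv := by
  have h : X.coact ≫ X.A ◁ ε[C] ≫ (ρ_ X.A).hom = 𝟙 _ := X.counit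
  rw [← cancel_mono (ρ_ X.A).hom, Category.assoc, h, Iso.inv_hom_id]

lemma coact_coassoc (X : Comod C) :
    X.coact ≫ X.A ◁ Δ[C] = X.coact ≫ X.coact ▷ C ≫ (α_ X.A C C).hom := by
  have h : X.coact ≫ X.A ◁ Δ[C] ≫ (α_ X.A C C).inv = X.coact ≫ X.coact ▷ C := X.coassoc
  rw [← cancel_mono (α_ X.A C C).inv]
  simpa using h

lemma hom_coact {X Y : Comod C} (f : X ⟶ Y) : X.coact ≫ f.f ▷ C = f.f ≫ Y.coact := f.h

/-- Constructor for comodules. -/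
abbrev mk' (A : V) (r : A ⟶ A ⊗ C) (h₁ : r ≫ A ◁ ε[C] = (ρ_ A).inv)
    (h₂ : r ≫ A ◁ Δ[C] = r ≫ r ▷ C ≫ (α_ A C C).hom) : Comod C where
  A := A
  a := r
  counit := by
    change r ≫ A ◁ ε[C] ≫ (ρ_ A).hom = 𝟙 _
    rw [reassoc_of% h₁, Iso.inv_hom_id]
  coassoc := by
    change r ≫ A ◁ Δ[C] ≫ (α_ A C C).inv = r ≫ r ▷ C
    rw [reassoc_of% h₂, Iso.hom_inv_id, Category.comp_id]

/-- Constructor for morphisms of comodules. -/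
def homMk {X Y : Comod C} (f : X.A ⟶ Y.A) (h : X.coact ≫ f ▷ C = f ≫ Y.coact) : X ⟶ Y where
  f := f
  h := h

/-- The coalgebra as a comodule over itself. -/
abbrev self (C : V) [ComonObj C] : Comod C := mk' C Δ[C] (ComonObj.comul_counit C) (ComonObj.comul_assoc C)


lemma coact_self (C : V) [ComonObj C] : (self C).coact = Δ[C] := rfl

section Left

variable [BraidedCategory V]

/-- The left coaction obtained from the right one by the twist. -/
def lcoact (X : Comod C) : X.A ⟶ C ⊗ X.A := X.coact ≫ (β_ X.A C).hom

lemma hom_lcoact {X Y : Comod C} (f : X ⟶ Y) : X.lcoact ≫ C ◁ f.f = f.f ≫ Y.lcoact := by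
  simp only [lcoact, Category.assoc, ← BraidedCategory.braiding_naturality_left, reassoc_of% @hom_coact]

@[simp]
lemma lcoact_counit (X : Comod C) : X.lcoact ≫ ε[C] ▷ X.A = (λ_ X.A).inv := by
  simp [lcoact, ← BraidedCategory.braiding_naturality_right, reassoc_of% @coact_counit]

variable [IsCommComonObj C]

lemma lcoact_self (C : V) [ComonObj C] [IsCommComonObj C] : (self C).lcoact = Δ[C] :=
  IsCommComonObj.comul_comm C


/-- The left and the right coaction commute. -/
lemma lcoact_coact (X : Comod C) :
    X.lcoact ≫ C ◁ X.coact = X.coact ≫ X.lcoact ▷ C ≫ (α_ C X.A C).hom := by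
  have h := X.coact_coassoc
  have h' : X.coact ≫ X.coact ▷ C = X.coact ≫ X.A ◁ Δ[C] ≫ (α_ X.A C C).inv := by
    rw [← cancel_mono (α_ X.A C C).hom]
    simpa using h.symm
  simp only [lcoact, Category.assoc, ← BraidedCategory.braiding_naturality_left, comp_whiskerRight]
  rw [reassoc_of% h', reassoc_of% h', BraidedCategory.braiding_tensor_left_hom]
  simp only [Iso.inv_hom_id_assoc]
  rw [← whiskerLeft_comp_assoc, IsCommComonObj.comul_comm]

/-- Left coassociativity. -/
lemma lcoact_coassoc (X : Comod C) :
    X.lcoact ≫ C ◁ X.lcoact = X.lcoact ≫ Δ[C] ▷ X.A ≫ (α_ C C X.A).hom := by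
  have h := X.coact_coassoc
  have h' : X.coact ≫ X.coact ▷ C = X.coact ≫ X.A ◁ Δ[C] ≫ (α_ X.A C C).inv := by
    rw [← cancel_mono (α_ X.A C C).hom]
    simpa using h.symm
  conv_lhs => rw [lcoact, ← lcoact, lcoact, MonoidalCategory.whiskerLeft_comp, ← lcoact,
    reassoc_of% @lcoact_coact, lcoact, comp_whiskerRight, Category.assoc, reassoc_of% h']
  rw [lcoact, Category.assoc, ← BraidedCategory.braiding_naturality_right_assoc,
    BraidedCategory.braiding_tensor_right_hom]
  simp

end Left

section Cotensor

variable [SymmetricCategory V] [HasEqualizers V]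
  [∀ Z : V, PreservesFiniteLimits (tensorRight Z)]

instance preservesFiniteLimits_tensorLeft (Z : V) : PreservesFiniteLimits (tensorLeft Z) :=
  preservesFiniteLimits_of_natIso (BraidedCategory.tensorLeftIsoTensorRight Z).symm

lemma mono_whiskerRight {A B : V} (f : A ⟶ B) [Mono f] (Z : V) : Mono (f ▷ Z) :=
  inferInstanceAs (Mono ((tensorRight Z).map f))

lemma mono_whiskerLeft {A B : V} (f : A ⟶ B) [Mono f] (Z : V) : Mono (Z ◁ f) :=
  inferInstanceAs (Mono ((tensorLeft Z).map f))

/-- The map `X ⊗ Y ⟶ X ⊗ (C ⊗ Y)` induced by the coaction of `X`. -/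
def cotensorFst (X Y : Comod C) : X.A ⊗ Y.A ⟶ X.A ⊗ (C ⊗ Y.A) :=
  X.coact ▷ Y.A ≫ (α_ X.A C Y.A).hom

/-- The map `X ⊗ Y ⟶ X ⊗ (C ⊗ Y)` induced by the left coaction of `Y`. -/
def cotensorSnd (X Y : Comod C) : X.A ⊗ Y.A ⟶ X.A ⊗ (C ⊗ Y.A) :=
  X.A ◁ Y.lcoact

/-- The object underlying the cotensor product: the equalizer of the two maps
`X ⊗ Y ⟶ X ⊗ C ⊗ Y` induced by the coactions. -/
noncomputable def cotensorX (X Y : Comod C) : V := equalizer (cotensorFst X Y) (cotensorSnd X Y)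

/-- The inclusion of the cotensor product in the tensor product. -/
noncomputable def ι (X Y : Comod C) : cotensorX X Y ⟶ X.A ⊗ Y.A :=
  equalizer.ι (cotensorFst X Y) (cotensorSnd X Y)

instance mono_ι (X Y : Comod C) : Mono (ι X Y) :=
  equalizer.ι_mono (f := cotensorFst X Y) (g := cotensorSnd X Y)

lemma ι_condition (X Y : Comod C) :
    ι X Y ≫ X.coact ▷ Y.A ≫ (α_ X.A C Y.A).hom = ι X Y ≫ X.A ◁ Y.lcoact :=
  equalizer.condition (cotensorFst X Y) (cotensorSnd X Y)

lemma exists_lift (X Y : Comod C) {W : V} (h : W ⟶ X.A ⊗ Y.A)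
    (w : h ≫ X.coact ▷ Y.A ≫ (α_ X.A C Y.A).hom = h ≫ X.A ◁ Y.lcoact) :
    ∃ l : W ⟶ cotensorX X Y, l ≫ ι X Y = h :=
  ⟨equalizer.lift h w, equalizer.lift_ι h w⟩

instance mono_ι_whiskerRight (X Y : Comod C) (Z : V) : Mono (ι X Y ▷ Z) := mono_whiskerRight _ _

instance mono_whiskerLeft_ι (X Y : Comod C) (Z : V) : Mono (Z ◁ ι X Y) := mono_whiskerLeft _ _

lemma exists_liftRight (X Y : Comod C) (Z : V) {W : V} (h : W ⟶ (X.A ⊗ Y.A) ⊗ Z)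
    (w : h ≫ X.coact ▷ Y.A ▷ Z ≫ (α_ X.A C Y.A).hom ▷ Z = h ≫ (X.A ◁ Y.lcoact) ▷ Z) :
    ∃ l : W ⟶ cotensorX X Y ⊗ Z, l ≫ ι X Y ▷ Z = h := by
  have hl := isLimitForkMapOfIsLimit (tensorRight Z) (equalizer.condition (cotensorFst X Y) (cotensorSnd X Y))
    (equalizerIsEqualizer _ _)
  obtain ⟨l, hl⟩ := Fork.IsLimit.lift' hl h (by simpa [cotensorFst, cotensorSnd] using w)
  exact ⟨l, hl⟩

lemma exists_liftLeft (X Y : Comod C) (Z : V) {W : V} (h : W ⟶ Z ⊗ (X.A ⊗ Y.A))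
    (w : h ≫ Z ◁ X.coact ▷ Y.A ≫ Z ◁ (α_ X.A C Y.A).hom = h ≫ Z ◁ (X.A ◁ Y.lcoact)) :
    ∃ l : W ⟶ Z ⊗ cotensorX X Y, l ≫ Z ◁ ι X Y = h := by
  have hl := isLimitForkMapOfIsLimit (tensorLeft Z) (equalizer.condition (cotensorFst X Y) (cotensorSnd X Y))
    (equalizerIsEqualizer _ _)
  obtain ⟨l, hl⟩ := Fork.IsLimit.lift' hl h (by simpa [cotensorFst, cotensorSnd] using w)
  exact ⟨l, hl⟩


@[simp]
lemma lcoact_braiding (X : Comod C) : X.lcoact ≫ (β_ C X.A).hom = X.coact := by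
  simp [lcoact]

variable [IsCommComonObj C]

lemma exists_cotensorCoact (X Y : Comod C) : ∃ r : cotensorX X Y ⟶ cotensorX X Y ⊗ C,
    r ≫ ι X Y ▷ C = ι X Y ≫ X.A ◁ Y.coact ≫ (α_ X.A Y.A C).inv := by
  apply exists_liftRight
  have h₁ := ι_condition X Y
  have h₂ := lcoact_coact Y
  calc _ = (ι X Y ≫ X.coact ▷ Y.A ≫ (α_ X.A C Y.A).hom) ≫ X.A ◁ C ◁ Y.coact ≫ X.A ◁ (α_ C Y.A C).inv ≫
            (α_ X.A (C ⊗ Y.A) C).inv := by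
        simp only [Category.assoc]
        rw [← associator_inv_naturality_left_assoc, whisker_exchange_assoc]
        monoidal
    _ = ι X Y ≫ X.A ◁ (Y.lcoact ≫ C ◁ Y.coact) ≫ X.A ◁ (α_ C Y.A C).inv ≫
            (α_ X.A (C ⊗ Y.A) C).inv := by
        rw [h₁]; simp
    _ = _ := by rw [h₂]; simp

/-- The coaction of the cotensor product: the unique map which is compatible with the coaction
`X ⊗ Y ⟶ X ⊗ Y ⊗ C` of `Y` under the inclusion in `X ⊗ Y`. -/
noncomputable def cotensorCoact (X Y : Comod C) : cotensorX X Y ⟶ cotensorX X Y ⊗ C :=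
  (exists_cotensorCoact X Y).choose

lemma cotensorCoact_ι (X Y : Comod C) :
    cotensorCoact X Y ≫ ι X Y ▷ C = ι X Y ≫ X.A ◁ Y.coact ≫ (α_ X.A Y.A C).inv :=
  (exists_cotensorCoact X Y).choose_spec

/-- The cotensor product of comodules. -/
noncomputable def cotensor (X Y : Comod C) : Comod C :=
  mk' (cotensorX X Y) (cotensorCoact X Y)
    (by
      rw [← cancel_mono (ι X Y ▷ _), Category.assoc, whisker_exchange, reassoc_of% @cotensorCoact_ι,
        ← rightUnitor_inv_naturality]
      have := Y.coact_counit
      rw [← associator_inv_naturality_right, ← whiskerLeft_comp_assoc, this]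
      simp)
    (by
      rw [← cancel_mono (ι X Y ▷ _), Category.assoc, whisker_exchange, reassoc_of% @cotensorCoact_ι,
        ← associator_inv_naturality_right, ← whiskerLeft_comp_assoc, Y.coact_coassoc]
      simp only [Category.assoc]
      rw [whiskerRight_tensor, Iso.hom_inv_id_assoc, ← comp_whiskerRight_assoc (cotensorCoact X Y),
        cotensorCoact_ι]
      simp only [comp_whiskerRight, Category.assoc]
      rw [reassoc_of% @cotensorCoact_ι]
      monoidal)

/-- The inclusion of the cotensor product in the tensor product. -/
noncomputable def incl (X Y : Comod C) : (cotensor X Y).A ⟶ X.A ⊗ Y.A := ι X Y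

instance mono_incl (X Y : Comod C) : Mono (incl X Y) := inferInstanceAs (Mono (ι X Y))
instance mono_incl_whiskerRight (X Y : Comod C) (Z : V) : Mono (incl X Y ▷ Z) := inferInstanceAs (Mono (ι X Y ▷ Z))
instance mono_whiskerLeft_incl (X Y : Comod C) (Z : V) : Mono (Z ◁ incl X Y) := inferInstanceAs (Mono (Z ◁ ι X Y))

lemma coact_incl (X Y : Comod C) :
    (cotensor X Y).coact ≫ incl X Y ▷ C = incl X Y ≫ X.A ◁ Y.coact ≫ (α_ X.A Y.A C).inv :=
  cotensorCoact_ι X Y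

lemma lcoact_incl (X Y : Comod C) :
    (cotensor X Y).lcoact ≫ C ◁ incl X Y = incl X Y ≫ X.lcoact ▷ Y.A ≫ (α_ C X.A Y.A).hom := by
  have h : incl X Y ≫ X.coact ▷ Y.A ≫ (α_ X.A C Y.A).hom = incl X Y ≫ X.A ◁ Y.lcoact :=
    ι_condition X Y
  rw [lcoact, Category.assoc, ← BraidedCategory.braiding_naturality_left, reassoc_of% @coact_incl,
    BraidedCategory.braiding_tensor_left_hom]
  simp only [Iso.inv_hom_id_assoc]
  rw [← whiskerLeft_comp_assoc, ← lcoact, ← reassoc_of% h, Iso.hom_inv_id_assoc,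
    ← comp_whiskerRight_assoc, ← lcoact]

lemma incl_condition (X Y : Comod C) :
    incl X Y ≫ X.coact ▷ Y.A ≫ (α_ X.A C Y.A).hom = incl X Y ≫ X.A ◁ Y.lcoact :=
  ι_condition X Y

lemma hom_ext_incl {W X Y : Comod C} {f g : W ⟶ cotensor X Y} (h : f.f ≫ incl X Y = g.f ≫ incl X Y) :
    f = g := by
  ext
  rwa [← cancel_mono (incl X Y)]

lemma exists_hom {W X Y : Comod C} (h : W.A ⟶ X.A ⊗ Y.A)
    (w : h ≫ X.coact ▷ Y.A ≫ (α_ X.A C Y.A).hom = h ≫ X.A ◁ Y.lcoact)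
    (w' : W.coact ≫ h ▷ C = h ≫ X.A ◁ Y.coact ≫ (α_ X.A Y.A C).inv) :
    ∃ f : W ⟶ cotensor X Y, f.f ≫ incl X Y = h := by
  obtain ⟨l, hl⟩ : ∃ l : W.A ⟶ (cotensor X Y).A, l ≫ incl X Y = h := exists_lift X Y h w
  refine ⟨homMk l ?_, hl⟩
  rw [← cancel_mono (incl X Y ▷ C), Category.assoc, Category.assoc, coact_incl, ← comp_whiskerRight,
    hl, reassoc_of% hl, w']

/-- The morphism to a cotensor product determined by a map to the tensor product. -/
noncomputable def lift {W X Y : Comod C} (h : W.A ⟶ X.A ⊗ Y.A)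
    (w : h ≫ X.coact ▷ Y.A ≫ (α_ X.A C Y.A).hom = h ≫ X.A ◁ Y.lcoact)
    (w' : W.coact ≫ h ▷ C = h ≫ X.A ◁ Y.coact ≫ (α_ X.A Y.A C).inv) :
    W ⟶ cotensor X Y :=
  (exists_hom h w w').choose

@[simp]
lemma lift_incl {W X Y : Comod C} (h : W.A ⟶ X.A ⊗ Y.A)
    (w : h ≫ X.coact ▷ Y.A ≫ (α_ X.A C Y.A).hom = h ≫ X.A ◁ Y.lcoact)
    (w' : W.coact ≫ h ▷ C = h ≫ X.A ◁ Y.coact ≫ (α_ X.A Y.A C).inv) :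
    (lift h w w').f ≫ incl X Y = h :=
  (exists_hom h w w').choose_spec


/-- Functoriality of the cotensor product. -/
noncomputable def cotensorMap {X X' Y Y' : Comod C} (f : X ⟶ X') (g : Y ⟶ Y') :
    cotensor X Y ⟶ cotensor X' Y' :=
  lift (incl X Y ≫ (f.f ⊗ₘ g.f))
    (by
      have e : (f.f ⊗ₘ g.f) ≫ X'.coact ▷ Y'.A ≫ (α_ X'.A C Y'.A).hom =
          (X.coact ▷ Y.A ≫ (α_ X.A C Y.A).hom) ≫ (f.f ⊗ₘ (C ◁ g.f)) := by
        rw [← tensorHom_id, tensorHom_comp_tensorHom_assoc, ← hom_coact, Category.assoc,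
          ← id_tensorHom, ← associator_naturality, ← tensorHom_id, ← tensorHom_id (Y := Y.A),
          tensorHom_comp_tensorHom_assoc, Category.id_comp, Category.comp_id]
      have e' : (f.f ⊗ₘ g.f) ≫ X'.A ◁ Y'.lcoact = X.A ◁ Y.lcoact ≫ (f.f ⊗ₘ (C ◁ g.f)) := by
        rw [← id_tensorHom, tensorHom_comp_tensorHom, ← hom_lcoact, ← id_tensorHom (X := X.A),
          tensorHom_comp_tensorHom, Category.id_comp, Category.comp_id]
      rw [Category.assoc, e, ← Category.assoc, incl_condition, Category.assoc, Category.assoc, e'])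
    (by
      have e : (f.f ⊗ₘ g.f) ≫ X'.A ◁ Y'.coact = X.A ◁ Y.coact ≫ (f.f ⊗ₘ (g.f ▷ C)) := by
        rw [← id_tensorHom, tensorHom_comp_tensorHom, ← hom_coact, ← id_tensorHom (X := X.A),
          tensorHom_comp_tensorHom, Category.id_comp, Category.comp_id]
      rw [comp_whiskerRight, reassoc_of% @coact_incl, Category.assoc, reassoc_of% e, ← tensorHom_id,
        ← tensorHom_id, associator_inv_naturality])

@[simp]
lemma cotensorMap_incl {X X' Y Y' : Comod C} (f : X ⟶ X') (g : Y ⟶ Y') :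
    (cotensorMap f g).f ≫ incl X' Y' = incl X Y ≫ (f.f ⊗ₘ g.f) :=
  lift_incl _ _ _

lemma cotensorMap_id (X Y : Comod C) : cotensorMap (𝟙 X) (𝟙 Y) = 𝟙 _ := hom_ext_incl (by simp)

lemma cotensorMap_comp {X X' X'' Y Y' Y'' : Comod C} (f : X ⟶ X') (g : Y ⟶ Y') (f' : X' ⟶ X'')
    (g' : Y' ⟶ Y'') : cotensorMap f g ≫ cotensorMap f' g' = cotensorMap (f ≫ f') (g ≫ g') :=
  hom_ext_incl (by simp [reassoc_of% @cotensorMap_incl])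

/-- The symmetry of the cotensor product, restricting the twist. -/
noncomputable def braidHom (X Y : Comod C) : cotensor X Y ⟶ cotensor Y X :=
  lift (incl X Y ≫ (β_ X.A Y.A).hom)
    (by
      have h := incl_condition X Y
      have h' : incl X Y ≫ X.coact ▷ Y.A = incl X Y ≫ X.A ◁ Y.lcoact ≫ (α_ X.A C Y.A).inv := by
        rw [← reassoc_of% h, Iso.hom_inv_id, Category.comp_id]
      rw [Category.assoc, Category.assoc, ← BraidedCategory.braiding_naturality_right_assoc,
        ← BraidedCategory.braiding_naturality_left, lcoact, comp_whiskerRight, Category.assoc,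
        reassoc_of% h', BraidedCategory.braiding_tensor_left_hom]
      have e : (α_ X.A C Y.A).inv ≫ (β_ X.A C).hom ▷ Y.A ≫ (α_ C X.A Y.A).hom ≫
          C ◁ (β_ X.A Y.A).hom ≫ (α_ C Y.A X.A).inv = (β_ X.A (C ⊗ Y.A)).hom :=
        (BraidedCategory.braiding_tensor_right_hom _ _ _).symm
      rw [reassoc_of% e, lcoact, MonoidalCategory.whiskerLeft_comp, Category.assoc,
        BraidedCategory.braiding_naturality_right_assoc X.A (β_ Y.A C).hom, ← comp_whiskerRight_assoc,
        SymmetricCategory.symmetry, id_whiskerRight, Category.id_comp])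
    (by
      have h := incl_condition X Y
      have h' : incl X Y ≫ X.coact ▷ Y.A = incl X Y ≫ X.A ◁ Y.lcoact ≫ (α_ X.A C Y.A).inv := by
        rw [← reassoc_of% h, Iso.hom_inv_id, Category.comp_id]
      rw [comp_whiskerRight, reassoc_of% @coact_incl, Category.assoc,
        ← BraidedCategory.braiding_naturality_left_assoc, reassoc_of% h',
        BraidedCategory.braiding_tensor_left_hom]
      simp only [Category.assoc, Iso.inv_hom_id_assoc, Iso.hom_inv_id, Category.comp_id]
      rw [← whiskerLeft_comp_assoc, lcoact_braiding])

@[simp]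
lemma braidHom_incl (X Y : Comod C) :
    (braidHom X Y).f ≫ incl Y X = incl X Y ≫ (β_ X.A Y.A).hom :=
  lift_incl _ _ _

/-- The symmetry isomorphism. -/
@[simps]
noncomputable def braid (X Y : Comod C) : cotensor X Y ≅ cotensor Y X where
  hom := braidHom X Y
  inv := braidHom Y X
  hom_inv_id := hom_ext_incl (by simp [reassoc_of% @cotensorMap_incl, reassoc_of% @braidHom_incl])
  inv_hom_id := hom_ext_incl (by simp [reassoc_of% @cotensorMap_incl, reassoc_of% @braidHom_incl])

/-- `X ≅ C □ X`, restricting the left coaction `X ⟶ C ⊗ X`. -/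
noncomputable def leftUnitInv (X : Comod C) : X ⟶ cotensor (self C) X :=
  lift (X := self C) X.lcoact (lcoact_coassoc X).symm
    (by rw [← cancel_mono (α_ (self C).A X.A C).hom]; simp [lcoact_coact])

@[simp]
lemma leftUnitInv_incl (X : Comod C) : (leftUnitInv X).f ≫ incl (self C) X = X.lcoact :=
  lift_incl _ _ _

/-- `X ≅ X □ C`, restricting the coaction `X ⟶ X ⊗ C`. -/
noncomputable def rightUnitInv (X : Comod C) : X ⟶ cotensor X (self C) :=
  lift (Y := self C) X.coact (by rw [lcoact_self]; exact (coact_coassoc X).symm)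
    (by rw [← cancel_mono (α_ X.A (self C).A C).hom]; simp [coact_self, coact_coassoc])

@[simp]
lemma rightUnitInv_incl (X : Comod C) : (rightUnitInv X).f ≫ incl X (self C) = X.coact :=
  lift_incl _ _ _

instance isIso_leftUnitInv (X : Comod C) : IsIso (leftUnitInv X) := by
  have : IsIso (leftUnitInv X).f :=
    ⟨incl (self C) X ≫ ε[C] ▷ X.A ≫ (λ_ X.A).hom, by
      rw [reassoc_of% @leftUnitInv_incl, reassoc_of% @lcoact_counit, Iso.inv_hom_id], by
      rw [← cancel_mono (incl (self C) X)]
      simp only [Category.assoc, leftUnitInv_incl, Category.id_comp]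
      have h := incl_condition (self C) X
      have h' : incl (self C) X ≫ C ◁ X.lcoact = incl (self C) X ≫ Δ[C] ▷ X.A ≫ (α_ C C X.A).hom :=
        h.symm
      rw [← leftUnitor_naturality, ← whisker_exchange_assoc, reassoc_of% h']
      simp [← associator_naturality_left_assoc, ← comp_whiskerRight_assoc]⟩
  exact Comonad.coalgebra_iso_of_iso _ _

instance isIso_rightUnitInv (X : Comod C) : IsIso (rightUnitInv X) := by
  have : IsIso (rightUnitInv X).f :=
    ⟨incl X (self C) ≫ X.A ◁ ε[C] ≫ (ρ_ X.A).hom, by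
      rw [reassoc_of% @rightUnitInv_incl, reassoc_of% @coact_counit, Iso.inv_hom_id], by
      rw [← cancel_mono (incl X (self C))]
      simp only [Category.assoc, rightUnitInv_incl, Category.id_comp]
      have h := incl_condition X (self C)
      rw [lcoact_self] at h
      rw [← rightUnitor_naturality, whisker_exchange_assoc]
      have h' : incl X (self C) ≫ X.coact ▷ C = incl X (self C) ≫ X.A ◁ Δ[C] ≫ (α_ X.A C C).inv := by
        rw [← cancel_mono (α_ X.A C C).hom]
        simpa using h
      rw [reassoc_of% h', ← associator_inv_naturality_right_assoc, ← whiskerLeft_comp_assoc,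
        ComonObj.comul_counit]
      simp⟩
  exact Comonad.coalgebra_iso_of_iso _ _

lemma exists_assocHom (X Y Z : Comod C) :
    ∃ f : cotensor (cotensor X Y) Z ⟶ cotensor X (cotensor Y Z),
      f.f ≫ incl X (cotensor Y Z) ≫ X.A ◁ incl Y Z =
        incl (cotensor X Y) Z ≫ incl X Y ▷ Z.A ≫ (α_ X.A Y.A Z.A).hom := by
  obtain ⟨l, hl⟩ : ∃ l : (cotensor (cotensor X Y) Z).A ⟶ X.A ⊗ (cotensor Y Z).A,
      l ≫ X.A ◁ incl Y Z =
        incl (cotensor X Y) Z ≫ incl X Y ▷ Z.A ≫ (α_ X.A Y.A Z.A).hom := by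
    apply exists_liftLeft
    have h := incl_condition (cotensor X Y) Z
    have h₁ := coact_incl X Y
    calc _ = incl (cotensor X Y) Z ≫ (incl X Y ≫ X.A ◁ Y.coact ≫ (α_ X.A Y.A C).inv) ▷ Z.A ≫
          (α_ (X.A ⊗ Y.A) C Z.A).hom ≫ (α_ X.A Y.A (C ⊗ Z.A)).hom := by
          simp only [comp_whiskerRight, Category.assoc, whisker_assoc]
          simp
      _ = (incl (cotensor X Y) Z ≫ (cotensor X Y).coact ▷ Z.A ≫ (α_ (cotensor X Y).A C Z.A).hom) ≫
          incl X Y ▷ (C ⊗ Z.A) ≫ (α_ X.A Y.A (C ⊗ Z.A)).hom := by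
          rw [← h₁]
          simp
      _ = _ := by
          rw [h, Category.assoc, whisker_exchange_assoc]
          simp
  have h := incl_condition X Y
  obtain ⟨f, hf⟩ := exists_hom (W := cotensor (cotensor X Y) Z) (X := X) (Y := cotensor Y Z) l
    (by
      have := mono_whiskerLeft (C ◁ incl Y Z) X.A
      rw [← cancel_mono (X.A ◁ C ◁ incl Y Z)]
      simp only [Category.assoc]
      rw [← associator_naturality_right, ← whisker_exchange_assoc, reassoc_of% hl,
        ← whiskerLeft_comp, lcoact_incl, whiskerLeft_comp, reassoc_of% hl, whiskerLeft_comp]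
      have h' : incl X Y ≫ X.coact ▷ Y.A = incl X Y ≫ X.A ◁ Y.lcoact ≫ (α_ X.A C Y.A).inv := by
        rw [← reassoc_of% h, Iso.hom_inv_id, Category.comp_id]
      rw [whiskerRight_tensor]
      simp only [Category.assoc, Iso.hom_inv_id_assoc]
      rw [← comp_whiskerRight_assoc, h']
      simp)
    (by
      have := mono_whiskerRight (X.A ◁ incl Y Z) C
      rw [← cancel_mono ((X.A ◁ incl Y Z) ▷ C)]
      simp only [Category.assoc]
      rw [← comp_whiskerRight, hl, ← associator_inv_naturality_middle, ← whiskerLeft_comp_assoc,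
        coact_incl, comp_whiskerRight, reassoc_of% @coact_incl, whiskerLeft_comp, Category.assoc,
        reassoc_of% hl]
      simp only [comp_whiskerRight, ← associator_inv_naturality_left_assoc]
      rw [whisker_exchange_assoc]
      monoidal)
  exact ⟨f, by rw [reassoc_of% hf, hl]⟩


lemma exists_assocInv (X Y Z : Comod C) :
    ∃ f : cotensor X (cotensor Y Z) ⟶ cotensor (cotensor X Y) Z,
      f.f ≫ incl (cotensor X Y) Z ≫ incl X Y ▷ Z.A =
        incl X (cotensor Y Z) ≫ X.A ◁ incl Y Z ≫ (α_ X.A Y.A Z.A).inv := by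
  obtain ⟨a, ha⟩ := exists_assocHom Z Y X
  refine ⟨braidHom X (cotensor Y Z) ≫ cotensorMap (braidHom Y Z) (𝟙 X) ≫ a ≫
    braidHom Z (cotensor Y X) ≫ cotensorMap (braidHom Y X) (𝟙 Z), ?_⟩
  simp only [Comonad.Coalgebra.comp_f, Comonad.Coalgebra.id_f, Category.assoc, reassoc_of% @cotensorMap_incl,
    tensorHom_id, ← comp_whiskerRight, braidHom_incl, reassoc_of% @braidHom_incl]
  simp only [comp_whiskerRight]
  rw [← BraidedCategory.braiding_naturality_right_assoc, reassoc_of% ha, reassoc_of% @cotensorMap_incl,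
    Comonad.Coalgebra.id_f, tensorHom_id, ← comp_whiskerRight_assoc, braidHom_incl, comp_whiskerRight_assoc,
    reassoc_of% @braidHom_incl, ← BraidedCategory.braiding_naturality_right_assoc,
    BraidedCategory.braiding_tensor_right_hom, BraidedCategory.braiding_tensor_right_hom]
  simp only [Category.assoc, Iso.inv_hom_id_assoc, ← comp_whiskerRight_assoc,
    SymmetricCategory.symmetry, id_whiskerRight, Category.id_comp, ← whiskerLeft_comp_assoc,
    whiskerLeft_id, Iso.hom_inv_id_assoc]
  rw [← comp_whiskerRight, SymmetricCategory.symmetry, id_whiskerRight, Category.comp_id]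

/-- The associativity isomorphism, restricting the one of the tensor product. -/
noncomputable def assoc (X Y Z : Comod C) :
    cotensor (cotensor X Y) Z ≅ cotensor X (cotensor Y Z) where
  hom := (exists_assocHom X Y Z).choose
  inv := (exists_assocInv X Y Z).choose
  hom_inv_id := by
    have h₁ := (exists_assocHom X Y Z).choose_spec
    have h₂ := (exists_assocInv X Y Z).choose_spec
    apply hom_ext_incl
    rw [← cancel_mono (incl X Y ▷ Z.A)]
    simp [h₁, h₂, reassoc_of% h₁]
  inv_hom_id := by
    have h₁ := (exists_assocHom X Y Z).choose_spec
    have h₂ := (exists_assocInv X Y Z).choose_spec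
    apply hom_ext_incl
    rw [← cancel_mono (X.A ◁ incl Y Z)]
    simp [h₁, h₂, reassoc_of% h₂]

@[simp]
lemma assoc_hom_incl (X Y Z : Comod C) :
    (assoc X Y Z).hom.f ≫ incl X (cotensor Y Z) ≫ X.A ◁ incl Y Z =
        incl (cotensor X Y) Z ≫ incl X Y ▷ Z.A ≫ (α_ X.A Y.A Z.A).hom :=
  (exists_assocHom X Y Z).choose_spec

lemma hom_ext_incl₂ {W X Y Z : Comod C} {f g : W ⟶ cotensor X (cotensor Y Z)}
    (h : f.f ≫ incl X (cotensor Y Z) ≫ X.A ◁ incl Y Z = g.f ≫ incl X (cotensor Y Z) ≫ X.A ◁ incl Y Z) :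
    f = g := by
  apply hom_ext_incl
  rw [← cancel_mono (X.A ◁ incl Y Z), Category.assoc, Category.assoc, h]

lemma assoc_naturality {X X' Y Y' Z Z' : Comod C} (f : X ⟶ X') (g : Y ⟶ Y') (h : Z ⟶ Z') :
    cotensorMap (cotensorMap f g) h ≫ (assoc X' Y' Z').hom =
      (assoc X Y Z).hom ≫ cotensorMap f (cotensorMap g h) := by
  apply hom_ext_incl₂
  have e₁ : (cotensorMap g h).f ≫ incl Y' Z' = incl Y Z ≫ (g.f ⊗ₘ h.f) := cotensorMap_incl g h
  have e₂ : (cotensorMap f g).f ≫ incl X' Y' = incl X Y ≫ (f.f ⊗ₘ g.f) := cotensorMap_incl f g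
  have e₃ : (f.f ⊗ₘ (cotensorMap g h).f) ≫ X'.A ◁ incl Y' Z' =
      X.A ◁ incl Y Z ≫ (f.f ⊗ₘ (g.f ⊗ₘ h.f)) := by
    rw [← id_tensorHom, tensorHom_comp_tensorHom, e₁, ← id_tensorHom, tensorHom_comp_tensorHom,
      Category.comp_id, Category.id_comp]
  have e₄ : ((cotensorMap f g).f ⊗ₘ h.f) ≫ incl X' Y' ▷ Z'.A =
      incl X Y ▷ Z.A ≫ ((f.f ⊗ₘ g.f) ⊗ₘ h.f) := by
    rw [← tensorHom_id, tensorHom_comp_tensorHom, e₂, ← tensorHom_id, tensorHom_comp_tensorHom,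
      Category.comp_id, Category.id_comp]
  simp only [Comonad.Coalgebra.comp_f, Category.assoc, assoc_hom_incl, reassoc_of% @cotensorMap_incl]
  rw [reassoc_of% e₄, e₃, reassoc_of% @assoc_hom_incl, associator_naturality]

lemma leftUnitInv_naturality {X Y : Comod C} (f : X ⟶ Y) :
    leftUnitInv X ≫ cotensorMap (𝟙 (self C)) f = f ≫ leftUnitInv Y := by
  apply hom_ext_incl
  have h := hom_lcoact f
  simp only [Comonad.Coalgebra.comp_f, Category.assoc, cotensorMap_incl, leftUnitInv_incl,
    reassoc_of% @leftUnitInv_incl, Comonad.Coalgebra.id_f, id_tensorHom]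
  exact h

lemma rightUnitInv_naturality {X Y : Comod C} (f : X ⟶ Y) :
    rightUnitInv X ≫ cotensorMap f (𝟙 (self C)) = f ≫ rightUnitInv Y := by
  apply hom_ext_incl
  have h := hom_coact f
  simp only [Comonad.Coalgebra.comp_f, Category.assoc, cotensorMap_incl, rightUnitInv_incl,
    reassoc_of% @rightUnitInv_incl, Comonad.Coalgebra.id_f, tensorHom_id]
  exact h

lemma assoc_triangle (X Y : Comod C) :
    cotensorMap (rightUnitInv X) (𝟙 Y) ≫ (assoc X (self C) Y).hom =
      cotensorMap (𝟙 X) (leftUnitInv Y) := by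
  apply hom_ext_incl₂
  have h := incl_condition X Y
  simp only [Comonad.Coalgebra.comp_f, Category.assoc, assoc_hom_incl, reassoc_of% @cotensorMap_incl,
    Comonad.Coalgebra.id_f, id_tensorHom, tensorHom_id]
  rw [← comp_whiskerRight_assoc, rightUnitInv_incl, ← whiskerLeft_comp, leftUnitInv_incl]
  exact h

lemma assoc_pentagon (W X Y Z : Comod C) :
    cotensorMap (assoc W X Y).hom (𝟙 Z) ≫ (assoc W (cotensor X Y) Z).hom ≫
      cotensorMap (𝟙 W) (assoc X Y Z).hom =
    (assoc (cotensor W X) Y Z).hom ≫ (assoc W X (cotensor Y Z)).hom := by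
  apply hom_ext_incl₂
  have := mono_whiskerLeft (X.A ◁ incl Y Z) W.A
  rw [← cancel_mono (W.A ◁ X.A ◁ incl Y Z)]
  have e₁ : (assoc X Y Z).hom.f ≫ incl X (cotensor Y Z) ≫ X.A ◁ incl Y Z =
      incl (cotensor X Y) Z ≫ incl X Y ▷ Z.A ≫ (α_ X.A Y.A Z.A).hom := assoc_hom_incl X Y Z
  have e₂ : (assoc W X Y).hom.f ≫ incl W (cotensor X Y) ≫ W.A ◁ incl X Y =
      incl (cotensor W X) Y ≫ incl W X ▷ Y.A ≫ (α_ W.A X.A Y.A).hom := assoc_hom_incl W X Y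
  calc _ = (cotensorMap (assoc W X Y).hom (𝟙 Z)).f ≫ (assoc W (cotensor X Y) Z).hom.f ≫
        incl W (cotensor (cotensor X Y) Z) ≫ W.A ◁ ((assoc X Y Z).hom.f ≫
          incl X (cotensor Y Z) ≫ X.A ◁ incl Y Z) := by
        simp only [Comonad.Coalgebra.comp_f, Category.assoc, reassoc_of% @cotensorMap_incl,
          Comonad.Coalgebra.id_f, id_tensorHom, whiskerLeft_comp]
    _ = (incl (cotensor (cotensor W X) Y) Z ≫ ((assoc W X Y).hom.f ≫ incl W (cotensor X Y) ≫
          W.A ◁ incl X Y) ▷ Z.A) ≫ (α_ W.A (X.A ⊗ Y.A) Z.A).hom ≫ W.A ◁ (α_ X.A Y.A Z.A).hom := by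
        rw [e₁, whiskerLeft_comp, reassoc_of% @assoc_hom_incl, reassoc_of% @cotensorMap_incl]
        simp only [Comonad.Coalgebra.id_f, tensorHom_id, comp_whiskerRight, Category.assoc,
          whiskerLeft_comp, ← associator_naturality_middle_assoc]
    _ = (incl (cotensor (cotensor W X) Y) Z ≫ incl (cotensor W X) Y ▷ Z.A ≫
          (α_ (cotensor W X).A Y.A Z.A).hom) ≫ incl W X ▷ (Y.A ⊗ Z.A) ≫
            (α_ W.A X.A (Y.A ⊗ Z.A)).hom := by
        rw [e₂]
        simp only [comp_whiskerRight, Category.assoc, MonoidalCategory.pentagon,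
          associator_naturality_left_assoc]
    _ = _ := by
        rw [← assoc_hom_incl]
        simp only [Comonad.Coalgebra.comp_f, Category.assoc]
        rw [whisker_exchange_assoc, reassoc_of% @assoc_hom_incl]
        simp

lemma braid_hexagon (X Y Z : Comod C) :
    (assoc X Y Z).hom ≫ braidHom X (cotensor Y Z) ≫ (assoc Y Z X).hom =
      cotensorMap (braidHom X Y) (𝟙 Z) ≫ (assoc Y X Z).hom ≫ cotensorMap (𝟙 Y) (braidHom X Z) := by
  apply hom_ext_incl₂
  simp only [Comonad.Coalgebra.comp_f, Category.assoc, reassoc_of% @cotensorMap_incl, assoc_hom_incl,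
    Comonad.Coalgebra.id_f, id_tensorHom, tensorHom_id, ← whiskerLeft_comp, braidHom_incl,
    reassoc_of% @braidHom_incl]
  rw [whiskerLeft_comp, reassoc_of% @assoc_hom_incl, reassoc_of% @cotensorMap_incl,
    ← BraidedCategory.braiding_naturality_right_assoc, reassoc_of% @assoc_hom_incl,
    Comonad.Coalgebra.id_f, tensorHom_id, ← comp_whiskerRight_assoc, braidHom_incl,
    comp_whiskerRight_assoc, BraidedCategory.hexagon_forward]

lemma braidHom_naturality {X X' Y Y' : Comod C} (f : X ⟶ X') (g : Y ⟶ Y') :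
    cotensorMap f g ≫ braidHom X' Y' = braidHom X Y ≫ cotensorMap g f :=
  hom_ext_incl (by simp [reassoc_of% @cotensorMap_incl, reassoc_of% @braidHom_incl])

/-- The cotensor product over `C` as a monoidal structure with unit `C`. -/
noncomputable instance monoidalCategory : MonoidalCategory (Comod C) where
  tensorObj := cotensor
  tensorUnit := self C
  tensorHom := cotensorMap
  whiskerLeft X _ _ f := cotensorMap (𝟙 X) f
  whiskerRight f Y := cotensorMap f (𝟙 Y)
  associator := assoc
  leftUnitor X := (asIso (leftUnitInv X)).symm
  rightUnitor X := (asIso (rightUnitInv X)).symm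
  tensorHom_def f g := hom_ext_incl (by simp [MonoidalCategory.tensorHom_def, reassoc_of% @cotensorMap_incl, reassoc_of% @braidHom_incl])
  id_tensorHom_id X Y := hom_ext_incl (by simp [reassoc_of% @cotensorMap_incl, reassoc_of% @braidHom_incl])
  tensorHom_comp_tensorHom f g f' g' := hom_ext_incl (by simp [reassoc_of% @cotensorMap_incl, reassoc_of% @braidHom_incl])
  whiskerLeft_id X Y := hom_ext_incl (by simp [reassoc_of% @cotensorMap_incl, reassoc_of% @braidHom_incl])
  id_whiskerRight X Y := hom_ext_incl (by simp [reassoc_of% @cotensorMap_incl, reassoc_of% @braidHom_incl])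
  associator_naturality := assoc_naturality
  leftUnitor_naturality f := by
    rw [← cancel_epi (leftUnitInv _)]
    simp [reassoc_of% (leftUnitInv_naturality f)]
  rightUnitor_naturality f := by
    rw [← cancel_epi (rightUnitInv _)]
    simp [reassoc_of% (rightUnitInv_naturality f)]
  pentagon := assoc_pentagon
  triangle X Y := by
    have h₁ : cotensorMap (rightUnitInv X) (𝟙 Y) ≫ cotensorMap (inv (rightUnitInv X)) (𝟙 Y) = 𝟙 _ :=
      by
      simp [cotensorMap_comp, cotensorMap_id]
    have h₂ : cotensorMap (𝟙 X) (leftUnitInv Y) ≫ cotensorMap (𝟙 X) (inv (leftUnitInv Y)) = 𝟙 _ :=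
      by
      simp [cotensorMap_comp, cotensorMap_id]
    have h₃ : cotensorMap (inv (rightUnitInv X)) (𝟙 Y) ≫ cotensorMap (rightUnitInv X) (𝟙 Y) = 𝟙 _ :=
      by
      simp [cotensorMap_comp, cotensorMap_id]
    have : IsIso (cotensorMap (rightUnitInv X) (𝟙 Y)) := ⟨_, h₁, h₃⟩
    rw [← cancel_epi (cotensorMap (rightUnitInv X) (𝟙 Y))]
    rw [reassoc_of% (assoc_triangle X Y)]
    exact h₂.trans h₁.symm

/-- The monoidal structure given by the cotensor product is symmetric, by restriction of the twist. -/
noncomputable instance symmetricCategory : SymmetricCategory (Comod C) where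
  braiding := braid
  braiding_naturality_left f Z := braidHom_naturality f (𝟙 Z)
  braiding_naturality_right X _ _ f := braidHom_naturality (𝟙 X) f
  hexagon_forward := braid_hexagon
  hexagon_reverse X Y Z := by
    have h : (braid Z (cotensor X Y)).symm = braid (cotensor X Y) Z := rfl
    have := congrArg Iso.inv (Iso.ext (braid_hexagon Z X Y) : (α_ Z X Y) ≪≫ braid Z (X ⊗ Y) ≪≫ α_ X Y Z =
      whiskerRightIso (braid Z X) Y ≪≫ α_ X Z Y ≪≫ whiskerLeftIso X (braid Z Y))
    simp at this
    exact this
  symmetry X Y := (braid X Y).hom_inv_id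

end Cotensor

end Comod

end Comodules

/-- A nonempty finite product of fields. -/
class IsFiniteProductOfFields (k : Type u) [CommRing k] : Prop where
  exists_ringEquiv : ∃ (n : ℕ) (_ : n ≠ 0) (F : Fin n → Type u) (_ : ∀ i, Field (F i)),
    Nonempty (k ≃+* ∀ i, F i)

lemma IsFiniteProductOfFields.isSemisimpleRing (k : Type u) [CommRing k]
    [h : IsFiniteProductOfFields k] : IsSemisimpleRing k := by
  obtain ⟨n, _, F, _, ⟨e⟩⟩ := h
  exact e.symm.isSemisimpleRing

section Flat

open HomologicalComplex

variable {k : Type u} [CommRing k]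

/-- The summands `K i ⊗ Z j` of the degree `n` part of `K ⊗ Z`. -/
noncomputable def tensorEvalDiagram (Z : ChainComplex (ModuleCat.{u} k) ℕ) (n : ℕ) :
    ChainComplex (ModuleCat.{u} k) ℕ ⥤
      (Discrete {p : ℕ × ℕ // p.1 + p.2 = n} ⥤ ModuleCat.{u} k) where
  obj K := Discrete.functor (fun p => K.X p.1.1 ⊗ Z.X p.1.2)
  map f := Discrete.natTrans (fun p => f.f p.as.1.1 ▷ Z.X p.as.1.2)
  map_id K := by ext; simp
  map_comp f g := by ext; simp

instance finite_antidiagonal (n : ℕ) : Finite {p : ℕ × ℕ // p.1 + p.2 = n} :=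
  (Finset.HasAntidiagonal.antidiagonal n).finite_toSet.subset (fun p (hp : p.1 + p.2 = n) => by simpa using hp)

/-- The degree `n` part of `K ⊗ Z` is the direct sum of the `K i ⊗ Z j`. -/
noncomputable def tensorEvalIso (Z : ChainComplex (ModuleCat.{u} k) ℕ) (n : ℕ) :
    tensorEvalDiagram Z n ⋙ colim ≅
      tensorRight Z ⋙ HomologicalComplex.eval (ModuleCat.{u} k) (ComplexShape.down ℕ) n :=
  NatIso.ofComponents (fun K => Iso.refl _) (fun {K L} f => by
    refine (Category.comp_id _).trans (Eq.trans ?_ (Category.id_comp _).symm)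
    refine colimit.hom_ext ?_
    rintro ⟨⟨i, j⟩, h⟩
    refine (colimit.ι_map _ _).trans ?_
    have := HomologicalComplex.ι_mapBifunctorMap f (𝟙 Z) (curriedTensor (ModuleCat.{u} k)) (ComplexShape.down ℕ) i j n h
    refine Eq.trans ?_ this.symm
    dsimp
    simp
    rfl)

/-- Over a finite product of fields, tensor products of complexes preserve finite limits. -/
instance preservesFiniteLimits_tensorRight [IsFiniteProductOfFields k] (Z : ChainComplex (ModuleCat.{u} k) ℕ) :
    PreservesFiniteLimits (tensorRight Z) where
  preservesFiniteLimits J _ _ := by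
    have := IsFiniteProductOfFields.isSemisimpleRing k
    refine preservesLimitsOfShape_of_eval _ (fun n => ?_)
    have : PreservesLimitsOfShape J (tensorEvalDiagram Z n) := by
      refine preservesLimitsOfShape_of_evaluation _ _ (fun p => ?_)
      have e : HomologicalComplex.eval (ModuleCat.{u} k) (ComplexShape.down ℕ) p.as.1.1 ⋙
          tensorRight (Z.X p.as.1.2) ≅ tensorEvalDiagram Z n ⋙ (evaluation _ _).obj p :=
        NatIso.ofComponents (fun K => Iso.refl _) (fun f =>
          (Category.comp_id _).trans (Category.id_comp _).symm)
      have : PreservesFiniteLimits (tensorRight (Z.X p.as.1.2)) := by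
        have : Module.Projective k (Z.X p.as.1.2) := Module.projective_of_isSemisimpleRing _ _
        have : Module.Flat k (Z.X p.as.1.2) := Module.Flat.of_projective
        exact (Module.Flat.iff_preservesFiniteLimits_tensorRight _).1 this
      exact preservesLimitsOfShape_of_natIso e
    exact preservesLimitsOfShape_of_natIso (tensorEvalIso Z n)
end Flat

/-- A dg-coalgebra `C` is simply connected if `C₀ = k` and `C₁ = 0`. -/
structure IsSimplyConnected {k : Type u} [CommRing k] (C : ChainComplex (ModuleCat.{u} k) ℕ) :
    Prop where
  zero : Nonempty (C.X 0 ≅ ModuleCat.of k k)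
  one : IsZero (C.X 1)

section Comonoidal

open HomotopicalAlgebra

/-- A symmetric comonoidal model category: a category with a model structure and a symmetric monoidal
structure, such that tensoring with a fibrant object on either side preserves fibrant objects and weak
equivalences between fibrant objects, and such that, for any fibrant replacement of the unit and any
fibrant object `X`, the induced morphism `X ≅ 𝟙 ⊗ X ⟶ J ⊗ X` is a weak equivalence. -/
class SymmetricComonoidalModelCategory (D : Type u) [Category.{v} D] [ModelCategory D]
    [MonoidalCategory D] [SymmetricCategory D] : Prop where
  isFibrant_tensor (X Y : D) [IsFibrant X] [IsFibrant Y] : IsFibrant (X ⊗ Y)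
  weakEquivalence_whiskerLeft (X : D) [IsFibrant X] {Y Z : D} [IsFibrant Y] [IsFibrant Z]
    (f : Y ⟶ Z) [WeakEquivalence f] : WeakEquivalence (X ◁ f)
  weakEquivalence_whiskerRight (X : D) [IsFibrant X] {Y Z : D} [IsFibrant Y] [IsFibrant Z]
    (f : Y ⟶ Z) [WeakEquivalence f] : WeakEquivalence (f ▷ X)
  weakEquivalence_unit {J : D} [IsFibrant J] (i : 𝟙_ D ⟶ J) [WeakEquivalence i] (X : D)
    [IsFibrant X] : WeakEquivalence ((λ_ X).inv ≫ i ▷ X)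

end Comonoidal

end DGComod

/-! The ring `k` is semisimple, so tensoring is exact and acyclic complexes are contractible, hence
both injective and projective. Comodule maps `X ⟶ cofree W` are chain maps `X.A ⟶ W`, so cofree
comodules on acyclic complexes are injective. Let `J` be the contractible complex with the unit of
`k`-modules in degrees 1 and 0, and `S` its quotient by the unit in degree 0. Every `X` embeds in
`cofree (J ⊗ X)`, so a map `X ⟶ Y` factors as a monomorphism into `Y ⊞ cofree (J ⊗ X)` followed by
the projection, and the maps with the right lifting property against monomorphisms are retracts of
such projections. This gives the first factorization and shows that these maps are
quasi-isomorphisms.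

For the second factorization it then suffices to treat a monomorphism `X ⟶ Y` with quotient `Q`. If
`P ⟶ Q` is a fibration with `P` acyclic, then `X ⟶ Y ×_Q P` has cokernel `P`, so it is a
quasi-isomorphism, and `Y ×_Q P ⟶ Y` is a fibration. Such a `P` is the limit of a Postnikov tower:
the lowest homology `V`, in degree `n`, is killed by mapping to the cofree comodule on `V` in degree
`n` and pulling back the cofree comodule on a disk (`exists_killing`). Simple connectivity says that
tensoring `V` in degree `n` with `C` adds nothing in degrees `n` and `n + 1`. The tower stabilizes
in each degree, so tensor products commute with its limit.

The comonoidal axioms rest on `isFibrant_iff`: `X` is fibrant exactly when `J ⊗ X` is injective. If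
`J ⊗ E` is injective, then `E` is the kernel of the fibration `J ⊗ E ⟶ S ⊗ E`: maps from acyclic
comodules are lifted one degree at a time, because `C₀ = k` and `C₁ = 0` make the coaction trivial
on the lowest nonzero degrees (`exists_lift_step`). Conversely, the tower for the embedding `X ⟶
cofree (J ⊗ X)` exhibits a fibrant `X` as a retract of some `E` with `J ⊗ E` injective.

Then `C` is fibrant because `J ⊗ C` is cofree. The injective `J ⊗ X` is a retract of a cofree
comodule, and `cofree W □ Y ≅ W ⊗ Y`, so `J ⊗ (X □ Y)` is a retract of `X ⊗ (J ⊗ Y)`, which is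
injective. The same isomorphism shows that `- □ Z` sends trivial fibrations to quasi-isomorphisms,
and Ken Brown's lemma extends this to weak equivalences between fibrant objects. -/

namespace DGComod

/-! ### The comodules `M ⊗ X`, cofree comodules and their cotensor products -/

section LeftTensor

open scoped ComonObj

variable {V : Type u} [Category.{v} V] [MonoidalCategory V]

namespace Comod

variable {C : V} [ComonObj C]

/-- The comodule `M ⊗ X`, with the coaction of `X`. -/
abbrev leftTensor (M : V) (X : Comod C) : Comod C :=
  mk' (M ⊗ X.A) (M ◁ X.coact ≫ (α_ M X.A C).inv)
    (by
      rw [Category.assoc, ← associator_inv_naturality_right, ← whiskerLeft_comp_assoc, coact_counit]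
      simp)
    (by
      have h := X.coact_coassoc
      rw [Category.assoc, ← associator_inv_naturality_right, ← whiskerLeft_comp_assoc, h]
      simp only [comp_whiskerRight, whiskerLeft_comp, Category.assoc, whisker_assoc]
      monoidal)

lemma leftTensor_coact (M : V) (X : Comod C) :
    (leftTensor M X).coact = M ◁ X.coact ≫ (α_ M X.A C).inv := rfl

/-- Functoriality of `M ⊗ X` in both variables. -/
abbrev leftTensorMap {M M' : V} (m : M ⟶ M') {X X' : Comod C} (f : X ⟶ X') :
    leftTensor M X ⟶ leftTensor M' X' :=
  homMk (m ⊗ₘ f.f) (by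
    have h := hom_coact f
    rw [leftTensor_coact, leftTensor_coact, Category.assoc, ← tensorHom_id,
      ← associator_inv_naturality, ← id_tensorHom, ← id_tensorHom, tensorHom_comp_tensorHom_assoc,
      tensorHom_comp_tensorHom_assoc, tensorHom_id, h, Category.id_comp, Category.comp_id])

/-- `M ⊗ -` as a functor on comodules. -/
@[simps]
def leftTensorFunctor (M : V) : Comod C ⥤ Comod C where
  obj X := leftTensor M X
  map f := leftTensorMap (𝟙 M) f
  map_id X := by ext; exact id_tensorHom_id _ _
  map_comp f g := by
    ext
    simp [homMk]

/-- The cofree comodule `W ⊗ C`. -/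
abbrev cofree (W : V) : Comod C := leftTensor W (self C)

lemma cofree_coact (W : V) : (cofree W : Comod C).coact = W ◁ Δ[C] ≫ (α_ W C C).inv := rfl

/-- The morphism to a cofree comodule determined by a morphism in the base category. -/
abbrev toCofree {X : Comod C} {W : V} (f : X.A ⟶ W) : X ⟶ cofree W :=
  homMk (X.coact ≫ f ▷ C) (by
    rw [cofree_coact, Category.assoc, ← whisker_exchange_assoc, reassoc_of% coact_coassoc]
    simp)

lemma toCofree_f {X : Comod C} {W : V} (f : X.A ⟶ W) : (toCofree f).f = X.coact ≫ f ▷ C := rfl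

lemma toCofree_counit {X : Comod C} {W : V} (f : X.A ⟶ W) :
    (toCofree f).f ≫ W ◁ ε[C] ≫ (ρ_ W).hom = f := by
  rw [toCofree_f, Category.assoc, ← whisker_exchange_assoc, reassoc_of% coact_counit]
  simp

/-- Together with `toCofree_counit` this is the adjunction between the forgetful functor and
`cofree`; it rests on the counitality of `C`. -/
lemma eq_toCofree {X : Comod C} {W : V} (f : X ⟶ cofree W) :
    f = toCofree (f.f ≫ W ◁ ε[C] ≫ (ρ_ W).hom) := by
  ext
  have h := hom_coact f
  rw [cofree_coact] at h
  rw [toCofree_f, comp_whiskerRight, reassoc_of% h]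
  simp only [comp_whiskerRight, whisker_assoc, Category.assoc, Iso.inv_hom_id_assoc,
    ← whiskerLeft_comp_assoc, ComonObj.counit_comul]
  simp

lemma toCofree_comp {X Y : Comod C} {W : V} (g : X ⟶ Y) (f : Y.A ⟶ W) :
    g ≫ toCofree f = toCofree (g.f ≫ f) := by
  ext
  rw [Comonad.Coalgebra.comp_f, toCofree_f, toCofree_f, comp_whiskerRight,
    reassoc_of% (hom_coact g)]

/-- Functoriality of cofree comodules. -/
abbrev cofreeMap {W W' : V} (f : W ⟶ W') : (cofree W : Comod C) ⟶ cofree W' :=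
  leftTensorMap f (𝟙 _)

lemma toCofree_cofreeMap {X : Comod C} {W W' : V} (f : X.A ⟶ W) (g : W ⟶ W') :
    toCofree f ≫ cofreeMap g = toCofree (f ≫ g) := by
  ext
  rw [Comonad.Coalgebra.comp_f, toCofree_f, toCofree_f]
  simp [homMk]

/-- The coaction, as a morphism of comodules to a cofree comodule. -/
abbrev coactHom (X : Comod C) : X ⟶ cofree X.A := homMk X.coact (by
  rw [cofree_coact, reassoc_of% coact_coassoc]
  simp)

/-- The associativity `M ⊗ (N ⊗ X) ≅ (M ⊗ N) ⊗ X`. -/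
def leftTensorAssoc (M N : V) (X : Comod C) : leftTensor M (leftTensor N X) ≅ leftTensor (M ⊗ N) X where
  hom := homMk (α_ M N X.A).inv (by
    rw [leftTensor_coact M, leftTensor_coact N, leftTensor_coact]
    simp)
  inv := homMk (α_ M N X.A).hom (by
    rw [leftTensor_coact M, leftTensor_coact N, leftTensor_coact]
    simp)
  hom_inv_id := by ext; exact Iso.inv_hom_id _
  inv_hom_id := by ext; exact Iso.hom_inv_id _

/-- The braiding of two factors of `M ⊗ N ⊗ X`. -/
def leftTensorSwap [SymmetricCategory V] (M N : V) (X : Comod C) :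
    leftTensor M (leftTensor N X) ⟶ leftTensor N (leftTensor M X) :=
  homMk ((α_ M N X.A).inv ≫ (β_ M N).hom ▷ X.A ≫ (α_ N M X.A).hom) (by
    change (M ◁ (N ◁ X.coact ≫ (α_ N X.A C).inv) ≫ (α_ M (N ⊗ X.A) C).inv) ≫ _ =
      _ ≫ (N ◁ (M ◁ X.coact ≫ (α_ M X.A C).inv) ≫ (α_ N (M ⊗ X.A) C).inv)
    have e := whisker_exchange (β_ M N).hom X.coact
    have e' : N ◁ M ◁ X.coact = (α_ N M X.A).inv ≫ (N ⊗ M) ◁ X.coact ≫ (α_ N M (X.A ⊗ C)).hom := by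
      simp
    have e'' : M ◁ N ◁ X.coact = (α_ M N X.A).inv ≫ (M ⊗ N) ◁ X.coact ≫ (α_ M N (X.A ⊗ C)).hom := by
      simp
    simp only [whiskerLeft_comp, e', e'', Category.assoc, Iso.hom_inv_id_assoc, ← reassoc_of% e]
    simp only [comp_whiskerRight, whiskerRight_tensor, Category.assoc]
    monoidal)

lemma leftTensorSwap_swap [SymmetricCategory V] (M N : V) (X : Comod C) :
    leftTensorSwap M N X ≫ leftTensorSwap N M X = 𝟙 _ := by
  ext
  change ((α_ M N X.A).inv ≫ (β_ M N).hom ▷ X.A ≫ (α_ N M X.A).hom) ≫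
    (α_ N M X.A).inv ≫ (β_ N M).hom ▷ X.A ≫ (α_ M N X.A).hom = 𝟙 _
  simp only [Category.assoc, Iso.hom_inv_id_assoc, ← comp_whiskerRight_assoc,
    SymmetricCategory.symmetry]
  simp

section Cotensor

variable [SymmetricCategory V] [HasEqualizers V]
  [∀ Z : V, PreservesFiniteLimits (tensorRight Z)] [IsCommComonObj C]

lemma exists_leftTensorCotensorHom (M : V) (X Y : Comod C) :
    ∃ f : leftTensor M (cotensor X Y) ⟶ cotensor (leftTensor M X) Y,
      f.f ≫ incl (leftTensor M X) Y = M ◁ incl X Y ≫ (α_ M X.A Y.A).inv := by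
  have h := incl_condition X Y
  have h' := coact_incl X Y
  refine exists_hom (W := leftTensor M (cotensor X Y)) (X := leftTensor M X) (Y := Y)
    (M ◁ incl X Y ≫ (α_ M X.A Y.A).inv) ?_ ?_
  · calc _ = M ◁ (incl X Y ≫ X.coact ▷ Y.A ≫ (α_ X.A C Y.A).hom) ≫ (α_ M X.A (C ⊗ Y.A)).inv := by
          rw [leftTensor_coact]
          simp
      _ = _ := by
          rw [h]
          simp
  · calc _ = M ◁ ((cotensor X Y).coact ≫ incl X Y ▷ C) ≫ (α_ M (X.A ⊗ Y.A) C).inv ≫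
          (α_ M X.A Y.A).inv ▷ C := by
          rw [leftTensor_coact]
          simp
      _ = _ := by
          rw [h']
          simp

/-- `M ⊗ -` preserves the equalizer defining the cotensor product, which gives `l`; compatibility
with the coactions is checked after the monomorphism `(M ◁ incl X Y) ▷ C`. -/
lemma exists_leftTensorCotensorInv (M : V) (X Y : Comod C) :
    ∃ f : cotensor (leftTensor M X) Y ⟶ leftTensor M (cotensor X Y),
      f.f ≫ M ◁ incl X Y = incl (leftTensor M X) Y ≫ (α_ M X.A Y.A).hom := by
  have h := incl_condition (leftTensor M X) Y
  have h' := coact_incl (leftTensor M X) Y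
  rw [leftTensor_coact] at h
  obtain ⟨l, hl⟩ : ∃ l : (cotensor (leftTensor M X) Y).A ⟶ M ⊗ (cotensor X Y).A,
      l ≫ M ◁ incl X Y = incl (leftTensor M X) Y ≫ (α_ M X.A Y.A).hom :=
    exists_liftLeft X Y M (incl (leftTensor M X) Y ≫ (α_ M X.A Y.A).hom) (by
    have h₁ := h =≫ (α_ M X.A (C ⊗ Y.A)).hom
    calc _ = (incl (leftTensor M X) Y ≫ (M ◁ X.coact ≫ (α_ M X.A C).inv) ▷ Y.A ≫
          (α_ (M ⊗ X.A) C Y.A).hom) ≫ (α_ M X.A (C ⊗ Y.A)).hom := by simp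
      _ = _ := by rw [h]; simp)
  refine ⟨homMk l ?_, hl⟩
  have := mono_whiskerRight (M ◁ incl X Y) C
  have h₂ := coact_incl X Y
  rw [← cancel_mono ((M ◁ incl X Y) ▷ C), Category.assoc, Category.assoc, ← comp_whiskerRight, hl,
    leftTensor_coact, comp_whiskerRight, reassoc_of% h']
  calc _ = (incl (leftTensor M X) Y ≫ (α_ M X.A Y.A).hom) ≫ M ◁ X.A ◁ Y.coact ≫
        M ◁ (α_ X.A Y.A C).inv ≫ (α_ M (X.A ⊗ Y.A) C).inv := by simp
    _ = l ≫ M ◁ ((cotensor X Y).coact ≫ incl X Y ▷ C) ≫ (α_ M (X.A ⊗ Y.A) C).inv := by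
        rw [← hl, h₂]
        simp
    _ = _ := by simp

/-- The cotensor product commutes with `M ⊗ -` in the first variable. -/
lemma nonempty_leftTensorCotensorIso (M : V) (X Y : Comod C) :
    Nonempty (leftTensor M (cotensor X Y) ≅ cotensor (leftTensor M X) Y) := by
  obtain ⟨f, hf⟩ := exists_leftTensorCotensorHom M X Y
  obtain ⟨g, hg⟩ := exists_leftTensorCotensorInv M X Y
  refine ⟨⟨f, g, ?_, ?_⟩⟩
  · ext
    rw [← cancel_mono (M ◁ incl X Y)]
    rw [Comonad.Coalgebra.comp_f, Category.assoc, hg, reassoc_of% hf]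
    simp
  · apply hom_ext_incl
    rw [Comonad.Coalgebra.comp_f, Category.assoc, hf, reassoc_of% hg]
    simp

/-- The cotensor product with a cofree comodule. -/
lemma nonempty_cotensorCofreeIso (W : V) (Y : Comod C) :
    Nonempty (cotensor (cofree W) Y ≅ leftTensor W Y) := by
  obtain ⟨e⟩ := nonempty_leftTensorCotensorIso W (self C) Y
  exact ⟨e.symm ≪≫ (leftTensorFunctor W).mapIso (asIso (leftUnitInv Y)).symm⟩

end Cotensor

end Comod

end LeftTensor

/-! ### Complexes over a semisimple ring: acyclic, contractible, injective, projective -/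

section Semisimple

open HomologicalComplex

variable {k : Type u} [CommRing k]

instance monoidalPreadditive_chainComplex :
    MonoidalPreadditive (ChainComplex (ModuleCat.{u} k) ℕ) where
  whiskerLeft_zero {X Y Z} := by
    ext n : 1
    refine mapBifunctor.hom_ext (fun i j h => ?_)
    exact (ι_mapBifunctorMap (𝟙 X) (0 : Y ⟶ Z) (curriedTensor (ModuleCat.{u} k)) _ i j n h).trans (by simp)
  zero_whiskerRight {X Y Z} := by
    ext n : 1
    refine mapBifunctor.hom_ext (fun i j h => ?_)
    exact (ι_mapBifunctorMap (0 : Y ⟶ Z) (𝟙 X) (curriedTensor (ModuleCat.{u} k)) _ i j n h).trans (by simp)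
  whiskerLeft_add {X Y Z} f g := by
    ext n : 1
    refine mapBifunctor.hom_ext (fun i j h => ?_)
    have e := fun f' : Y ⟶ Z => ι_mapBifunctorMap (𝟙 X) f' (curriedTensor (ModuleCat.{u} k)) (ComplexShape.down ℕ) i j n h
    refine (e _).trans (Eq.trans ?_ (Preadditive.comp_add _ _ _ _ _ _).symm)
    refine Eq.trans ?_ (congrArg₂ (· + ·) (e f).symm (e g).symm)
    simp
  add_whiskerRight {X Y Z} f g := by
    ext n : 1
    refine mapBifunctor.hom_ext (fun i j h => ?_)
    have e := fun f' : Y ⟶ Z => ι_mapBifunctorMap f' (𝟙 X) (curriedTensor (ModuleCat.{u} k)) (ComplexShape.down ℕ) i j n h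
    refine (e _).trans (Eq.trans ?_ (Preadditive.comp_add _ _ _ _ _ _).symm)
    refine Eq.trans ?_ (congrArg₂ (· + ·) (e f).symm (e g).symm)
    simp

/-- The tensor product with a contractible complex is contractible. -/
noncomputable def homotopyTensor {K : ChainComplex (ModuleCat.{u} k) ℕ} (H : Homotopy (𝟙 K) 0)
    (L : ChainComplex (ModuleCat.{u} k) ℕ) : Homotopy (𝟙 (K ⊗ L)) 0 :=
  ((Homotopy.ofEq (id_whiskerRight K L).symm).trans
    (mapBifunctorMapHomotopy₁ H (𝟙 L) (curriedTensor (ModuleCat.{u} k)) (ComplexShape.down ℕ))).trans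
      (Homotopy.ofEq (MonoidalPreadditive.zero_whiskerRight (X := L)))

lemma acyclic_of_homotopy {K : ChainComplex (ModuleCat.{u} k) ℕ} (H : Homotopy (𝟙 K) 0) :
    K.Acyclic := fun i => by
  rw [exactAt_iff_isZero_homology, IsZero.iff_id_eq_zero, ← homologyMap_id, H.homologyMap_eq,
    homologyMap_zero]

variable [IsFiniteProductOfFields k]

instance projective_moduleCat (M : ModuleCat.{u} k) : Projective M := by
  have := IsFiniteProductOfFields.isSemisimpleRing k
  rw [← IsProjective.iff_projective]
  exact Module.projective_of_isSemisimpleRing _ _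

instance injective_moduleCat (M : ModuleCat.{u} k) : Injective M := by
  have := IsFiniteProductOfFields.isSemisimpleRing k
  have := Module.injective_of_isSemisimpleRing k M
  exact Module.injective_object_of_injective_module k M

/-- The projection onto the image has a section and the inclusion of the image has a retraction, all
modules being projective and injective; `g` is their composite. -/
lemma exists_comp_comp_eq {M N : ModuleCat.{u} k} (f : M ⟶ N) : ∃ g : N ⟶ M, f ≫ g ≫ f = f := by
  obtain ⟨I, p, i, _, _, rfl⟩ : ∃ (I : ModuleCat.{u} k) (p : M ⟶ I) (i : I ⟶ N) (_ : Epi p) (_ : Mono i),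
      p ≫ i = f := ⟨_, factorThruImage f, image.ι f, inferInstance, inferInstance, image.fac f⟩
  exact ⟨Injective.factorThru (𝟙 _) i ≫ Projective.factorThru (𝟙 _) p, by simp⟩

/-- Since `A` is projective, the epimorphism that refines `A` splits, so cycles bound without
refinement. -/
lemma exists_lift_of_exactAt {K : ChainComplex (ModuleCat.{u} k) ℕ} {i : ℕ} (h : K.ExactAt i)
    {A : ModuleCat.{u} k} (x : A ⟶ K.X i) (hx : ∀ j, x ≫ K.d i j = 0) :
    ∃ y : A ⟶ K.X (i + 1), y ≫ K.d (i + 1) i = x := by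
  obtain ⟨A', π, _, y, hy⟩ := (K.exactAt_iff_exact_up_to_refinements (i + 1) i _ (by simp) rfl).1 h x
    (hx _)
  refine ⟨Projective.factorThru (𝟙 _) π ≫ y, ?_⟩
  rw [Category.assoc, ← hy, Projective.factorThru_comp_assoc, Category.id_comp]

lemma exactAt_of_exists_lift {K : ChainComplex (ModuleCat.{u} k) ℕ} {i : ℕ}
    (h : ∀ {A : ModuleCat.{u} k} (x : A ⟶ K.X i), (∀ j, x ≫ K.d i j = 0) →
      ∃ y : A ⟶ K.X (i + 1), y ≫ K.d (i + 1) i = x) : K.ExactAt i := by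
  refine (K.exactAt_iff_exact_up_to_refinements (i + 1) i _ (by simp) rfl).2 (fun A x hx => ?_)
  obtain ⟨y, hy⟩ := h x (fun j => by
    by_cases hj : (ComplexShape.down ℕ).Rel i j
    · rwa [← (ComplexShape.down ℕ).next_eq' hj]
    · rw [K.shape _ _ hj, comp_zero])
  exact ⟨A, 𝟙 A, inferInstance, y, by rw [hy, Category.id_comp]⟩

/-- Over a finite product of fields, acyclic complexes are contractible. -/
lemma nonempty_homotopy_of_acyclic {K : ChainComplex (ModuleCat.{u} k) ℕ} (hK : K.Acyclic) :
    Nonempty (Homotopy (𝟙 K) 0) := by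
  -- As `d ≫ g ≫ d = d`, the map `𝟙 - d ≫ g` lands in the cycles, which are boundaries, and
  -- following it by the next `g` gives the contraction. For `i = 0` the truncated `i - 1` is `0`
  -- and `K.d 0 0 = 0`, so the correction disappears.
  choose g hg using fun i j => exists_comp_comp_eq (K.d i j)
  have key (i j) (hij : (ComplexShape.down ℕ).Rel j i) :
      (𝟙 _ - K.d i (i - 1) ≫ g i (i - 1)) ≫ g j i ≫ K.d j i = 𝟙 _ - K.d i (i - 1) ≫ g i (i - 1) := by
    obtain rfl : i + 1 = j := hij
    obtain ⟨y, hy⟩ := exists_lift_of_exactAt (hK i) (𝟙 _ - K.d i (i - 1) ≫ g i (i - 1)) (fun j => by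
      by_cases hj : j + 1 = i
      · subst hj
        simp [hg]
      · rw [K.shape _ _ hj, comp_zero])
    rw [← hy, Category.assoc, hg]
  refine ⟨⟨fun i j => if (ComplexShape.down ℕ).Rel j i then
    (𝟙 _ - K.d i (i - 1) ≫ g i (i - 1)) ≫ g j i else 0, fun i j h => if_neg h, fun i => ?_⟩⟩
  rw [prevD_eq _ (show (ComplexShape.down ℕ).Rel (i + 1) i from rfl),
    if_pos (show (ComplexShape.down ℕ).Rel (i + 1) i from rfl), Category.assoc, key _ _ rfl,
    zero_f, add_zero, id_f]
  obtain _ | i := i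
  · rw [dNext_eq_zero _ _ (by simp), K.shape 0 _ (by simp)]
    simp
  · rw [dNext_eq _ (show (ComplexShape.down ℕ).Rel (i + 1) i from rfl),
      if_pos (show (ComplexShape.down ℕ).Rel (i + 1) i from rfl)]
    simp [Preadditive.sub_comp, Preadditive.comp_sub, reassoc_of% (K.d_comp_d)]

/-- Contractible complexes are injective. -/
lemma injective_of_homotopy {K : ChainComplex (ModuleCat.{u} k) ℕ} (H : Homotopy (𝟙 K) 0) :
    Injective K where
  factors {A B} f i _ := by
    have (n : ℕ) : Mono (i.f n) := inferInstance
    let r (n : ℕ) : B.X n ⟶ A.X n := Injective.factorThru (𝟙 _) (i.f n)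
    have hr (n : ℕ) : i.f n ≫ r n = 𝟙 _ := Injective.comp_factorThru _ _
    -- The `r n` need not form a chain map, but a null-homotopic map is a chain map for any choice
    -- of components. On `A` the `r` cancels, and what remains is `f` followed by the identity
    -- written as a boundary of `H`.
    refine ⟨Homotopy.nullHomotopicMap (fun a b => r a ≫ f.f a ≫ H.hom a b), ?_⟩
    rw [Homotopy.comp_nullHomotopicMap]
    have e : Homotopy.nullHomotopicMap H.hom = 𝟙 K := by
      ext n : 1
      have := H.comm n
      simp only [zero_f, add_zero] at this
      exact this.symm
    simp only [reassoc_of% hr]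
    rw [← Homotopy.comp_nullHomotopicMap, e, Category.comp_id]

/-- Contractible complexes are projective. -/
lemma projective_of_homotopy {K : ChainComplex (ModuleCat.{u} k) ℕ} (H : Homotopy (𝟙 K) 0) :
    Projective K where
  factors {A B} f p _ := by
    have (n : ℕ) : Epi (p.f n) := inferInstance
    let s (n : ℕ) : B.X n ⟶ A.X n := Projective.factorThru (𝟙 _) (p.f n)
    have hs (n : ℕ) : s n ≫ p.f n = 𝟙 _ := Projective.factorThru_comp _ _
    refine ⟨Homotopy.nullHomotopicMap (fun a b => H.hom a b ≫ f.f b ≫ s b), ?_⟩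
    rw [Homotopy.nullHomotopicMap_comp]
    have e : Homotopy.nullHomotopicMap H.hom = 𝟙 K := by
      ext n : 1
      have := H.comm n
      simp only [zero_f, add_zero] at this
      exact this.symm
    simp only [Category.assoc, hs, Category.comp_id]
    rw [← Homotopy.nullHomotopicMap_comp, e, Category.id_comp]

lemma injective_of_acyclic {K : ChainComplex (ModuleCat.{u} k) ℕ} (hK : K.Acyclic) : Injective K :=
  injective_of_homotopy (nonempty_homotopy_of_acyclic hK).some

lemma projective_of_acyclic {K : ChainComplex (ModuleCat.{u} k) ℕ} (hK : K.Acyclic) :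
    Projective K :=
  projective_of_homotopy (nonempty_homotopy_of_acyclic hK).some

lemma acyclic_tensor {K : ChainComplex (ModuleCat.{u} k) ℕ} (hK : K.Acyclic)
    (L : ChainComplex (ModuleCat.{u} k) ℕ) : (K ⊗ L).Acyclic :=
  acyclic_of_homotopy (homotopyTensor (nonempty_homotopy_of_acyclic hK).some L)

lemma acyclic_of_iso {K L : ChainComplex (ModuleCat.{u} k) ℕ} (hK : K.Acyclic) (e : K ≅ L) :
    L.Acyclic :=
  fun i => (hK i).of_iso e

/-- The contractible complex with `V` in degrees `n + 1` and `n`. -/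
noncomputable abbrev disk (V : ModuleCat.{u} k) (n : ℕ) : ChainComplex (ModuleCat.{u} k) ℕ :=
  double (𝟙 V) (show (ComplexShape.down ℕ).Rel (n + 1) n from rfl)

lemma acyclic_disk (V : ModuleCat.{u} k) (n : ℕ) : (disk V n).Acyclic := by
  intro i
  apply exactAt_of_exists_lift
  intro A x hx
  by_cases h₀ : i = n
  · subst h₀
    refine ⟨x ≫ (doubleXIso₁ (𝟙 V) rfl (by simp)).hom ≫ (doubleXIso₀ (𝟙 V) rfl).inv, ?_⟩
    rw [double_d _ _ (by simp)]
    simp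
  by_cases h₁ : i = n + 1
  · subst h₁
    have h := hx n
    rw [double_d _ _ (by simp)] at h
    simp only [Category.id_comp] at h
    rw [← Category.assoc, Preadditive.IsIso.comp_right_eq_zero,
      Preadditive.IsIso.comp_right_eq_zero] at h
    exact ⟨0, by rw [h, zero_comp]⟩
  · exact ⟨0, (isZero_double_X _ _ _ h₁ h₀).eq_of_tgt _ _⟩

/-- The projection of the disk to the complex with `V` in degree `n + 1`. -/
noncomputable def diskToSingle (V : ModuleCat.{u} k) (n : ℕ) :
    disk V n ⟶ (single (ModuleCat.{u} k) (ComplexShape.down ℕ) (n + 1)).obj V :=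
  mkHomToSingle (doubleXIso₀ (𝟙 V) rfl).hom (fun i hi => by
    rw [double_d_eq_zero₁ _ _ _ _ (by simp), zero_comp])

instance epi_diskToSingle (V : ModuleCat.{u} k) (n : ℕ) : Epi (diskToSingle V n) := by
  have (i : ℕ) : Epi ((diskToSingle V n).f i) := by
    by_cases h : i = n + 1
    · subst h
      rw [diskToSingle, mkHomToSingle_f]
      infer_instance
    · exact ⟨fun _ _ _ => (isZero_single_obj_X _ _ _ _ h).eq_of_src _ _⟩
  exact HomologicalComplex.epi_of_epi_f _ this

/-- The inclusion of the unit in the disk. -/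
noncomputable def unitToDisk : 𝟙_ (ChainComplex (ModuleCat.{u} k) ℕ) ⟶ disk (𝟙_ (ModuleCat.{u} k)) 0 :=
  mkHomFromSingle (doubleXIso₁ (𝟙 _) rfl (by simp)).inv (fun i hi => by simp at hi)

instance mono_unitToDisk : Mono (unitToDisk (k := k)) := by
  have (i : ℕ) : Mono ((unitToDisk (k := k)).f i) := by
    by_cases h : i = 0
    · subst h
      rw [unitToDisk, mkHomFromSingle_f]
      infer_instance
    · exact ⟨fun _ _ _ => (isZero_single_obj_X _ _ _ _ h).eq_of_tgt _ _⟩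
  exact HomologicalComplex.mono_of_mono_f _ this

end Semisimple

/-! ### Tensoring with graded maps that need not commute with differentials -/

section GradedTensor

open HomologicalComplex

variable {k : Type u} [CommRing k] {K L M : ChainComplex (ModuleCat.{u} k) ℕ}

/-- The map `φ ⊗ Z` in degree `n`, for a family of maps `φ` which need not commute with the
differentials. -/
noncomputable def gradedWhisker (φ : ∀ i, K.X i ⟶ L.X i) (Z : ChainComplex (ModuleCat.{u} k) ℕ)
    (n : ℕ) : (K ⊗ Z).X n ⟶ (L ⊗ Z).X n :=
  GradedObject.Monoidal.tensorHom (show K.X ⟶ L.X from φ) (𝟙 Z.X) n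

lemma gradedWhisker_f (f : K ⟶ L) (Z : ChainComplex (ModuleCat.{u} k) ℕ) (n : ℕ) :
    gradedWhisker f.f Z n = (f ▷ Z).f n := rfl

lemma ι_gradedWhisker (φ : ∀ i, K.X i ⟶ L.X i) (Z : ChainComplex (ModuleCat.{u} k) ℕ)
    (i j n : ℕ) (h : i + j = n) :
    ιTensorObj K Z i j n h ≫ gradedWhisker φ Z n = φ i ▷ Z.X j ≫ ιTensorObj L Z i j n h :=
  (GradedObject.Monoidal.ι_tensorHom (show K.X ⟶ L.X from φ) (𝟙 Z.X) i j n h).trans (by simp; rfl)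

lemma ι_whiskerLeft (K : ChainComplex (ModuleCat.{u} k) ℕ) {Z Z' : ChainComplex (ModuleCat.{u} k) ℕ}
    (f : Z ⟶ Z') (i j n : ℕ) (h : i + j = n) :
    ιTensorObj K Z i j n h ≫ (K ◁ f).f n = K.X i ◁ f.f j ≫ ιTensorObj K Z' i j n h :=
  (ι_mapBifunctorMap (𝟙 K) f (curriedTensor (ModuleCat.{u} k)) _ i j n h).trans (by simp)

lemma tensor_hom_ext {n : ℕ} {A : ModuleCat.{u} k} {f g : (K ⊗ L).X n ⟶ A}
    (h : ∀ i j (hij : i + j = n), ιTensorObj K L i j n hij ≫ f = ιTensorObj K L i j n hij ≫ g) :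
    f = g :=
  mapBifunctor.hom_ext h

lemma gradedWhisker_congr {φ ψ : ∀ i, K.X i ⟶ L.X i} {n : ℕ} (h : ∀ i ≤ n, φ i = ψ i)
    (Z : ChainComplex (ModuleCat.{u} k) ℕ) : gradedWhisker φ Z n = gradedWhisker ψ Z n :=
  tensor_hom_ext fun i j hij => by rw [ι_gradedWhisker, ι_gradedWhisker, h i (by lia)]

lemma gradedWhisker_comp (φ : ∀ i, K.X i ⟶ L.X i) (ψ : ∀ i, L.X i ⟶ M.X i)
    (Z : ChainComplex (ModuleCat.{u} k) ℕ) (n : ℕ) :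
    gradedWhisker φ Z n ≫ gradedWhisker ψ Z n = gradedWhisker (fun i => φ i ≫ ψ i) Z n :=
  tensor_hom_ext fun i j hij => by
    rw [← Category.assoc, ι_gradedWhisker, Category.assoc, ι_gradedWhisker, ι_gradedWhisker,
      comp_whiskerRight, Category.assoc]

lemma gradedWhisker_id (Z : ChainComplex (ModuleCat.{u} k) ℕ) (n : ℕ) :
    gradedWhisker (fun i => 𝟙 (K.X i)) Z n = 𝟙 _ :=
  tensor_hom_ext fun i j hij => by
    rw [ι_gradedWhisker, id_whiskerRight, Category.id_comp]
    exact (Category.comp_id _).symm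

lemma gradedWhisker_exchange (φ : ∀ i, K.X i ⟶ L.X i) {Z Z' : ChainComplex (ModuleCat.{u} k) ℕ}
    (f : Z ⟶ Z') (n : ℕ) :
    gradedWhisker φ Z n ≫ (L ◁ f).f n = (K ◁ f).f n ≫ gradedWhisker φ Z' n :=
  tensor_hom_ext fun i j hij => by
    rw [← Category.assoc, ι_gradedWhisker, Category.assoc, ι_whiskerLeft, ← Category.assoc _ _ (gradedWhisker _ _ _),
      ι_whiskerLeft, Category.assoc, ι_gradedWhisker, whisker_exchange_assoc]

lemma gradedWhisker_assoc_inv (φ : ∀ i, K.X i ⟶ L.X i) (Y Z : ChainComplex (ModuleCat.{u} k) ℕ)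
    (n : ℕ) :
    gradedWhisker φ (Y ⊗ Z) n ≫ (α_ L Y Z).inv.f n =
      (α_ K Y Z).inv.f n ≫ gradedWhisker (gradedWhisker φ Y) Z n := by
  have h : gradedWhisker (gradedWhisker φ Y) Z n ≫ (α_ L Y Z).hom.f n =
      (α_ K Y Z).hom.f n ≫ gradedWhisker φ (Y ⊗ Z) n := by
    have := congrFun (GradedObject.Monoidal.associator_naturality (show K.X ⟶ L.X from φ) (𝟙 Y.X) (𝟙 Z.X)) n
    refine Eq.trans ?_ (this.trans ?_)
    · rfl
    · refine congrArg (fun x => (α_ K Y Z).hom.f n ≫ x) ?_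
      rw [GradedObject.Monoidal.id_tensorHom_id]
      rfl
  have e₁ : (α_ K Y Z).inv.f n ≫ (α_ K Y Z).hom.f n = 𝟙 _ := by
    rw [← comp_f, Iso.inv_hom_id, id_f]
  have e₂ : (α_ L Y Z).hom.f n ≫ (α_ L Y Z).inv.f n = 𝟙 _ := by
    rw [← comp_f, Iso.hom_inv_id, id_f]
  calc _ = ((α_ K Y Z).inv.f n ≫ (α_ K Y Z).hom.f n) ≫ gradedWhisker φ (Y ⊗ Z) n ≫
        (α_ L Y Z).inv.f n := by rw [e₁, Category.id_comp]
    _ = (α_ K Y Z).inv.f n ≫ (gradedWhisker (gradedWhisker φ Y) Z n ≫ (α_ L Y Z).hom.f n) ≫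
        (α_ L Y Z).inv.f n := by rw [h]; simp only [Category.assoc]
    _ = _ := by rw [Category.assoc, e₂, Category.comp_id]

/-- If `g` is the identity in degree `0`, `Z` vanishes in degree `1` and `φ` vanishes in degrees at
most `n - 2`, then `φ ⊗ Z` factors through `g` in degree `n`. -/
lemma whiskerLeft_gradedWhisker {φ : ∀ i, K.X i ⟶ L.X i} {n : ℕ} (h : ∀ i, i + 2 ≤ n → φ i = 0)
    {Z : ChainComplex (ModuleCat.{u} k) ℕ} (hZ : IsZero (Z.X 1)) (g : Z ⟶ Z) (hg : g.f 0 = 𝟙 _) :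
    (K ◁ g).f n ≫ gradedWhisker φ Z n = gradedWhisker φ Z n :=
  tensor_hom_ext fun i j hij => by
    rw [← Category.assoc, ι_whiskerLeft, Category.assoc, ι_gradedWhisker, whisker_exchange_assoc]
    -- The summand `j = 1` vanishes, and `j ≥ 2` forces `i + 2 ≤ n`, where `φ i = 0`; only `j = 0`
    -- survives.
    match j with
    | 0 => rw [hg, whiskerLeft_id, Category.id_comp]
    | 1 =>
      have : IsZero (K.X i ⊗ Z.X 1) := (tensorLeft (K.X i)).map_isZero hZ
      exact this.eq_of_src _ _
    | j + 2 => simp [h i (by lia)]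

/-- Degree `n` of `K ⊗ Z` involves only `K i` with `i ≤ n`. The degreewise inverses need not form a
chain map, so they are tensored by `gradedWhisker`; their default value `0` above `n` is invisible
in degree `n`. -/
lemma isIso_whiskerRight_f (f : K ⟶ L) (n : ℕ)
    (h : ∀ i ≤ n, IsIso (f.f i)) (Z : ChainComplex (ModuleCat.{u} k) ℕ) : IsIso ((f ▷ Z).f n) := by
  have hr (i : ℕ) : ∃ r : L.X i ⟶ K.X i, i ≤ n → f.f i ≫ r = 𝟙 _ ∧ r ≫ f.f i = 𝟙 _ := by
    by_cases hi : i ≤ n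
    · have := h i hi
      exact ⟨inv (f.f i), by simp⟩
    · exact ⟨0, fun h => (hi h).elim⟩
  choose r hr using hr
  refine ⟨gradedWhisker r Z n, ?_, ?_⟩
  · rw [← gradedWhisker_f, gradedWhisker_comp, gradedWhisker_congr (ψ := fun i => 𝟙 _)
      (fun i hi => (hr i hi).1), gradedWhisker_id]
  · rw [← gradedWhisker_f, gradedWhisker_comp, gradedWhisker_congr (ψ := fun i => 𝟙 _)
      (fun i hi => (hr i hi).2), gradedWhisker_id]

lemma isZero_tensor_X (n : ℕ) (h : ∀ i j, i + j = n → IsZero (K.X i) ∨ IsZero (L.X j)) :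
    IsZero ((K ⊗ L).X n) := by
  rw [IsZero.iff_id_eq_zero]
  refine tensor_hom_ext fun i j hij => ?_
  rcases h i j hij with h | h
  · exact ((tensorRight (L.X j)).map_isZero h).eq_of_src _ _
  · exact ((tensorLeft (K.X i)).map_isZero h).eq_of_src _ _

end GradedTensor

/-! ### Finite limits and colimits of comodules, and injective cofree comodules -/

section ComodBasics

open HomologicalComplex Comod

variable {k : Type u} [CommRing k] {C : ChainComplex (ModuleCat.{u} k) ℕ} [ComonObj C]

instance additive_tensorComonad : (tensorComonad C).toFunctor.Additive :=
  inferInstanceAs (tensorRight C).Additive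

instance hasFiniteColimits_comod : HasFiniteColimits (Comod C) where
  out _ _ _ := hasColimitsOfShape_of_hasColimitsOfShape_createsColimitsOfShape (tensorComonad C).forget

instance preservesColimitsOfShape_forget (J : Type) [Category.{0} J] [FinCategory J] :
    PreservesColimitsOfShape J (tensorComonad C).forget :=
  inferInstance

/-- The forgetful functor creates finite colimits, so the cokernel of comodules is the cokernel of
complexes. -/
lemma exists_quotient {A B : Comod C} (i : A ⟶ B) [Mono i.f] : ∃ (Q : Comod C) (q : B ⟶ Q)
    (w : i.f ≫ q.f = 0), (ShortComplex.mk i.f q.f w).ShortExact ∧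
      ∀ {Z : Comod C} (g : B ⟶ Z), i ≫ g = 0 → ∃ h : Q ⟶ Z, q ≫ h = g := by
  let F := (tensorComonad C).forget
  have hw : i ≫ cokernel.π i = 0 := cokernel.condition i
  have hw' : i.f ≫ (cokernel.π i).f = 0 := by
    rw [← Comonad.Coalgebra.comp_f, hw]
    rfl
  have hc : IsColimit (CokernelCofork.ofπ (f := i.f) (cokernel.π i).f hw') :=
    CokernelCofork.mapIsColimit _ (cokernelIsCokernel i) F
  refine ⟨cokernel i, cokernel.π i, hw', ?_, fun g hg => ⟨cokernel.desc i g hg, cokernel.π_desc _ _ _⟩⟩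
  have : Epi (cokernel.π i).f := Cofork.IsColimit.epi hc
  exact ShortComplex.ShortExact.mk' (ShortComplex.exact_of_g_is_cokernel _ hc) ‹_› ‹_›

variable [IsFiniteProductOfFields k]

instance preservesFiniteLimits_tensorComonad : PreservesFiniteLimits (tensorComonad C).toFunctor :=
  inferInstanceAs (PreservesFiniteLimits (tensorRight C))

instance preservesLimitsOfShape_tensorComonad (J : Type) [Category.{0} J] [FinCategory J] :
    PreservesLimitsOfShape J (tensorComonad C).toFunctor :=
  inferInstance

scoped instance hasFiniteLimits_comod : HasFiniteLimits (Comod C) where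
  out _ _ _ := hasLimitsOfShape_of_hasLimitsOfShape_createsLimitsOfShape (tensorComonad C).forget

instance preservesFiniteLimits_forget : PreservesFiniteLimits (tensorComonad C).forget where
  preservesFiniteLimits _ _ _ := inferInstance

instance hasBinaryBiproducts_comod : HasBinaryBiproducts (Comod C) :=
  HasBinaryBiproducts.of_hasBinaryProducts

lemma mono_iff_mono_f {X Y : Comod C} (f : X ⟶ Y) : Mono f ↔ Mono f.f :=
  ⟨fun _ => inferInstanceAs (Mono ((tensorComonad C).forget.map f)), fun h =>
    (tensorComonad C).forget.mono_of_mono_map h⟩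

instance mono_f {X Y : Comod C} (f : X ⟶ Y) [Mono f] : Mono f.f := (mono_iff_mono_f f).1 inferInstance

lemma isPullback_f {X Y Z W : Comod C} {a : X ⟶ Y} {b : X ⟶ Z} {c : Y ⟶ W} {d : Z ⟶ W}
    (h : IsPullback a b c d) : IsPullback a.f b.f c.f d.f :=
  h.map (tensorComonad C).forget

lemma isPullback_f_f {X Y Z W : Comod C} {a : X ⟶ Y} {b : X ⟶ Z} {c : Y ⟶ W} {d : Z ⟶ W}
    (h : IsPullback a b c d) (n : ℕ) : IsPullback (a.f.f n) (b.f.f n) (c.f.f n) (d.f.f n) :=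
  (isPullback_f h).map (HomologicalComplex.eval _ _ n)

/-- A morphism of comodules lifts through a monomorphism as soon as its underlying map does. -/
lemma exists_lift_of_mono {X Y Z : Comod C} (f : X ⟶ Z) (i : Y ⟶ Z) [Mono i.f] (l : X.A ⟶ Y.A)
    (h : l ≫ i.f = f.f) : ∃ g : X ⟶ Y, g ≫ i = f := by
  refine ⟨homMk l ?_, ?_⟩
  · have := mono_whiskerRight i.f C
    rw [← cancel_mono (i.f ▷ C), Category.assoc, Category.assoc, hom_coact i, ← comp_whiskerRight, h,
      hom_coact f, reassoc_of% h]
  · exact Comonad.Coalgebra.Hom.ext h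

/-- Cofree comodules on acyclic complexes are injective. -/
lemma injective_cofree {D : ChainComplex (ModuleCat.{u} k) ℕ} (hD : D.Acyclic) :
    Injective (cofree D : Comod C) where
  factors {A B} f i _ := by
    have := injective_of_acyclic hD
    rw [eq_toCofree f]
    exact ⟨toCofree (Injective.factorThru _ i.f), by rw [toCofree_comp, Injective.comp_factorThru]⟩

lemma acyclic_cofree {D : ChainComplex (ModuleCat.{u} k) ℕ} (hD : D.Acyclic) :
    (cofree D : Comod C).A.Acyclic :=
  acyclic_tensor hD C

variable (k) in
/-- A contractible complex into which the unit embeds. -/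
noncomputable def J : ChainComplex (ModuleCat.{u} k) ℕ := disk (𝟙_ _) 0

lemma acyclic_J : (J k).Acyclic := acyclic_disk _ _

variable (k) in
/-- The embedding of the unit in `J`. -/
noncomputable def unitToJ : 𝟙_ (ChainComplex (ModuleCat.{u} k) ℕ) ⟶ J k := unitToDisk

instance mono_unitToJ : Mono (unitToJ k) := mono_unitToDisk

/-- The embedding `X ⟶ J ⊗ X`. -/
noncomputable def toJ (X : Comod C) : X ⟶ leftTensor (J k) X :=
  homMk ((λ_ X.A).inv ≫ unitToJ k ▷ X.A) (by
    rw [leftTensor_coact, Category.assoc, ← whisker_exchange_assoc]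
    simp)

lemma toJ_f (X : Comod C) : (toJ X).f = (λ_ X.A).inv ≫ unitToJ k ▷ X.A := rfl

instance mono_toJ_f (X : Comod C) : Mono (toJ X).f := by
  have := mono_whiskerRight (unitToJ k) X.A
  rw [toJ_f]
  infer_instance

instance mono_coactHom_f (X : Comod C) : Mono (coactHom X).f :=
  show Mono X.coact from mono_of_mono_fac X.coact_counit

/-- The embedding of a comodule in a cofree comodule on an acyclic complex. -/
noncomputable def toCofreeJ (X : Comod C) : X ⟶ cofree (J k ⊗ X.A) :=
  toCofree (toJ X).f

instance mono_toCofreeJ_f (X : Comod C) : Mono (toCofreeJ X).f :=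
  mono_of_mono_fac (toCofree_counit (toJ X).f)

lemma injective_of_retract {X Y : Comod C} (i : X ⟶ Y) (r : Y ⟶ X) (h : i ≫ r = 𝟙 X) [Injective Y] :
    Injective X where
  factors {A B} f j _ := ⟨Injective.factorThru (f ≫ i) j ≫ r, by
    rw [Injective.comp_factorThru_assoc, Category.assoc, h, Category.comp_id]⟩

end ComodBasics

/-! ### The coaugmentation of a simply connected coalgebra -/

section Coaugmentation

open HomologicalComplex Comod
open scoped ComonObj

variable {k : Type u} [CommRing k] {C : ChainComplex (ModuleCat.{u} k) ℕ} [ComonObj C]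

lemma isIso_of_epi_of_iso_self {M N : ModuleCat.{u} k} (eM : M ≅ ModuleCat.of k k)
    (eN : N ≅ ModuleCat.of k k) (f : M ⟶ N) [Epi f] : IsIso f := by
  have h : IsIso (eM.inv ≫ f ≫ eN.hom) := by
    have h₁ : Function.Surjective (eM.inv ≫ f ≫ eN.hom).hom := by
      rw [← ModuleCat.epi_iff_surjective]
      infer_instance
    rw [ConcreteCategory.isIso_iff_bijective]
    exact OrzechProperty.bijective_of_surjective_endomorphism _ h₁
  have e : f = eM.hom ≫ (eM.inv ≫ f ≫ eN.hom) ≫ eN.inv := by simp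
  rw [e]
  infer_instance

/-- The isomorphism `C₀ ≅ k` is not assumed to be the counit. Surjective endomorphisms of `k` are
bijective, so it is enough that the counit is epi in degree 0. If it is killed by `u`, counitality
gives `C ◁ U = 0`; the given isomorphism extends to an epimorphism `p` from `C` to the unit, because
`C₁ = 0`, and exchanging `p` with `U` gives `p ≫ U = 0`. -/
lemma isIso_counit_f_zero (hC : IsSimplyConnected C) : IsIso (ε[C].f 0) := by
  obtain ⟨e⟩ := hC.zero
  let eu : (𝟙_ (ChainComplex (ModuleCat.{u} k) ℕ)).X 0 ≅ ModuleCat.of k k :=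
    singleObjXSelf (ComplexShape.down ℕ) 0 (𝟙_ (ModuleCat.{u} k))
  let p : C ⟶ 𝟙_ _ := mkHomToSingle e.hom (fun i hi => by
    obtain rfl : i = 1 := by simpa using hi.symm
    exact hC.one.eq_of_src _ _)
  have hp : Epi p := by
    have (i : ℕ) : Epi (p.f i) := by
      by_cases h : i = 0
      · subst h
        change Epi ((mkHomToSingle e.hom _).f 0)
        rw [mkHomToSingle_f]
        infer_instance
      · exact ⟨fun _ _ _ => (isZero_single_obj_X _ _ _ _ h).eq_of_src _ _⟩
    exact HomologicalComplex.epi_of_epi_f _ this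
  suffices Epi (ε[C].f 0) from isIso_of_epi_of_iso_self e eu _
  rw [Preadditive.epi_iff_cancel_zero]
  intro Z u hu
  let U : 𝟙_ (ChainComplex (ModuleCat.{u} k) ℕ) ⟶ (single _ (ComplexShape.down ℕ) 0).obj Z :=
    mkHomToSingle u (fun i hi => (isZero_single_obj_X _ _ _ _ (by
      rintro rfl
      simp at hi)).eq_of_src _ _)
  have hU : ε[C] ≫ U = 0 := by
    refine HomologicalComplex.hom_ext _ _ (fun i => ?_)
    by_cases h : i = 0
    · subst h
      rw [comp_f]
      change _ ≫ (mkHomToSingle u _).f 0 = _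
      rw [mkHomToSingle_f, reassoc_of% hu, zero_comp, zero_f]
    · exact (isZero_single_obj_X _ _ _ _ h).eq_of_tgt _ _
  have h₁ : C ◁ U = 0 := by
    have h₂ := ComonObj.comul_counit C
    have h₃ : (ρ_ C).inv ≫ C ◁ U = 0 := by
      rw [← h₂, Category.assoc, ← whiskerLeft_comp, hU, MonoidalPreadditive.whiskerLeft_zero, comp_zero]
    rwa [Preadditive.IsIso.comp_left_eq_zero] at h₃
  have h₂ : p ≫ U = 0 := by
    have h₃ := whisker_exchange p U
    rw [h₁, zero_comp] at h₃
    have h₄ : p ≫ U = (ρ_ C).inv ≫ (p ▷ _ ≫ 𝟙_ _ ◁ U) ≫ (λ_ _).hom := by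
      rw [Category.assoc, leftUnitor_naturality, unitors_equal, rightUnitor_naturality_assoc,
        Iso.inv_hom_id_assoc]
    rw [h₄, ← h₃]
    simp
  have h₅ : U = 0 := by rwa [← cancel_epi p, comp_zero]
  have h₆ : U.f 0 = 0 := by rw [h₅, zero_f]
  change (mkHomToSingle u _).f 0 = 0 at h₆
  rw [mkHomToSingle_f] at h₆
  rwa [Preadditive.IsIso.comp_right_eq_zero] at h₆

/-- A simply connected coalgebra has a coaugmentation, inverse to the counit in degree `0`. -/
lemma exists_coaugmentation (hC : IsSimplyConnected C) :
    ∃ η : 𝟙_ _ ⟶ C, (ε[C] ≫ η).f 0 = 𝟙 _ := by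
  have := isIso_counit_f_zero hC
  refine ⟨mkHomFromSingle ((singleObjXSelf (ComplexShape.down ℕ) 0 _).inv ≫ inv (ε[C].f 0))
    (fun i hi => by simp at hi), ?_⟩
  rw [comp_f, mkHomFromSingle_f, Iso.hom_inv_id_assoc]
  exact IsIso.hom_inv_id _

end Coaugmentation

/-! ### Lifting along `J ⊗ E ⟶ S ⊗ E`, one degree at a time -/

section Lifting

open HomologicalComplex Comod
open scoped ComonObj

variable {k : Type u} [CommRing k] [IsFiniteProductOfFields k]
  {C : ChainComplex (ModuleCat.{u} k) ℕ} [ComonObj C]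

variable (k) in
/-- The cokernel of the embedding of the unit in `J`. -/
noncomputable def S : ChainComplex (ModuleCat.{u} k) ℕ := cokernel (unitToJ k)

variable (k) in
/-- The projection of `J` to its quotient by the unit. -/
noncomputable def JToS : J k ⟶ S k := cokernel.π _

instance epi_JToS : Epi (JToS k) := inferInstanceAs (Epi (cokernel.π _))

/-- The projection `J ⊗ X ⟶ S ⊗ X`. -/
noncomputable abbrev toS (X : Comod C) : leftTensor (J k) X ⟶ leftTensor (S k) X :=
  leftTensorMap (JToS k) (𝟙 X)

lemma toS_f (X : Comod C) : (toS X).f = JToS k ▷ X.A :=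
  tensorHom_id _ _

lemma nullHomotopicMap_f_congr {K L : ChainComplex (ModuleCat.{u} k) ℕ}
    {h h' : ∀ i j, K.X i ⟶ L.X j} {n : ℕ} (e : ∀ i, ∀ j ≤ n + 1, h i j = h' i j) :
    (Homotopy.nullHomotopicMap h).f n = (Homotopy.nullHomotopicMap h').f n := by
  change dNext n h + prevD n h = dNext n h' + prevD n h'
  rw [prevD_eq _ (show (ComplexShape.down ℕ).Rel (n + 1) n from rfl),
    prevD_eq _ (show (ComplexShape.down ℕ).Rel (n + 1) n from rfl), e _ _ le_rfl,
    dNext_nat, dNext_nat, e _ _ (by lia)]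

/-- The map `X ⟶ X ⊗ C` given by a coaugmentation. -/
noncomputable abbrev coaug (η : 𝟙_ _ ⟶ C) (X : ChainComplex (ModuleCat.{u} k) ℕ) : X ⟶ X ⊗ C :=
  (ρ_ X).inv ≫ X ◁ η

/-- Since `φ` vanishes up to degree `n - 2` and `C₁ = 0`, only the `C₀` component of the coaction
contributes in degree `n`. It is isolated by `ε ≫ η`, and counitality then replaces the coaction by
the coaugmentation. -/
lemma coact_gradedWhisker (hC : IsSimplyConnected C) {η : 𝟙_ _ ⟶ C} (hη : (ε[C] ≫ η).f 0 = 𝟙 _)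
    (X : Comod C) {L : ChainComplex (ModuleCat.{u} k) ℕ} {φ : ∀ i, X.A.X i ⟶ L.X i} {n : ℕ}
    (h : ∀ i, i + 2 ≤ n → φ i = 0) :
    X.coact.f n ≫ gradedWhisker φ C n = (coaug η X.A).f n ≫ gradedWhisker φ C n := by
  calc _ = (X.coact ≫ X.A ◁ (ε[C] ≫ η)).f n ≫ gradedWhisker φ C n := by
        rw [comp_f, Category.assoc, whiskerLeft_gradedWhisker h hC.one _ hη]
    _ = _ := by rw [whiskerLeft_comp, reassoc_of% coact_counit]

lemma coact_whiskerRight_f (hC : IsSimplyConnected C) {η : 𝟙_ _ ⟶ C} (hη : (ε[C] ≫ η).f 0 = 𝟙 _)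
    (X : Comod C) {L : ChainComplex (ModuleCat.{u} k) ℕ} (f : X.A ⟶ L) {n : ℕ}
    (h : ∀ i, i + 2 ≤ n → f.f i = 0) :
    (X.coact ≫ f ▷ C).f n = (f ≫ coaug η L).f n := by
  have e : f ≫ coaug η L = coaug η X.A ≫ f ▷ C := by
    simp [whisker_exchange]
  rw [e, comp_f, comp_f, ← gradedWhisker_f, coact_gradedWhisker hC hη X h]

/-- The projection `J ⊗ E ⟶ S ⊗ E` has a section which is natural in `E` but does not commute with
the differentials. -/
lemma exists_gradedSection (E : Comod C) : ∃ t : ∀ i, (S k ⊗ E.A).X i ⟶ (J k ⊗ E.A).X i,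
    (∀ i, t i ≫ (toS E).f.f i = 𝟙 _) ∧
    ∀ (c : E.A ⟶ E.A ⊗ C) (n : ℕ), t n ≫ (J k ◁ c ≫ (α_ _ _ _).inv).f n =
      (S k ◁ c ≫ (α_ _ _ _).inv).f n ≫ gradedWhisker t C n := by
  have hs (i : ℕ) : ∃ s : (S k).X i ⟶ (J k).X i, s ≫ (JToS k).f i = 𝟙 _ :=
    ⟨Projective.factorThru (𝟙 _) _, Projective.factorThru_comp _ _⟩
  choose s hs using hs
  refine ⟨fun i => gradedWhisker s E.A i, fun i => ?_, fun c n => ?_⟩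
  · rw [toS_f, ← gradedWhisker_f, gradedWhisker_comp, gradedWhisker_congr (ψ := fun i => 𝟙 _)
      (fun i _ => hs i), gradedWhisker_id]
  · rw [comp_f, comp_f, ← Category.assoc, gradedWhisker_exchange, Category.assoc,
      gradedWhisker_assoc_inv, Category.assoc]

lemma coaug_tensor (η : 𝟙_ _ ⟶ C) (K L : ChainComplex (ModuleCat.{u} k) ℕ) :
    coaug η (K ⊗ L) = K ◁ coaug η L ≫ (α_ _ _ _).inv := by
  simp

lemma nullHomotopicMap_hom {K : ChainComplex (ModuleCat.{u} k) ℕ} (H : Homotopy (𝟙 K) 0) :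
    Homotopy.nullHomotopicMap H.hom = 𝟙 K := by
  ext n : 1
  have := H.comm n
  simp only [zero_f, add_zero] at this
  exact this.symm

lemma nullHomotopicMap_f_eq_zero {K L : ChainComplex (ModuleCat.{u} k) ℕ}
    {h : ∀ i j, K.X i ⟶ L.X j} {n : ℕ} (e : ∀ i, ∀ j ≤ n + 1, h i j = 0) :
    (Homotopy.nullHomotopicMap h).f n = 0 := by
  rw [nullHomotopicMap_f_congr (h' := 0) e]
  change dNext n 0 + prevD n 0 = 0
  rw [map_zero, map_zero, add_zero]

/-- `ψ` is the boundary of `H ≫ φ ≫ t`, with `H` a contraction of `Q` and `t` a graded section of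
the projection; projecting cancels `t` and returns `φ`. The homotopy raises degrees by one, so `ψ`
vanishes in one degree fewer than `φ`, and its degree `n` part uses `φ` up to degree `n + 1`. There
`φ` still does not distinguish the coaction from the coaugmentation, because `C₁ = 0`. -/
lemma exists_chain_lift (hC : IsSimplyConnected C) {η : 𝟙_ _ ⟶ C} (hη : (ε[C] ≫ η).f 0 = 𝟙 _)
    {E Q : Comod C} (hQ : Q.A.Acyclic) (φ : Q ⟶ leftTensor (S k) E) (m : ℕ)
    (hφ : ∀ i < m, φ.f.f i = 0) :
    ∃ ψ : Q.A ⟶ J k ⊗ E.A, ψ ≫ (toS E).f = φ.f ∧ (∀ i, i + 1 < m → ψ.f i = 0) ∧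
      ∀ n ≤ m, (ψ ≫ (leftTensor (J k) E).coact).f n = (ψ ≫ coaug η (J k ⊗ E.A)).f n := by
  obtain ⟨H⟩ := nonempty_homotopy_of_acyclic hQ
  obtain ⟨t, t_π, t_comm⟩ := exists_gradedSection E
  refine ⟨Homotopy.nullHomotopicMap (fun a b => H.hom a b ≫ φ.f.f b ≫ t b), ?_, ?_, ?_⟩
  · rw [Homotopy.nullHomotopicMap_comp]
    simp only [Category.assoc, t_π]
    have e : (fun a b => H.hom a b ≫ φ.f.f b ≫ 𝟙 ((S k ⊗ E.A).X b)) =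
        fun a b => H.hom a b ≫ φ.f.f b := by
      ext a b : 2
      rw [Category.comp_id]
    exact (congrArg Homotopy.nullHomotopicMap e).trans ((Homotopy.nullHomotopicMap_comp _ _).symm.trans
      (by rw [nullHomotopicMap_hom, Category.id_comp]))
  · intro i hi
    refine nullHomotopicMap_f_eq_zero (fun a b hb => ?_)
    rw [hφ b (by lia), zero_comp, comp_zero]
  · intro n hn
    rw [Homotopy.nullHomotopicMap_comp, Homotopy.nullHomotopicMap_comp]
    refine nullHomotopicMap_f_congr (fun a b hb => ?_)
    have e₁ : φ.f.f b ≫ (leftTensor (S k) E).coact.f b = φ.f.f b ≫ (coaug η (S k ⊗ E.A)).f b := by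
      rw [← comp_f, ← hom_coact, coact_whiskerRight_f hC hη Q φ.f (fun i hi => hφ i (by lia)), comp_f]
    -- The section commutes with every map `E ⟶ E ⊗ C`, so it transports the equality of coaction
    -- and coaugmentation from `S ⊗ E` to `J ⊗ E`.
    have e₂ := t_comm E.coact b
    have e₃ := t_comm (coaug η E.A) b
    rw [← coaug_tensor, ← coaug_tensor] at e₃
    rw [← leftTensor_coact, ← leftTensor_coact] at e₂
    simp only [Category.assoc]
    rw [e₂, e₃, reassoc_of% e₁]

/-- The inductive step in the construction of lifts along `J ⊗ E ⟶ S ⊗ E`. -/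
lemma exists_lift_step (hC : IsSimplyConnected C) {E Q : Comod C} [Injective (leftTensor (J k) E)]
    (hQ : Q.A.Acyclic) (φ : Q ⟶ leftTensor (S k) E) (m : ℕ) (hφ : ∀ i < m, φ.f.f i = 0) :
    ∃ σ : Q ⟶ leftTensor (J k) E, (∀ i, i + 1 < m → σ.f.f i = 0) ∧
      ∀ i ≤ m, (σ ≫ toS E).f.f i = φ.f.f i := by
  obtain ⟨η, hη⟩ := exists_coaugmentation hC
  obtain ⟨ψ, hψ, hψ₀, hψ₁⟩ := exists_chain_lift hC hη hQ φ m hφ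
  -- The chain map `ψ` is not a comodule map, but `toCofree ψ` is. It agrees with `ψ` followed by
  -- the coaction in degrees at most `m`, and there the retraction `r` turns it back into `ψ`.
  obtain ⟨r, hr⟩ : ∃ r, coactHom (leftTensor (J k) E) ≫ r = 𝟙 _ := by
    have : Mono (coactHom (leftTensor (J k) E)) := (mono_iff_mono_f _).2 inferInstance
    exact ⟨Injective.factorThru (𝟙 _) (coactHom (leftTensor (J k) E)), Injective.comp_factorThru _ _⟩
  have hr' (n : ℕ) : (leftTensor (J k) E).coact.f n ≫ r.f.f n = 𝟙 _ := by
    have := congrArg (fun x => x.f.f n) hr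
    exact this
  have h (n : ℕ) (hn : n ≤ m) : (toCofree ψ ≫ r).f.f n = ψ.f n := by
    have e : (Q.coact ≫ ψ ▷ C).f n = (ψ ≫ (leftTensor (J k) E).coact).f n :=
      (coact_whiskerRight_f hC hη Q ψ (fun i hi => hψ₀ i (by lia))).trans (hψ₁ n hn).symm
    calc _ = (Q.coact ≫ ψ ▷ C).f n ≫ r.f.f n := rfl
      _ = _ := by
        rw [e, comp_f, Category.assoc, hr', Category.comp_id]
  refine ⟨toCofree ψ ≫ r, fun i hi => by rw [h i (by lia), hψ₀ i hi], fun i hi => ?_⟩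
  calc _ = (toCofree ψ ≫ r).f.f i ≫ (toS E).f.f i := rfl
    _ = _ := by rw [h i hi, ← hψ, comp_f]

end Lifting

/-! ### Fibrations, and fibrancy of `E` when `J ⊗ E` is injective -/

section Fibrancy

open HomologicalComplex Comod
open scoped ComonObj

variable {k : Type u} [CommRing k]
  {C : ChainComplex (ModuleCat.{u} k) ℕ} [ComonObj C]

/-- A family of maps which agrees up to any given degree with a morphism of comodules is a morphism
of comodules. -/
lemma exists_glue {Q E : Comod C} (f : ∀ i, Q.A.X i ⟶ E.A.X i)
    (hf : ∀ n, ∃ b : Q ⟶ E, ∀ i ≤ n, f i = b.f.f i) : ∃ g : Q ⟶ E, ∀ i, g.f.f i = f i := by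
  let g : Q.A ⟶ E.A :=
    { f := f
      comm' := fun i j hij => by
        obtain ⟨b, hb⟩ := hf i
        obtain rfl : j + 1 = i := hij
        rw [hb _ le_rfl, hb j (by lia), Hom.comm] }
  refine ⟨homMk g ?_, fun i => rfl⟩
  refine HomologicalComplex.hom_ext _ _ (fun n => ?_)
  obtain ⟨b, hb⟩ := hf n
  have e : (g ▷ C).f n = (b.f ▷ C).f n := gradedWhisker_congr hb C
  rw [comp_f, comp_f, e, ← comp_f, hom_coact, comp_f]
  exact congrArg (fun x => x ≫ E.coact.f n) (hb n le_rfl).symm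

/-- Dependent choice, for building successive corrections of lifts, lifts through a tower, and the
Postnikov tower. -/
lemma exists_seq {T : ℕ → Type v} (R : ∀ m, T m → T (m + 1) → Prop) (t : T 0)
    (h : ∀ m (x : T m), ∃ y, R m x y) : ∃ s : ∀ m, T m, s 0 = t ∧ ∀ m, R m (s m) (s (m + 1)) := by
  choose next hnext using h
  exact ⟨fun m => Nat.rec t next m, rfl, fun m => hnext m _⟩

variable [IsFiniteProductOfFields k]

/-- If `J ⊗ E` is injective, morphisms from an acyclic comodule lift along `J ⊗ E ⟶ S ⊗ E`. -/
lemma exists_lift_toS (hC : IsSimplyConnected C) {E Q : Comod C} [Injective (leftTensor (J k) E)]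
    (hQ : Q.A.Acyclic) (φ : Q ⟶ leftTensor (S k) E) :
    ∃ σ : Q ⟶ leftTensor (J k) E, σ ≫ toS E = φ := by
  -- Stage `m` lifts `φ` in degrees below `m`, and the next stage adds a lift of the error in degree
  -- `m`. The correction vanishes in degrees `i` with `i + 1 < m`, so degree `i` is final from stage
  -- `i + 2` on.
  obtain ⟨s, -, hs⟩ := exists_seq
    (T := fun m => {τ : Q ⟶ leftTensor (J k) E // ∀ i < m, (τ ≫ toS E).f.f i = φ.f.f i})
    (fun m x y => ∀ i, i + 1 < m → y.1.f.f i = x.1.f.f i) ⟨0, by simp⟩ (fun m ⟨τ, hτ⟩ => by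
      obtain ⟨σ, hσ, hσ'⟩ := exists_lift_step hC hQ (φ - τ ≫ toS E) m (fun i hi => by
        have := hτ i hi
        change φ.f.f i - (τ ≫ toS E).f.f i = 0
        rw [this, sub_self])
      refine ⟨⟨τ + σ, fun i hi => ?_⟩, fun i hi => ?_⟩
      · have h₁ := hσ' i (by lia)
        rw [Preadditive.add_comp]
        change (τ ≫ toS E).f.f i + (σ ≫ toS E).f.f i = _
        rw [h₁]
        change (τ ≫ toS E).f.f i + (φ.f.f i - (τ ≫ toS E).f.f i) = _
        abel
      · change τ.f.f i + σ.f.f i = τ.f.f i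
        rw [hσ i hi, add_zero])
  have hst (i d : ℕ) : (s (i + 2 + d)).1.f.f i = (s (i + 2)).1.f.f i := by
    induction d with
    | zero => rfl
    | succ d hd => rw [← hd, ← hs (i + 2 + d) i (by lia)]; rfl
  have hst' (i m : ℕ) (h : i + 2 ≤ m) : (s m).1.f.f i = (s (i + 2)).1.f.f i := by
    obtain ⟨d, rfl⟩ := Nat.exists_eq_add_of_le h
    exact hst i d
  obtain ⟨g, hg⟩ := exists_glue (fun i => (s (i + 2)).1.f.f i)
    (fun n => ⟨(s (n + 2)).1, fun i hi => (hst' i (n + 2) (by lia)).symm⟩)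
  refine ⟨g, Comonad.Coalgebra.Hom.ext (HomologicalComplex.hom_ext _ _ (fun i => ?_))⟩
  rw [← (s (i + 2)).2 i (by lia)]
  change g.f.f i ≫ (toS E).f.f i = (s (i + 2)).1.f.f i ≫ (toS E).f.f i
  rw [hg]

/-- The class of fibrations: morphisms with the right lifting property with respect to injective
quasi-isomorphisms. -/
def IsFib {X Y : Comod C} (p : X ⟶ Y) : Prop :=
  ∀ ⦃A B : Comod C⦄ (i : A ⟶ B), Mono i.f → QuasiIso i.f → HasLiftingProperty i p

lemma toJ_toS (E : Comod C) : toJ E ≫ toS E = 0 := by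
  ext1
  change (toJ E).f ≫ (toS E).f = 0
  rw [toJ_f, toS_f, Category.assoc, ← comp_whiskerRight]
  have : unitToJ k ≫ JToS k = 0 := cokernel.condition _
  rw [this, MonoidalPreadditive.zero_whiskerRight, comp_zero]

/-- `E` is the kernel of `toS E`: the unit is the kernel of `J ⟶ S`, and `- ⊗ E` preserves kernels.
-/
lemma exists_lift_toJ {E X : Comod C} (f : X ⟶ leftTensor (J k) E) (hf : f ≫ toS E = 0) :
    ∃ g : X ⟶ E, g ≫ toJ E = f := by
  have hl : IsLimit (KernelFork.ofι (f := JToS k) (unitToJ k) (cokernel.condition _)) :=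
    Abelian.monoIsKernelOfCokernel _ (colimit.isColimit _)
  have hl' := KernelFork.mapIsLimit _ hl (tensorRight E.A)
  have hf' : f.f ≫ JToS k ▷ E.A = 0 := by
    have : (f ≫ toS E).f = 0 := by rw [hf]; rfl
    rw [← toS_f]
    exact this
  obtain ⟨l, hl⟩ : ∃ l : X.A ⟶ 𝟙_ _ ⊗ E.A, l ≫ unitToJ k ▷ E.A = f.f := by
    obtain ⟨l, hl⟩ := KernelFork.IsLimit.lift' hl' f.f hf'
    exact ⟨l, hl⟩
  refine exists_lift_of_mono f (toJ E) (l ≫ (λ_ _).hom) ?_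
  rw [toJ_f, Category.assoc, Iso.hom_inv_id_assoc, hl]

lemma exists_acyclic_quotient {A B : Comod C} (i : A ⟶ B) (hi : Mono i.f) (hi' : QuasiIso i.f) :
    ∃ (Q : Comod C) (q : B ⟶ Q), Q.A.Acyclic ∧ i ≫ q = 0 ∧
      ∀ {Z : Comod C} (g : B ⟶ Z), i ≫ g = 0 → ∃ h : Q ⟶ Z, q ≫ h = g := by
  obtain ⟨Q, q, w, h, h'⟩ := exists_quotient i
  exact ⟨Q, q, h.acyclic_X₃ hi', Comonad.Coalgebra.Hom.ext w, h'⟩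

/-- A morphism `X ⟶ Y` from an injective object is a fibration if morphisms from acyclic comodules
to `Y` lift to `X`. -/
lemma isFib_of_injective {X Y : Comod C} [Injective X] (p : X ⟶ Y)
    (hp : ∀ {Q : Comod C} (_ : Q.A.Acyclic) (φ : Q ⟶ Y), ∃ σ : Q ⟶ X, σ ≫ p = φ) : IsFib p := by
  intro A B i hi hi'
  refine ⟨fun {f g} sq => ?_⟩
  obtain ⟨Q, q, hQ, hq, hQ'⟩ := exists_acyclic_quotient i hi hi'
  have : Mono i := (mono_iff_mono_f i).2 hi
  -- Injectivity extends `f` to `B`; the error over `Y` vanishes on `A`, so it factors through the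
  -- acyclic quotient, and a lift of it corrects the extension.
  obtain ⟨φ, hφ⟩ := hQ' (g - Injective.factorThru f i ≫ p) (by
    rw [Preadditive.comp_sub, Injective.comp_factorThru_assoc, sq.w, sub_self])
  obtain ⟨σ, hσ⟩ := hp hQ φ
  exact ⟨⟨⟨Injective.factorThru f i + q ≫ σ, by
    rw [Preadditive.comp_add, reassoc_of% hq, zero_comp, add_zero, Injective.comp_factorThru], by
    rw [Preadditive.add_comp, Category.assoc, hσ, hφ]
    abel⟩⟩⟩

/-- A comodule `E` is fibrant if `J ⊗ E` is injective. -/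
lemma exists_extension_of_injective (hC : IsSimplyConnected C) {E : Comod C}
    [Injective (leftTensor (J k) E)] {A B : Comod C} (i : A ⟶ B) (hi : Mono i.f)
    (hi' : QuasiIso i.f) (f : A ⟶ E) : ∃ g : B ⟶ E, i ≫ g = f := by
  have := isFib_of_injective (toS E) (fun hQ φ => exists_lift_toS hC hQ φ) i hi hi'
  -- The bottom map is zero, so the lift lands in the kernel of `toS E`, which is `E`.
  have sq : CommSq (f ≫ toJ E) i (toS E) 0 := ⟨by rw [Category.assoc, toJ_toS, comp_zero, comp_zero]⟩
  obtain ⟨g, hg⟩ := exists_lift_toJ sq.lift sq.fac_right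
  refine ⟨g, ?_⟩
  have : Mono (toJ E) := (mono_iff_mono_f _).2 inferInstance
  rw [← cancel_mono (toJ E), Category.assoc, hg, sq.fac_left]

end Fibrancy

/-! ### Trivial fibrations as retracts of projections with injective kernel -/

section TrivialFibrations

open HomologicalComplex Comod
open scoped ComonObj

variable {k : Type u} [CommRing k]
  {C : ChainComplex (ModuleCat.{u} k) ℕ} [ComonObj C]

/-- The class of trivial fibrations: morphisms with the right lifting property with respect to
injective maps. -/
def IsTrivFib {X Y : Comod C} (p : X ⟶ Y) : Prop :=
  ∀ ⦃A B : Comod C⦄ (i : A ⟶ B), Mono i.f → HasLiftingProperty i p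

lemma IsTrivFib.isFib {X Y : Comod C} {p : X ⟶ Y} (hp : IsTrivFib p) : IsFib p :=
  fun _ _ i hi _ => hp i hi

lemma hasLiftingProperty_of_isPullback {D : Type*} [Category D] {X Y Z W A B : D} {a : X ⟶ Y}
    {b : X ⟶ Z} {c : Y ⟶ W} {d : Z ⟶ W} (h : IsPullback a b c d) (i : A ⟶ B)
    [HasLiftingProperty i d] : HasLiftingProperty i a where
  sq_hasLift {f g} sq := by
    have sq' : CommSq (f ≫ b) i d (g ≫ c) := ⟨by
      rw [Category.assoc, ← h.w, sq.w_assoc]⟩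
    exact ⟨⟨⟨h.lift g sq'.lift sq'.fac_right.symm, h.hom_ext (by simp [sq.w]) (by simp), by simp⟩⟩⟩

lemma IsFib.of_isPullback {X Y Z W : Comod C} {a : X ⟶ Y} {b : X ⟶ Z} {c : Y ⟶ W} {d : Z ⟶ W}
    (h : IsPullback a b c d) (hd : IsFib d) : IsFib a := fun _ _ i hi hi' => by
  have := hd i hi hi'
  exact hasLiftingProperty_of_isPullback h i

lemma IsTrivFib.of_isPullback {X Y Z W : Comod C} {a : X ⟶ Y} {b : X ⟶ Z} {c : Y ⟶ W} {d : Z ⟶ W}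
    (h : IsPullback a b c d) (hd : IsTrivFib d) : IsTrivFib a := fun _ _ i hi => by
  have := hd i hi
  exact hasLiftingProperty_of_isPullback h i

lemma IsFib.comp {X Y Z : Comod C} {p : X ⟶ Y} {q : Y ⟶ Z} (hp : IsFib p) (hq : IsFib q) :
    IsFib (p ≫ q) := fun _ _ i hi hi' => by
  have := hp i hi hi'
  have := hq i hi hi'
  infer_instance

lemma isIso_map_biprod_fst {D E : Type*} [Category D] [Preadditive D] [HasBinaryBiproducts D]
    [Category E] [Preadditive E] (G : D ⥤ E) [G.Additive] (Z W : D) (hW : IsZero (G.obj W)) :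
    IsIso (G.map (biprod.fst : Z ⊞ W ⟶ Z)) := by
  refine ⟨G.map biprod.inl, ?_, ?_⟩
  · have h := congrArg (fun x => G.map x) (biprod.total (X := Z) (Y := W))
    simp only [G.map_add, G.map_comp, G.map_id] at h
    rw [hW.eq_of_tgt (G.map biprod.snd) 0, zero_comp, add_zero] at h
    exact h
  · rw [← G.map_comp, biprod.inl_fst, G.map_id]

variable [IsFiniteProductOfFields k]

lemma quasiIso_map_biprod_fst (F : Comod C ⥤ ChainComplex (ModuleCat.{u} k) ℕ) [F.Additive]
    (Z W : Comod C) (hW : (F.obj W).Acyclic) : QuasiIso (F.map (biprod.fst : Z ⊞ W ⟶ Z)) where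
  quasiIsoAt i := by
    rw [quasiIsoAt_iff_isIso_homologyMap]
    exact isIso_map_biprod_fst (F ⋙ homologyFunctor _ _ i) Z W ((hW i).isZero_homology)

lemma isTrivFib_biprod_fst (Z W : Comod C) [Injective W] :
    IsTrivFib (biprod.fst : Z ⊞ W ⟶ Z) := fun _ _ i hi => by
  have : Mono i := (mono_iff_mono_f i).2 hi
  refine ⟨fun {f g} sq => ⟨⟨⟨biprod.lift g (Injective.factorThru (f ≫ biprod.snd) i), ?_, by simp⟩⟩⟩⟩
  exact biprod.hom_ext _ _ (by simp [sq.w]) (by simp)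

/-- The embedding of `X` in the sum of `Y` and an injective object. -/
noncomputable def toBiprod {X Y : Comod C} (f : X ⟶ Y) : X ⟶ Y ⊞ cofree (J k ⊗ X.A) :=
  biprod.lift f (toCofreeJ X)

lemma toBiprod_fst {X Y : Comod C} (f : X ⟶ Y) : toBiprod f ≫ biprod.fst = f :=
  biprod.lift_fst _ _

instance mono_toBiprod {X Y : Comod C} (f : X ⟶ Y) : Mono (toBiprod f).f := by
  have : Mono (toCofreeJ X) := (mono_iff_mono_f _).2 inferInstance
  rw [← mono_iff_mono_f]
  exact mono_of_mono_fac (biprod.lift_snd f (toCofreeJ X))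

instance injective_cofree_J (X : ChainComplex (ModuleCat.{u} k) ℕ) :
    Injective (cofree (J k ⊗ X) : Comod C) :=
  injective_cofree (acyclic_tensor acyclic_J X)

lemma quasiIso_biprod_fst_f (Z : Comod C) (X : ChainComplex (ModuleCat.{u} k) ℕ) :
    QuasiIso (biprod.fst : Z ⊞ cofree (J k ⊗ X) ⟶ Z).f :=
  quasiIso_map_biprod_fst (tensorComonad C).forget Z (cofree (J k ⊗ X))
    (acyclic_cofree (acyclic_tensor acyclic_J X))

/-- The retract argument for the factorization of `p` through `toBiprod p`. -/
lemma nonempty_retractArrow {X Y : Comod C} (p : X ⟶ Y) (h : HasLiftingProperty (toBiprod p) p) :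
    Nonempty (RetractArrow p (biprod.fst : Y ⊞ cofree (J k ⊗ X.A) ⟶ Y)) := by
  have sq : CommSq (𝟙 X) (toBiprod p) p biprod.fst := ⟨by rw [toBiprod_fst, Category.id_comp]⟩
  exact ⟨{ i := Arrow.homMk (toBiprod p) (𝟙 Y) (by simp [toBiprod_fst])
           r := Arrow.homMk sq.lift (𝟙 Y) (by simp)
           retract := by ext1 <;> simp }⟩

/-- Additive functors which send cofree comodules on acyclic complexes to acyclic complexes send
trivial fibrations to quasi-isomorphisms. -/
lemma IsTrivFib.quasiIso_map {X Y : Comod C} {p : X ⟶ Y} (hp : IsTrivFib p)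
    (F : Comod C ⥤ ChainComplex (ModuleCat.{u} k) ℕ) [F.Additive]
    (hF : ∀ D : ChainComplex (ModuleCat.{u} k) ℕ, D.Acyclic → (F.obj (cofree D)).Acyclic) :
    QuasiIso (F.map p) := by
  obtain ⟨r⟩ := nonempty_retractArrow p (hp _ inferInstance)
  have := quasiIso_map_biprod_fst F Y (cofree (J k ⊗ X.A)) (hF _ (acyclic_tensor acyclic_J _))
  exact quasiIso_of_retractArrow (r.map F)

lemma IsTrivFib.quasiIso_f {X Y : Comod C} {p : X ⟶ Y} (hp : IsTrivFib p) : QuasiIso p.f :=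
  hp.quasiIso_map (tensorComonad C).forget (fun _ hD => acyclic_cofree hD)

/-- By two out of three `toBiprod p` is a quasi-isomorphism, so `p` lifts against it and is a
retract of the projection, which has the stronger lifting property. -/
lemma IsFib.isTrivFib {X Y : Comod C} {p : X ⟶ Y} (hp : IsFib p) (hp' : QuasiIso p.f) :
    IsTrivFib p := by
  have h : QuasiIso (toBiprod p).f := by
    have := quasiIso_biprod_fst_f Y X.A
    have e : (toBiprod p).f ≫ (biprod.fst : Y ⊞ cofree (J k ⊗ X.A) ⟶ Y).f = p.f := by
      rw [← Comonad.Coalgebra.comp_f, toBiprod_fst]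
    exact quasiIso_of_comp_right _ _ (hφφ' := by rw [e]; infer_instance)
  obtain ⟨r⟩ := nonempty_retractArrow p (hp _ inferInstance h)
  intro A B i hi
  have := isTrivFib_biprod_fst Y (cofree (J k ⊗ X.A)) i hi
  exact r.rightLiftingProperty i

/-- A split epimorphism from an injective comodule is a trivial fibration. -/
lemma isTrivFib_of_section {X Y : Comod C} [Injective X] (p : X ⟶ Y) (s : Y ⟶ X) (h : s ≫ p = 𝟙 Y) :
    IsTrivFib p := fun _ _ i hi => by
  have : Mono i := (mono_iff_mono_f i).2 hi
  -- The error over `Y` of an extension of `f` vanishes on `A`; the section `s` lifts it.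
  refine ⟨fun {f g} sq => ⟨⟨⟨Injective.factorThru f i + (g - Injective.factorThru f i ≫ p) ≫ s, ?_, ?_⟩⟩⟩⟩
  · simp [Preadditive.comp_add, Preadditive.comp_sub, Preadditive.sub_comp, sq.w, reassoc_of% sq.w]
  · simp [Preadditive.add_comp, Preadditive.sub_comp, h]

end TrivialFibrations

/-! ### Killing the lowest homology -/

section Postnikov

open HomologicalComplex Comod
open scoped ComonObj

variable {k : Type u} [CommRing k]
  {C : ChainComplex (ModuleCat.{u} k) ℕ} [ComonObj C]

/-- The counit is injective in the lowest degree. -/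
lemma mono_whiskerLeft_counit_f (hC : IsSimplyConnected C) {W : ChainComplex (ModuleCat.{u} k) ℕ}
    (n : ℕ) (hW : ∀ i < n, IsZero (W.X i)) : Mono ((W ◁ ε[C]).f n) := by
  obtain ⟨η, hη⟩ := exists_coaugmentation hC
  -- `W` is zero below degree `n` and `C₁ = 0`, so the coaugmentation inverts the counit on the left
  -- in degree `n` of `W ⊗ C`.
  have h := whiskerLeft_gradedWhisker (K := W) (φ := fun i => 𝟙 (W.X i)) (n := n)
    (fun i hi => (hW i (by lia)).eq_of_src _ _) hC.one (ε[C] ≫ η) hη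
  rw [gradedWhisker_id, Category.comp_id, whiskerLeft_comp, comp_f] at h
  exact mono_of_mono_fac h

variable [IsFiniteProductOfFields k]

/-- A chain map to the homology of `K`, inducing the identity in homology. -/
lemma exists_toSingle_homology (K : ChainComplex (ModuleCat.{u} k) ℕ) (n : ℕ) :
    ∃ r : K.X n ⟶ K.homology n, K.iCycles n ≫ r = K.homologyπ n ∧ K.d (n + 1) n ≫ r = 0 :=
  ⟨K.pOpcycles n ≫ Injective.factorThru (𝟙 _) (K.homologyι n), by
    rw [← homology_π_ι_assoc, Injective.comp_factorThru, Category.comp_id],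
    by rw [d_pOpcycles_assoc, zero_comp]⟩

lemma exists_boundary_of_homologyπ {K : ChainComplex (ModuleCat.{u} k) ℕ} {n : ℕ} {r : K.X n ⟶ K.homology n}
    (hr : K.iCycles n ≫ r = K.homologyπ n) {A : ModuleCat.{u} k} (x : A ⟶ K.X n)
    (hx : ∀ j, x ≫ K.d n j = 0) (hx' : x ≫ r = 0) : ∃ y : A ⟶ K.X (n + 1), y ≫ K.d (n + 1) n = x := by
  have h : K.liftCycles x _ rfl (hx _) ≫ K.homologyπ n = 0 := by
    rw [← hr, liftCycles_i_assoc, hx']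
  obtain ⟨A', π, _, y, hy⟩ := (K.comp_homologyπ_eq_zero_iff_up_to_refinements (n + 1) n (by simp) _).1 h
  refine ⟨Projective.factorThru (𝟙 _) π ≫ y, ?_⟩
  have := congrArg (fun z => Projective.factorThru (𝟙 A) π ≫ z ≫ K.iCycles n) hy
  simp only [Category.assoc, toCycles_i, liftCycles_i, Projective.factorThru_comp_assoc,
    Category.id_comp] at this
  rw [Category.assoc, this]

lemma isZero_single_tensor_X (V : ModuleCat.{u} k) (n i : ℕ) (hi : i < n)
    (Z : ChainComplex (ModuleCat.{u} k) ℕ) :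
    IsZero (((single (ModuleCat.{u} k) (ComplexShape.down ℕ) n).obj V ⊗ Z).X i) :=
  isZero_tensor_X i fun a _ _ => Or.inl (isZero_single_obj_X _ _ _ a (by lia))

/-- The homology in the lowest degree can be killed by pulling back an acyclic cofree comodule. -/
lemma exists_killing (hC : IsSimplyConnected C) (Q : Comod C) (n : ℕ)
    (hQ : ∀ i < n, Q.A.ExactAt i) :
    ∃ (V : ModuleCat.{u} k) (g : Q ⟶ cofree ((single _ (ComplexShape.down ℕ) n).obj V)),
      ∀ {D : ChainComplex (ModuleCat.{u} k) ℕ} (_ : D.Acyclic) (d : D ⟶ (single _ _ n).obj V)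
        {Q' : Comod C} (p : Q' ⟶ Q) (q : Q' ⟶ cofree D), IsPullback p q g (cofreeMap d) →
        ∀ i ≤ n, Q'.A.ExactAt i := by
  obtain ⟨r, hr, hr'⟩ := exists_toSingle_homology Q.A n
  let W := (single (ModuleCat.{u} k) (ComplexShape.down ℕ) n).obj (Q.A.homology n)
  let R : Q.A ⟶ W := mkHomToSingle r (fun i hi => by
    obtain rfl : n + 1 = i := hi
    exact hr')
  have hR : R.f n = r ≫ (singleObjXSelf (ComplexShape.down ℕ) n _).inv := mkHomToSingle_f _ _
  let g : Q ⟶ cofree W := toCofree R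
  have hg (i : ℕ) : g.f.f i ≫ (W ◁ ε[C]).f i = R.f i ≫ (ρ_ W).inv.f i := by
    have h := toCofree_counit (C := C) R
    rw [← Category.assoc, ← Iso.eq_comp_inv] at h
    exact congrArg (fun x => Hom.f x i) h
  have hmono : Mono ((W ◁ ε[C]).f n) := mono_whiskerLeft_counit_f hC n
    (fun i hi => isZero_single_obj_X _ _ _ i (by lia))
  have hW' : IsZero ((W ⊗ C).X (n + 1)) := isZero_tensor_X _ fun a b hab => by
    by_cases ha : a = n
    · obtain rfl : b = 1 := by lia
      exact Or.inr hC.one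
    · exact Or.inl (isZero_single_obj_X _ _ _ a ha)
  refine ⟨_, g, fun {D} hD d {Q'} p q sq i hi => exactAt_of_exists_lift fun {A} x hx => ?_⟩
  let G : (cofree D : Comod C) ⟶ cofree W := cofreeMap d
  -- construct a preimage from compatible preimages in the two factors
  suffices h : ∃ (y₁ : A ⟶ Q.A.X (i + 1)) (y₂ : A ⟶ (D ⊗ C).X (i + 1)),
      y₁ ≫ Q.A.d (i + 1) i = x ≫ p.f.f i ∧ y₂ ≫ (D ⊗ C).d (i + 1) i = x ≫ q.f.f i ∧
      y₁ ≫ g.f.f (i + 1) = y₂ ≫ G.f.f (i + 1) by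
    obtain ⟨y₁, y₂, h₁, h₂, h₃⟩ := h
    have sq₁ := isPullback_f_f sq (i + 1)
    refine ⟨sq₁.lift y₁ y₂ h₃, (isPullback_f_f sq i).hom_ext ?_ ?_⟩
    · rw [Category.assoc, ← Hom.comm, IsPullback.lift_fst_assoc, h₁]
    · rw [Category.assoc, ← Hom.comm, IsPullback.lift_snd_assoc]
      exact h₂
  obtain ⟨w, hw⟩ := exists_lift_of_exactAt (acyclic_tensor hD C i) (x ≫ q.f.f i) (fun j => by
    have := q.f.comm i j
    have h : q.f.f i ≫ (D ⊗ C).d i j = Q'.A.d i j ≫ q.f.f j := this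
    rw [Category.assoc, h, reassoc_of% hx, zero_comp])
  have hxp (j : ℕ) : (x ≫ p.f.f i) ≫ Q.A.d i j = 0 := by
    rw [Category.assoc, p.f.comm, reassoc_of% hx, zero_comp]
  obtain rfl | hi := eq_or_lt_of_le hi
  -- In degree `n`, the image of `x` in `W ⊗ C` is the boundary of an element of degree `n + 1`,
  -- where `W ⊗ C` vanishes. Hence the component of `x` in `Q` has zero homology class.
  · have h₀ : x ≫ p.f.f i ≫ g.f.f i = 0 := by
      have h := (isPullback_f_f sq i).w
      rw [h]
      change x ≫ q.f.f i ≫ _ = 0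
      rw [← reassoc_of% hw]
      have h' := G.f.comm (i + 1) i
      have h'' : (D ⊗ C).d (i + 1) i ≫ G.f.f i =
        G.f.f (i + 1) ≫ (W ⊗ C).d (i + 1) i := h'.symm
      rw [h'', hW'.eq_of_tgt (G.f.f (i + 1)) 0, zero_comp, comp_zero]
    have h₁ : (x ≫ p.f.f i) ≫ r = 0 := by
      have h := congrArg (fun z => x ≫ p.f.f i ≫ z) (hg i)
      simp only [reassoc_of% h₀, zero_comp] at h
      have e : IsIso ((ρ_ W).inv.f i) := inferInstance
      rw [← Category.assoc, ← Category.assoc, hR, eq_comm, Preadditive.IsIso.comp_right_eq_zero,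
        ← Category.assoc, Preadditive.IsIso.comp_right_eq_zero] at h
      exact h
    obtain ⟨y, hy⟩ := exists_boundary_of_homologyπ hr _ hxp h₁
    exact ⟨y, w, hy, hw, hW'.eq_of_tgt _ _⟩
  · obtain ⟨y, hy⟩ := exists_lift_of_exactAt (hQ i hi) _ hxp
    obtain hi' | hi' := lt_or_eq_of_le (show i + 1 ≤ n by lia)
    · exact ⟨y, w, hy, hw, (isZero_single_tensor_X _ _ _ hi' C).eq_of_tgt _ _⟩
    · subst hi'
      -- In degree `n - 1`, the two preimages may disagree in degree `n` of `W ⊗ C`, which the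
      -- counit embeds in the homology of `Q`. Cycles surject onto homology, so a cycle absorbs the
      -- difference.
      obtain ⟨z, hz⟩ : ∃ z : A ⟶ Q.A.cycles (i + 1), z ≫ Q.A.homologyπ (i + 1) =
          (y ≫ g.f.f (i + 1) - w ≫ G.f.f (i + 1)) ≫
            (W ◁ ε[C]).f (i + 1) ≫ (ρ_ W).hom.f (i + 1) ≫
              (singleObjXSelf (ComplexShape.down ℕ) (i + 1) _).hom :=
        ⟨Projective.factorThru _ _, Projective.factorThru_comp _ _⟩
      refine ⟨y - z ≫ Q.A.iCycles (i + 1), w, ?_, hw, ?_⟩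
      · rw [Preadditive.sub_comp, hy, Category.assoc, iCycles_d, comp_zero, sub_zero]
      · have h : z ≫ Q.A.iCycles (i + 1) ≫ g.f.f (i + 1) =
            y ≫ g.f.f (i + 1) - w ≫ G.f.f (i + 1) := by
          have e : (ρ_ W).hom.f (i + 1) ≫ (ρ_ W).inv.f (i + 1) = 𝟙 _ := by
            rw [← comp_f, Iso.hom_inv_id, id_f]
          rw [← cancel_mono ((W ◁ ε[C]).f (i + 1)), Category.assoc, Category.assoc, hg, hR,
            Category.assoc, reassoc_of% hr, reassoc_of% hz]
          simp [e]
        rw [Preadditive.sub_comp, Category.assoc, h]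
        abel

end Postnikov

/-! ### Towers that are eventually constant in each degree -/

section Tower

open HomologicalComplex Comod Opposite
open scoped ComonObj

lemma isEventuallyConstantTo_of_succ {D : Type*} [Category D] (F : ℕᵒᵖ ⥤ D) (n : ℕ)
    (h : ∀ m, n ≤ m → IsIso (F.map (homOfLE m.le_succ).op)) : F.IsEventuallyConstantTo (op n) := by
  intro ⟨j⟩ f
  obtain ⟨d, rfl⟩ := Nat.exists_eq_add_of_le (leOfHom f.unop)
  obtain rfl : f = (homOfLE (Nat.le_add_right n d)).op := Subsingleton.elim _ _
  induction d with
  | zero => exact inferInstanceAs (IsIso (F.map (𝟙 _)))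
  | succ d hd =>
    have := hd
    have := h (n + d) (by lia)
    have e : (homOfLE (Nat.le_add_right n (d + 1))).op =
      (homOfLE (n + d).le_succ).op ≫ (homOfLE (Nat.le_add_right n d)).op := rfl
    rw [e, F.map_comp]
    infer_instance

/-- Lifts chosen successively along the maps of the tower form a cone. -/
lemma hasLiftingProperty_of_isLimit {D : Type*} [Category D] {F : ℕᵒᵖ ⥤ D} {c : Cone F}
    (hc : IsLimit c) {A B : D} (i : A ⟶ B)
    (h : ∀ m : ℕ, HasLiftingProperty i (F.map (homOfLE m.le_succ).op)) :
    HasLiftingProperty i (c.π.app (op 0)) := by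
  refine ⟨fun {f g} sq => ?_⟩
  obtain ⟨s, hs₀, hs⟩ := exists_seq
    (T := fun m => {l : B ⟶ F.obj (op m) // i ≫ l = f ≫ c.π.app (op m)})
    (fun m x y => y.1 ≫ F.map (homOfLE m.le_succ).op = x.1) ⟨g, sq.w.symm⟩ (fun m x => by
      have sq' : CommSq (f ≫ c.π.app (op (m + 1))) i (F.map (homOfLE m.le_succ).op) x.1 :=
        ⟨by rw [x.2, Category.assoc, c.w]⟩
      exact ⟨⟨sq'.lift, sq'.fac_left⟩, sq'.fac_right⟩)
  let c' : Cone F := ⟨B, NatTrans.ofOpSequence (fun m => (s m).1) (fun m => by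
    rw [hs m]
    exact Category.id_comp _)⟩
  have h' (m : ℕ) : hc.lift c' ≫ c.π.app (op m) = (s m).1 := hc.fac c' (op m)
  refine ⟨⟨⟨hc.lift c', hc.hom_ext fun ⟨m⟩ => ?_, ?_⟩⟩⟩
  · rw [Category.assoc, h', (s m).2]
  · rw [h', hs₀]

variable {k : Type u} [CommRing k]

/-- A tower of complexes which is eventually constant in each degree. -/
def DegreewiseConstant (F : ℕᵒᵖ ⥤ ChainComplex (ModuleCat.{u} k) ℕ) : Prop :=
  ∀ n m : ℕ, n < m → IsIso ((F.map (homOfLE m.le_succ).op).f n)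

lemma DegreewiseConstant.isEventuallyConstantTo {F : ℕᵒᵖ ⥤ ChainComplex (ModuleCat.{u} k) ℕ}
    (hF : DegreewiseConstant F) (n : ℕ) :
    (F ⋙ HomologicalComplex.eval _ _ n).IsEventuallyConstantTo (op (n + 1)) :=
  isEventuallyConstantTo_of_succ _ _ (fun m hm => hF n m hm)

lemma DegreewiseConstant.isIso_π {F : ℕᵒᵖ ⥤ ChainComplex (ModuleCat.{u} k) ℕ}
    (hF : DegreewiseConstant F) {c : Cone F} (hc : IsLimit c) (n m : ℕ) (h : n < m) :
    IsIso ((c.π.app (op m)).f n) :=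
  (hF.isEventuallyConstantTo n).isIso_π_of_isLimit'
    (isLimitOfPreserves (HomologicalComplex.eval _ _ n) hc) (op m) (homOfLE h).op

lemma DegreewiseConstant.nonempty_isLimit {F : ℕᵒᵖ ⥤ ChainComplex (ModuleCat.{u} k) ℕ}
    (hF : DegreewiseConstant F) (c : Cone F) (h : ∀ n, IsIso ((c.π.app (op (n + 1))).f n)) :
    Nonempty (IsLimit c) :=
  ⟨isLimitOfEval _ _ fun n => by
    have : IsIso (((HomologicalComplex.eval _ _ n).mapCone c).π.app (op (n + 1))) := h n
    exact (hF.isEventuallyConstantTo n).isLimitOfIsIso _⟩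

lemma DegreewiseConstant.tensorRight {F : ℕᵒᵖ ⥤ ChainComplex (ModuleCat.{u} k) ℕ}
    (hF : DegreewiseConstant F) (Z : ChainComplex (ModuleCat.{u} k) ℕ) :
    DegreewiseConstant (F ⋙ MonoidalCategory.tensorRight Z) :=
  fun n m hn => isIso_whiskerRight_f _ n (fun i hi => hF i m (by lia)) Z

/-- Tensor products do not preserve all sequential limits, but degree `n` of `K ⊗ Z` depends only on
degrees at most `n` of `K`, which are constant from stage `n + 1` on. -/
lemma DegreewiseConstant.preservesLimit {F : ℕᵒᵖ ⥤ ChainComplex (ModuleCat.{u} k) ℕ}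
    (hF : DegreewiseConstant F) (Z : ChainComplex (ModuleCat.{u} k) ℕ) :
    PreservesLimit F (MonoidalCategory.tensorRight Z) where
  preserves {c} hc := (hF.tensorRight Z).nonempty_isLimit _ fun n =>
    isIso_whiskerRight_f _ n (fun i hi => hF.isIso_π hc i (n + 1) (by lia)) Z

variable {C : ChainComplex (ModuleCat.{u} k) ℕ} [ComonObj C]

/-- A tower of comodules which is eventually constant in each degree has a limit, with the expected
underlying complex. -/
lemma exists_limit {F : ℕᵒᵖ ⥤ Comod C} (hF : DegreewiseConstant (F ⋙ (tensorComonad C).forget)) :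
    ∃ (c : Cone F) (_ : IsLimit c), ∀ n m, n < m → IsIso ((c.π.app (op m)).f.f n) := by
  -- The forgetful functor of a comonad creates the limit once the comonad and its square preserve
  -- it.
  have : PreservesLimit (F ⋙ (tensorComonad C).forget) (tensorComonad C).toFunctor :=
    hF.preservesLimit C
  have : PreservesLimit ((F ⋙ (tensorComonad C).forget) ⋙ (tensorComonad C).toFunctor)
    (tensorComonad C).toFunctor := (hF.tensorRight C).preservesLimit C
  have : HasLimit F := hasLimit_of_created F (tensorComonad C).forget
  exact ⟨limit.cone F, limit.isLimit F, fun n m h =>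
    hF.isIso_π (isLimitOfPreserves (tensorComonad C).forget (limit.isLimit F)) n m h⟩

lemma nonempty_isLimit {F : ℕᵒᵖ ⥤ Comod C} (hF : DegreewiseConstant (F ⋙ (tensorComonad C).forget))
    (c : Cone F) (h : ∀ n, IsIso ((c.π.app (op (n + 1))).f.f n)) : Nonempty (IsLimit c) := by
  have : PreservesLimit (F ⋙ (tensorComonad C).forget) (tensorComonad C).toFunctor :=
    hF.preservesLimit C
  have : PreservesLimit ((F ⋙ (tensorComonad C).forget) ⋙ (tensorComonad C).toFunctor)
    (tensorComonad C).toFunctor := (hF.tensorRight C).preservesLimit C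
  obtain ⟨hc⟩ := hF.nonempty_isLimit ((tensorComonad C).forget.mapCone c) h
  exact ⟨isLimitOfReflects (tensorComonad C).forget hc⟩

variable [IsFiniteProductOfFields k]

lemma isPullback_leftTensorMap (M : ChainComplex (ModuleCat.{u} k) ℕ)
    {X Y Z W : Comod C} {a : X ⟶ Y} {b : X ⟶ Z} {c : Y ⟶ W} {d : Z ⟶ W} (h : IsPullback a b c d) :
    IsPullback (leftTensorMap (𝟙 M) a) (leftTensorMap (𝟙 M) b) (leftTensorMap (𝟙 M) c)
      (leftTensorMap (𝟙 M) d) := by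
  have h' := (isPullback_f h).map (tensorLeft M)
  refine IsPullback.of_map (tensorComonad C).forget ?_ ?_
  · have := (leftTensorFunctor M).map_comp a c
    have := (leftTensorFunctor M).map_comp b d
    have e := congrArg (leftTensorFunctor M).map h.w
    simp only [Functor.map_comp] at e
    exact e
  · have e {X Y : Comod C} (f : X ⟶ Y) : (leftTensorMap (𝟙 M) f).f = (tensorLeft M).map f.f :=
      id_tensorHom _ _
    simp only [Comonad.forget_map]
    rw [e, e, e, e]
    exact h'

end Tower

/-! ### Acyclic covers as limits of Postnikov towers -/

section AcyclicCover

open HomologicalComplex Comod Opposite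

variable {k : Type u} [CommRing k] {C : ChainComplex (ModuleCat.{u} k) ℕ} [ComonObj C]
  [IsFiniteProductOfFields k]

/-- By adjunction, lifting comodule maps from `Q` along `cofreeMap d` amounts to lifting chain maps
along `d`. -/
lemma isFib_cofreeMap {D W : ChainComplex (ModuleCat.{u} k) ℕ} (hD : D.Acyclic) (d : D ⟶ W)
    (hd : ∀ {K : ChainComplex (ModuleCat.{u} k) ℕ} (_ : K.Acyclic) (f : K ⟶ W), ∃ g, g ≫ d = f) :
    IsFib (cofreeMap d : (cofree D : Comod C) ⟶ cofree W) := by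
  have := injective_cofree (C := C) hD
  refine isFib_of_injective (X := (cofree D : Comod C)) _ (fun {Q} hQ φ => ?_)
  obtain ⟨g, hg⟩ := hd hQ (φ.f ≫ W ◁ ComonObj.counit ≫ (ρ_ W).hom)
  exact ⟨toCofree g, by rw [toCofree_cofreeMap, hg, ← eq_toCofree φ]⟩

lemma epi_whiskerLeft (M : ChainComplex (ModuleCat.{u} k) ℕ) {K L : ChainComplex (ModuleCat.{u} k) ℕ}
    (d : K ⟶ L) [Epi d] : Epi (M ◁ d) := by
  have : Epi (d ▷ M) := by
    have (n : ℕ) : Epi ((d ▷ M).f n) := by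
      have (i : ℕ) : Epi (d.f i) := inferInstance
      let t (i : ℕ) : L.X i ⟶ K.X i := Projective.factorThru (𝟙 _) (d.f i)
      have ht (i : ℕ) : t i ≫ d.f i = 𝟙 _ := Projective.factorThru_comp _ _
      have h := gradedWhisker_comp t d.f M n
      simp only [ht, gradedWhisker_id] at h
      exact epi_of_epi_fac h
    exact HomologicalComplex.epi_of_epi_f _ this
  have e : M ◁ d = (β_ M K).hom ≫ d ▷ M ≫ (β_ L M).hom := by
    rw [← BraidedCategory.braiding_naturality_right_assoc, SymmetricCategory.symmetry, Category.comp_id]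
  rw [e]
  infer_instance

lemma injective_leftTensor_cofree (M : ChainComplex (ModuleCat.{u} k) ℕ)
    {D : ChainComplex (ModuleCat.{u} k) ℕ} (h : (M ⊗ D).Acyclic) :
    Injective (leftTensor M (cofree D : Comod C)) :=
  have := injective_cofree (C := C) h
  injective_of_retract (leftTensorAssoc M D (self C)).hom (leftTensorAssoc M D (self C)).inv
    (Iso.hom_inv_id _)

lemma leftTensorMap_cofreeMap (M : ChainComplex (ModuleCat.{u} k) ℕ)
    {D W : ChainComplex (ModuleCat.{u} k) ℕ} (d : D ⟶ W) :
    leftTensorMap (𝟙 M) (cofreeMap d : (cofree D : Comod C) ⟶ cofree W) =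
      (leftTensorAssoc M D (self C)).hom ≫ cofreeMap (M ◁ d) ≫ (leftTensorAssoc M W (self C)).inv := by
  refine Comonad.Coalgebra.Hom.ext ?_
  change 𝟙 M ⊗ₘ (d ⊗ₘ 𝟙 C) = (α_ M D C).inv ≫ ((M ◁ d) ⊗ₘ 𝟙 C) ≫ (α_ M W C).hom
  simp

/-- `J ⊗ W` is acyclic, hence projective, so `J ◁ d` splits; the source is injective because `J ⊗ D`
is acyclic. -/
lemma isTrivFib_leftTensorMap_cofreeMap {D W : ChainComplex (ModuleCat.{u} k) ℕ}
    (d : D ⟶ W) [Epi d] :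
    IsTrivFib (leftTensorMap (𝟙 (J k)) (cofreeMap d : (cofree D : Comod C) ⟶ cofree W)) := by
  have := injective_leftTensor_cofree (C := C) (J k) (acyclic_tensor acyclic_J D)
  have := projective_of_acyclic (acyclic_tensor (acyclic_J (k := k)) W)
  have : Epi (J k ◁ d) := epi_whiskerLeft (J k) d
  let s : J k ⊗ W ⟶ J k ⊗ D := Projective.factorThru (𝟙 _) (J k ◁ d)
  have hs : s ≫ J k ◁ d = 𝟙 _ := Projective.factorThru_comp _ _
  have h : (cofreeMap s : (cofree (J k ⊗ W) : Comod C) ⟶ _) ≫ cofreeMap (J k ◁ d) = 𝟙 _ := by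
    refine Comonad.Coalgebra.Hom.ext ?_
    change (s ⊗ₘ 𝟙 C) ≫ ((J k ◁ d) ⊗ₘ 𝟙 C) = 𝟙 _
    rw [MonoidalCategory.tensorHom_comp_tensorHom, hs, Category.comp_id, id_tensorHom_id]
  have h' : ((leftTensorAssoc (J k) W (self C)).hom ≫ cofreeMap s ≫
      (leftTensorAssoc (J k) D (self C)).inv) ≫
        leftTensorMap (𝟙 (J k)) (cofreeMap d : (cofree D : Comod C) ⟶ cofree W) = 𝟙 _ := by
    rw [leftTensorMap_cofreeMap]
    simp only [Category.assoc, Iso.inv_hom_id_assoc]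
    rw [reassoc_of% h, Iso.hom_inv_id]
  exact isTrivFib_of_section _ _ h'

lemma isIso_leftTensorMap_f (M : ChainComplex (ModuleCat.{u} k) ℕ) {X Y : Comod C} (f : X ⟶ Y) (n : ℕ)
    (h : ∀ i ≤ n, IsIso (f.f.f i)) : IsIso ((leftTensorMap (𝟙 M) f).f.f n) := by
  have e : (leftTensorMap (𝟙 M) f).f = (β_ M X.A).hom ≫ f.f ▷ M ≫ (β_ Y.A M).hom := by
    rw [← BraidedCategory.braiding_naturality_right_assoc, SymmetricCategory.symmetry, Category.comp_id]
    exact id_tensorHom _ _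
  have := isIso_whiskerRight_f f.f n h M
  have h₁ : IsIso ((β_ M X.A).hom.f n) := inferInstance
  have h₂ : IsIso ((β_ Y.A M).hom.f n) := inferInstance
  rw [e, comp_f, comp_f]
  infer_instance

/-- The homology in degree `n + 1` is killed by pulling back the cofree comodule on a disk in
degrees `n + 1` and `n`, so nothing changes below degree `n`. The disk surjects onto its top degree,
which makes `J ⊗ p` a trivial fibration. -/
lemma exists_postnikov_step (hC : IsSimplyConnected C) (Q : Comod C) (n : ℕ)
    (hQ : ∀ i < n + 1, Q.A.ExactAt i) :
    ∃ (Q' : Comod C) (p : Q' ⟶ Q), IsFib p ∧ IsTrivFib (leftTensorMap (𝟙 (J k)) p) ∧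
      (∀ i < n, IsIso (p.f.f i)) ∧ ∀ i < n + 2, Q'.A.ExactAt i := by
  obtain ⟨V, g, hg⟩ := exists_killing hC Q (n + 1) hQ
  have sq := IsPullback.of_hasPullback g (cofreeMap (diskToSingle V n))
  refine ⟨_, _, IsFib.of_isPullback sq (isFib_cofreeMap (acyclic_disk V n) _ fun hK f => ?_),
    IsTrivFib.of_isPullback (isPullback_leftTensorMap (J k) sq)
      (isTrivFib_leftTensorMap_cofreeMap _), fun i hi => ?_, fun i hi =>
      hg (acyclic_disk V n) _ _ _ sq i (by lia)⟩
  · have := projective_of_acyclic hK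
    exact ⟨Projective.factorThru f _, Projective.factorThru_comp _ _⟩
  · have h₁ : IsZero ((disk V n ⊗ C).X i) :=
      isZero_tensor_X i fun a b hab => Or.inl (isZero_double_X _ _ _ (by lia) (by lia))
    have h₂ := isZero_single_tensor_X V (n + 1) i (by lia) C
    exact (isPullback_f_f sq i).isIso_fst_of_isIso ⟨0, h₁.eq_of_src _ _, h₂.eq_of_src _ _⟩

/-- A comodule which is exact in degree `0` is covered by an acyclic one. -/
lemma exists_acyclic_cover (hC : IsSimplyConnected C) (Q : Comod C) (hQ : Q.A.ExactAt 0) :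
    ∃ (P : Comod C) (p : P ⟶ Q), P.A.Acyclic ∧ IsFib p ∧ IsTrivFib (leftTensorMap (𝟙 (J k)) p) := by
  obtain ⟨s, hs₀, hs⟩ := exists_seq (T := fun m => {Q : Comod C // ∀ i < m + 1, Q.A.ExactAt i})
    (fun m x y => ∃ p : y.1 ⟶ x.1, IsFib p ∧ IsTrivFib (leftTensorMap (𝟙 (J k)) p) ∧
      ∀ i < m, IsIso (p.f.f i)) ⟨Q, fun i hi => by
        obtain rfl : i = 0 := by lia
        exact hQ⟩ (fun m x => by
      obtain ⟨Q', p, h₁, h₂, h₃, h₄⟩ := exists_postnikov_step hC x.1 m x.2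
      exact ⟨⟨Q', h₄⟩, p, h₁, h₂, h₃⟩)
  choose p hp₁ hp₂ hp₃ using hs
  let F : ℕᵒᵖ ⥤ Comod C := Functor.ofOpSequence (X := fun m => (s m).1) p
  have hFp (m : ℕ) : F.map (homOfLE m.le_succ).op = p m := Functor.ofOpSequence_map_homOfLE_succ (X := fun m => (s m).1) p m
  have hF : DegreewiseConstant (F ⋙ (tensorComonad C).forget) := fun n m h => by
    change IsIso ((F.map (homOfLE m.le_succ).op).f.f n)
    rw [hFp]
    exact hp₃ m n h
  obtain ⟨c, hc, hc'⟩ := exists_limit hF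
  have hF' : DegreewiseConstant ((F ⋙ leftTensorFunctor (J k)) ⋙ (tensorComonad C).forget) :=
    fun n m h => isIso_leftTensorMap_f (J k) _ n fun i hi => hF i m (by lia)
  -- Tensoring with `J` preserves this limit, so `J ⊗ P ⟶ J ⊗ Q` is again a limit of a tower of
  -- trivial fibrations.
  obtain ⟨hJ⟩ := nonempty_isLimit hF' ((leftTensorFunctor (J k)).mapCone c) (fun n =>
    isIso_leftTensorMap_f (J k) _ n fun i hi => hc' i (n + 1) (by lia))
  suffices h : ∃ (P : Comod C) (p : P ⟶ (s 0).1), P.A.Acyclic ∧ IsFib p ∧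
      IsTrivFib (leftTensorMap (𝟙 (J k)) p) by rwa [hs₀] at h
  refine ⟨c.pt, c.π.app (op 0), fun i => exactAt_of_exists_lift fun {A} x hx => ?_,
    fun _ _ i hi hi' => hasLiftingProperty_of_isLimit hc i fun m => ?_,
    fun _ _ i hi => hasLiftingProperty_of_isLimit hJ i fun m => ?_⟩
  -- In degrees `i` and `i + 1` the limit agrees with stage `i + 2`, which is exact in degree `i`.
  · have := hc' i (i + 2) (by lia)
    have := hc' (i + 1) (i + 2) (by lia)
    let q : c.pt ⟶ (s (i + 2)).1 := c.π.app (op (i + 2))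
    have h₁ : IsIso (q.f.f i) := hc' i (i + 2) (by lia)
    have h₂ : IsIso (q.f.f (i + 1)) := hc' (i + 1) (i + 2) (by lia)
    obtain ⟨y, hy⟩ := exists_lift_of_exactAt ((s (i + 2)).2 i (by lia)) (x ≫ q.f.f i) (fun j => by
      rw [Category.assoc, q.f.comm, reassoc_of% hx, zero_comp])
    refine ⟨y ≫ inv (q.f.f (i + 1)), ?_⟩
    rw [← cancel_mono (q.f.f i), ← hy, Category.assoc, Category.assoc, ← q.f.comm,
      IsIso.inv_hom_id_assoc]
  · rw [hFp]
    exact hp₁ m i hi hi'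
  · change HasLiftingProperty i (leftTensorMap (𝟙 (J k)) (F.map (homOfLE m.le_succ).op))
    rw [hFp]
    exact hp₂ m i hi

end AcyclicCover

/-! ### The second factorization, and injectivity of `J ⊗ X` for fibrant `X` -/

section Factorizations

open HomologicalComplex Comod ZeroObject

variable {k : Type u} [CommRing k] {C : ChainComplex (ModuleCat.{u} k) ℕ} [ComonObj C]
  [IsFiniteProductOfFields k]

lemma quasiIso_of_shortExact {S : ShortComplex (ChainComplex (ModuleCat.{u} k) ℕ)}
    (hS : S.ShortExact) (h : S.X₃.Acyclic) : QuasiIso S.f where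
  quasiIsoAt i := by
    have hz (i : ℕ) : IsZero (S.X₃.homology i) := (h i).isZero_homology
    have h₁ : Mono (homologyMap S.f i) :=
      (hS.homology_exact₁ (i + 1) i rfl).mono_g ((hz _).eq_of_src _ _)
    have h₂ : Epi (homologyMap S.f i) :=
      (hS.homology_exact₂ i).epi_f ((hz _).eq_of_tgt _ _)
    rw [quasiIsoAt_iff_isIso_homologyMap]
    exact isIso_of_mono_of_epi _

/-- A disk killing homology in degree 0 would need a degree `-1`. The first step instead pulls back
the zero comodule, which is a fibration because chain maps from an acyclic complex to one
concentrated in degree 0 vanish. -/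
lemma exists_acyclic_fibration (hC : IsSimplyConnected C) (Q : Comod C) :
    ∃ (P : Comod C) (p : P ⟶ Q), P.A.Acyclic ∧ IsFib p := by
  obtain ⟨V, g, hg⟩ := exists_killing hC Q 0 (fun i hi => by lia)
  have h₀ : (0 : ChainComplex (ModuleCat.{u} k) ℕ).Acyclic := fun i => by
    rw [exactAt_iff_isZero_homology]
    exact (homologyFunctor _ _ i).map_isZero (isZero_zero _)
  have sq := IsPullback.of_hasPullback g
    (cofreeMap (0 : (0 : ChainComplex (ModuleCat.{u} k) ℕ) ⟶ (single _ _ 0).obj V))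
  obtain ⟨P, p, h₁, h₂, -⟩ := exists_acyclic_cover hC _ (hg h₀ 0 _ _ sq 0 le_rfl)
  refine ⟨P, _, h₁, h₂.comp (IsFib.of_isPullback sq (isFib_cofreeMap h₀ _ fun {K} hK f => ⟨0, ?_⟩))⟩
  obtain ⟨y, hy⟩ := exists_lift_of_exactAt (hK 0) (𝟙 (K.X 0)) (fun j => by
    rw [K.shape _ _ (by simp), comp_zero])
  refine to_single_hom_ext ?_
  have hf : K.d (0 + 1) 0 ≫ f.f 0 = 0 := by
    rw [← f.comm, single_obj_d]
    exact comp_zero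
  rw [← Category.id_comp (f.f 0), ← hy, Category.assoc, hf, comp_zero, comp_zero,
    zero_f]

/-- Monomorphisms factor as injective quasi-isomorphisms followed by fibrations. -/
lemma exists_factorization_of_mono (hC : IsSimplyConnected C) {X Y : Comod C} (j : X ⟶ Y) [Mono j.f] :
    ∃ (E : Comod C) (i : X ⟶ E) (p : E ⟶ Y), i ≫ p = j ∧ Mono i.f ∧ QuasiIso i.f ∧ IsFib p ∧
      (Y.A.ExactAt 0 → IsTrivFib (leftTensorMap (𝟙 (J k)) p)) := by
  obtain ⟨Q, q, w, hq, hq'⟩ := exists_quotient j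
  obtain ⟨P, p, hP, hp, hp'⟩ : ∃ (P : Comod C) (p : P ⟶ Q), P.A.Acyclic ∧ IsFib p ∧
      (Y.A.ExactAt 0 → IsTrivFib (leftTensorMap (𝟙 (J k)) p)) := by
    -- Exactness in degree 0 passes from `Y` to the quotient `Q`, so in that case the cover that
    -- stays well behaved after tensoring with `J` is available.
    by_cases hY : Y.A.ExactAt 0
    · obtain ⟨P, p, h₁, h₂, h₃⟩ := exists_acyclic_cover hC Q (exactAt_of_exists_lift fun x hx => by
        have : Epi q.f := hq.epi_g
        have : Epi (q.f.f 0) := inferInstance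
        obtain ⟨y, hy⟩ := exists_lift_of_exactAt hY (Projective.factorThru x (q.f.f 0)) (fun j => by
          rw [Y.A.shape _ _ (by simp), comp_zero])
        exact ⟨y ≫ q.f.f 1, by rw [Category.assoc, q.f.comm, reassoc_of% hy,
          Projective.factorThru_comp]⟩)
      exact ⟨P, p, h₁, h₂, fun _ => h₃⟩
    · obtain ⟨P, p, h₁, h₂⟩ := exists_acyclic_fibration hC Q
      exact ⟨P, p, h₁, h₂, fun h => (hY h).elim⟩
  -- The factorization goes through `Y ×_Q P`: the kernel of its projection to the acyclic `P` is
  -- the kernel `X` of `q`.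
  have sq := IsPullback.of_hasPullback q p
  have sq' := isPullback_f sq
  have w' : j ≫ q = 0 := Comonad.Coalgebra.Hom.ext w
  let i : X ⟶ pullback q p := sq.lift j 0 (by rw [w', zero_comp])
  have hi : i ≫ pullback.fst q p = j := sq.lift_fst _ _ _
  have hi' : i ≫ pullback.snd q p = 0 := sq.lift_snd _ _ _
  have hif : i.f ≫ (pullback.fst q p).f = j.f := congrArg Comonad.Coalgebra.Hom.f hi
  have hif' : i.f ≫ (pullback.snd q p).f = 0 := congrArg Comonad.Coalgebra.Hom.f hi'
  have hmono : Mono i.f := mono_of_mono_fac hif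
  have hepi : Epi (pullback.snd q p).f := by
    have : Epi q.f := hq.epi_g
    exact Abelian.epi_snd_of_isLimit _ _ sq'.isLimit
  have hS : (ShortComplex.mk i.f (pullback.snd q p).f hif').ShortExact := by
    refine ShortComplex.ShortExact.mk' (ShortComplex.exact_of_f_is_kernel _ ?_) hmono hepi
    refine KernelFork.IsLimit.ofι' _ _ (fun {A} x hx => ?_)
    have h : (x ≫ (pullback.fst q p).f) ≫ q.f = 0 := by
      rw [Category.assoc, sq'.w, reassoc_of% hx, zero_comp]
    refine ⟨hq.fIsKernel.lift (KernelFork.ofι _ h), sq'.hom_ext ?_ ?_⟩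
    · rw [Category.assoc, hif]
      exact hq.fIsKernel.fac (KernelFork.ofι _ h) WalkingParallelPair.zero
    · rw [Category.assoc, hif', comp_zero]
      exact hx.symm
  exact ⟨_, i, _, hi, hmono, quasiIso_of_shortExact hS hP, IsFib.of_isPullback sq hp,
    fun h => IsTrivFib.of_isPullback (isPullback_leftTensorMap (J k) sq) (hp' h)⟩

/-- The monomorphism `toBiprod f` replaces `f`; the leftover projection is a trivial fibration. -/
lemma exists_trivialCofibration_fibration (hC : IsSimplyConnected C) {X Y : Comod C} (f : X ⟶ Y) :
    ∃ (E : Comod C) (i : X ⟶ E) (p : E ⟶ Y), i ≫ p = f ∧ Mono i.f ∧ QuasiIso i.f ∧ IsFib p := by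
  obtain ⟨E, i, p, h₁, h₂, h₃, h₄, -⟩ := exists_factorization_of_mono hC (toBiprod f)
  exact ⟨E, i, p ≫ biprod.fst, by rw [reassoc_of% h₁, toBiprod_fst], h₂, h₃,
    h₄.comp (isTrivFib_biprod_fst _ _).isFib⟩

lemma injective_of_isTrivFib {X Y : Comod C} {p : X ⟶ Y} (hp : IsTrivFib p) [Injective Y] :
    Injective X where
  factors {A B} f i hi := by
    have := hp i inferInstance
    have sq : CommSq f i p (Injective.factorThru (f ≫ p) i) := ⟨(Injective.comp_factorThru _ _).symm⟩
    exact ⟨sq.lift, sq.fac_left⟩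

/-- If `X` is fibrant, then `J ⊗ X` is injective. -/
lemma injective_leftTensor_of_extension (hC : IsSimplyConnected C) {X : Comod C}
    (hX : ∀ {A B : Comod C} (i : A ⟶ B) (_ : Mono i.f) (_ : QuasiIso i.f) (f : A ⟶ X),
      ∃ g : B ⟶ X, i ≫ g = f) : Injective (leftTensor (J k) X) := by
  -- Fibrancy of `X` splits `i`, so `X` is a retract of `E`. The target `cofree (J ⊗ X)` is acyclic,
  -- hence exact in degree 0, so `J ⊗ p` is a trivial fibration to an injective object and `J ⊗ E`
  -- is injective.
  obtain ⟨E, i, p, -, h₂, h₃, -, h₅⟩ := exists_factorization_of_mono hC (toCofreeJ X)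
  obtain ⟨r, hr⟩ := hX i h₂ h₃ (𝟙 X)
  have hJ := acyclic_tensor (acyclic_J (k := k)) X.A
  have := injective_leftTensor_cofree (C := C) (J k) (acyclic_tensor acyclic_J (J k ⊗ X.A))
  have := injective_of_isTrivFib (h₅ (acyclic_cofree hJ 0))
  have e : leftTensorMap (𝟙 (J k)) i ≫ leftTensorMap (𝟙 (J k)) r = 𝟙 (leftTensor (J k) X) :=
    ((leftTensorFunctor (J k)).map_comp i r).symm.trans (by
      rw [hr]
      exact (leftTensorFunctor (J k)).map_id X)
  exact injective_of_retract _ _ e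

end Factorizations

/-! ### The model structure -/

section ModelStructure

open HomotopicalAlgebra MorphismProperty Comod

variable {k : Type u} [CommRing k] (C : ChainComplex (ModuleCat.{u} k) ℕ) [ComonObj C]

/-- The quasi-isomorphisms of comodules. -/
abbrev comodQuasiIso : MorphismProperty (Comod C) :=
  (HomologicalComplex.quasiIso (ModuleCat.{u} k) (ComplexShape.down ℕ)).inverseImage
    (tensorComonad C).forget

/-- The morphisms of comodules which are injective chain maps. -/
abbrev comodMono : MorphismProperty (Comod C) :=
  (monomorphisms (ChainComplex (ModuleCat.{u} k) ℕ)).inverseImage (tensorComonad C).forget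

variable {C} in
lemma rlp_iff_isFib {X Y : Comod C} (f : X ⟶ Y) :
    (comodMono C ⊓ comodQuasiIso C).rlp f ↔ IsFib f :=
  ⟨fun h _ _ i hi hi' => h i ⟨hi, hi'⟩, fun h _ _ i hi => h i hi.1 hi.2⟩

variable [IsFiniteProductOfFields k]

/-- The injective model structure on comodules. -/
@[reducible]
noncomputable def modelCategory (hC : IsSimplyConnected C) : ModelCategory (Comod C) :=
  letI : CategoryWithWeakEquivalences (Comod C) := ⟨comodQuasiIso C⟩
  letI : CategoryWithCofibrations (Comod C) := ⟨comodMono C⟩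
  letI : CategoryWithFibrations (Comod C) := ⟨(comodMono C ⊓ comodQuasiIso C).rlp⟩
  haveI : (weakEquivalences (Comod C)).HasTwoOutOfThreeProperty :=
    inferInstanceAs (comodQuasiIso C).HasTwoOutOfThreeProperty
  haveI : (weakEquivalences (Comod C)).IsStableUnderRetracts :=
    inferInstanceAs (comodQuasiIso C).IsStableUnderRetracts
  haveI : (cofibrations (Comod C)).IsStableUnderRetracts :=
    inferInstanceAs (comodMono C).IsStableUnderRetracts
  haveI : (fibrations (Comod C)).IsStableUnderRetracts :=
    inferInstanceAs (comodMono C ⊓ comodQuasiIso C).rlp.IsStableUnderRetracts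
  haveI : (trivialFibrations (Comod C)).IsStableUnderRetracts :=
    inferInstanceAs (fibrations (Comod C) ⊓ weakEquivalences (Comod C)).IsStableUnderRetracts
  haveI : (trivialCofibrations (Comod C)).IsStableUnderRetracts :=
    inferInstanceAs (cofibrations (Comod C) ⊓ weakEquivalences (Comod C)).IsStableUnderRetracts
  haveI : HasFactorization (cofibrations (Comod C)) (trivialFibrations (Comod C)) := ⟨fun f => ⟨
    { Z := _
      i := toBiprod f
      p := biprod.fst
      fac := toBiprod_fst f
      hi := mono_toBiprod f
      hp := ⟨(rlp_iff_isFib _).2 (isTrivFib_biprod_fst _ _).isFib,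
        (isTrivFib_biprod_fst _ _).quasiIso_f⟩ }⟩⟩
  haveI : HasFactorization (trivialCofibrations (Comod C)) (fibrations (Comod C)) := ⟨fun f => by
    obtain ⟨E, i, p, h₁, h₂, h₃, h₄⟩ := exists_trivialCofibration_fibration hC f
    exact ⟨{ Z := E, i := i, p := p, fac := h₁, hi := ⟨h₂, h₃⟩, hp := (rlp_iff_isFib _).2 h₄ }⟩⟩
  haveI : IsWeakFactorizationSystem (cofibrations (Comod C)) (trivialFibrations (Comod C)) :=
    IsWeakFactorizationSystem.mk' _ _ fun i _ hi hp =>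
      ((rlp_iff_isFib _).1 hp.1).isTrivFib hp.2 i hi
  haveI : IsWeakFactorizationSystem (trivialCofibrations (Comod C)) (fibrations (Comod C)) :=
    IsWeakFactorizationSystem.mk' _ _ fun i _ hi hp => hp i hi
  ModelCategory.mk' (Comod C)

end ModelStructure

/-! ### Cotensor products, injectivity and quasi-isomorphisms -/

section CotensorHomotopy

open HomologicalComplex Comod

variable {k : Type u} [CommRing k] {C : ChainComplex (ModuleCat.{u} k) ℕ} [ComonObj C]
  [IsFiniteProductOfFields k]

lemma exists_retraction_coactHom (X : Comod C) [Injective X] : ∃ r, coactHom X ≫ r = 𝟙 X := by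
  have : Mono (coactHom X) := (mono_iff_mono_f _).2 inferInstance
  exact ⟨Injective.factorThru (𝟙 X) (coactHom X), Injective.comp_factorThru _ _⟩

/-- The injective `X` is a retract of `cofree X.A`, so `M ⊗ X` is a retract of the cofree comodule
on the acyclic complex `M ⊗ X.A`. -/
lemma injective_leftTensor_of_injective (M : ChainComplex (ModuleCat.{u} k) ℕ) (X : Comod C)
    (hX : X.A.Acyclic) [Injective X] : Injective (leftTensor M X) := by
  obtain ⟨r, hr⟩ := exists_retraction_coactHom X
  have := injective_leftTensor_cofree (C := C) M
    (acyclic_of_iso (acyclic_tensor hX M) (β_ X.A M))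
  have e : leftTensorMap (𝟙 M) (coactHom X) ≫ leftTensorMap (𝟙 M) r = 𝟙 (leftTensor M X) :=
    ((leftTensorFunctor M).map_comp _ r).symm.trans (by
      rw [hr]
      exact (leftTensorFunctor M).map_id X)
  exact injective_of_retract _ _ e

variable [IsCommComonObj C]

/-- The comodules `X` with `J ⊗ X` injective are stable under the cotensor product. -/
lemma injective_leftTensor_cotensor (X Y : Comod C) [Injective (leftTensor (J k) X)]
    [Injective (leftTensor (J k) Y)] : Injective (leftTensor (J k) (cotensor X Y)) := by
  -- `J ⊗ Y` is injective and acyclic, so `X ⊗ (J ⊗ Y)` is injective, and reordering the factors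
  -- identifies it with `cofree (J ⊗ X) □ Y`.
  have h₁ := injective_leftTensor_of_injective X.A (leftTensor (J k) Y) (acyclic_tensor acyclic_J Y.A)
  have h₂ : Injective (leftTensor (J k) (leftTensor X.A Y)) :=
    injective_of_retract _ _ (leftTensorSwap_swap (J k) X.A Y)
  have h₃ : Injective (leftTensor (J k ⊗ X.A) Y) :=
    injective_of_retract _ _ (leftTensorAssoc (J k) X.A Y).inv_hom_id
  obtain ⟨e⟩ := nonempty_cotensorCofreeIso (C := C) (J k ⊗ X.A) Y
  have h₄ : Injective (cotensor (cofree (J k ⊗ X.A)) Y) := injective_of_retract _ _ e.hom_inv_id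
  -- Injectivity of `J ⊗ X` makes `(J ⊗ X) □ Y`, that is `J ⊗ (X □ Y)`, a retract of `cofree (J ⊗ X)
  -- □ Y`.
  obtain ⟨r, hr⟩ := exists_retraction_coactHom (leftTensor (J k) X)
  have h₅ : Injective (cotensor (leftTensor (J k) X) Y) :=
    injective_of_retract (cotensorMap (coactHom _) (𝟙 Y)) (cotensorMap r (𝟙 Y)) (by
      have h := cotensorMap_comp (coactHom (leftTensor (J k) X)) (𝟙 Y) r (𝟙 Y)
      rw [hr, Category.comp_id, cotensorMap_id] at h
      exact h)
  obtain ⟨e'⟩ := nonempty_leftTensorCotensorIso (C := C) (J k) X Y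
  exact injective_of_retract _ _ e'.hom_inv_id

instance additive_cotensorRight (Y : Comod C) :
    (tensorRight Y ⋙ (tensorComonad C).forget).Additive where
  map_add {X X' f g} := by
    have h (f : X ⟶ X') : (cotensorMap f (𝟙 Y)).f ≫ incl X' Y = incl X Y ≫ f.f ▷ Y.A :=
      (cotensorMap_incl f (𝟙 Y)).trans (by rw [Comonad.Coalgebra.id_f, tensorHom_id])
    change (cotensorMap (f + g) (𝟙 Y)).f = (cotensorMap f (𝟙 Y)).f + (cotensorMap g (𝟙 Y)).f
    rw [← cancel_mono (incl X' Y), Preadditive.add_comp, h, h, h, ← Preadditive.comp_add,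
      ← MonoidalPreadditive.add_whiskerRight]
    rfl

/-- `cofree D □ Z ≅ D ⊗ Z` is acyclic when `D` is, so the retract description of trivial fibrations
applies to `- □ Z`. -/
lemma IsTrivFib.quasiIso_whiskerRight {X Y : Comod C} {p : X ⟶ Y} (hp : IsTrivFib p) (Z : Comod C) :
    QuasiIso (p ▷ Z).f :=
  hp.quasiIso_map (tensorRight Z ⋙ (tensorComonad C).forget) fun D hD => by
    obtain ⟨e⟩ := nonempty_cotensorCofreeIso (C := C) D Z
    exact acyclic_of_iso (acyclic_tensor hD Z.A) ((tensorComonad C).forget.mapIso e.symm)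

end CotensorHomotopy

/-! ### Fibrant comodules and the comonoidal axioms -/

section Comonoidal

open HomotopicalAlgebra Comod

variable {k : Type u} [CommRing k] [IsFiniteProductOfFields k]
  {C : ChainComplex (ModuleCat.{u} k) ℕ} [ComonObj C]

lemma isFibrant_iff (hC : IsSimplyConnected C) (X : Comod C) :
    letI := modelCategory C hC
    IsFibrant X ↔ Injective (leftTensor (J k) X) := by
  let := modelCategory C hC
  constructor
  · intro h
    refine injective_leftTensor_of_extension hC fun {A B} i hi hi' f => ?_
    have : HasLiftingProperty i (terminal.from X) := h.mem i ⟨hi, hi'⟩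
    have sq : CommSq f i (terminal.from X) (terminal.from B) := ⟨Subsingleton.elim _ _⟩
    exact ⟨sq.lift, sq.fac_left⟩
  · intro h
    refine ⟨fun A B i hi => ⟨fun {f g} sq => ?_⟩⟩
    obtain ⟨l, hl⟩ := exists_extension_of_injective hC i hi.1 hi.2 f
    exact ⟨⟨⟨l, hl, Subsingleton.elim _ _⟩⟩⟩

variable [IsCommComonObj C]

/-- Ken Brown's lemma: `f` is a section of a trivial fibration followed by a fibration, which is
trivial by two out of three, and trivial fibrations stay weak equivalences after cotensoring. -/
lemma weakEquivalence_whiskerRight (hC : IsSimplyConnected C) {Y Z : Comod C} (f : Y ⟶ Z) :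
    letI := modelCategory C hC
    ∀ [IsFibrant Y] [IsFibrant Z] [WeakEquivalence f] (X : Comod C), WeakEquivalence (f ▷ X) := by
  let := modelCategory C hC
  intro _ _ _ X
  have key {E Z : Comod C} (p : E ⟶ Z) [Fibration p] [WeakEquivalence p] :
      WeakEquivalence (p ▷ X) :=
    ⟨(((rlp_iff_isFib p).1 (mem_fibrations p)).isTrivFib
      (mem_weakEquivalences p)).quasiIso_whiskerRight X⟩
  obtain ⟨h⟩ : Nonempty (FibrantBrownFactorization f) := inferInstance
  have hp : Fibration h.p := inferInstance
  have h₁ := key h.p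
  have h₂ := key h.r
  have h₃ : WeakEquivalence (h.i ▷ X) :=
    weakEquivalence_of_postcomp_of_fac (g := h.r ▷ X) (fg := 𝟙 _)
      (by rw [← comp_whiskerRight, h.i_r, id_whiskerRight])
  rw [← h.fac, comp_whiskerRight]
  infer_instance

lemma isFibrant_unit (hC : IsSimplyConnected C) :
    letI := modelCategory C hC
    IsFibrant (𝟙_ (Comod C)) :=
  (isFibrant_iff hC (self C)).2 (injective_cofree acyclic_J)

lemma isFibrant_tensor (hC : IsSimplyConnected C) (X Y : Comod C) :
    letI := modelCategory C hC
    IsFibrant X → IsFibrant Y → IsFibrant (X ⊗ Y) := by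
  intro hX hY
  have := (isFibrant_iff hC X).1 hX
  have := (isFibrant_iff hC Y).1 hY
  exact (isFibrant_iff hC (cotensor X Y)).2 (injective_leftTensor_cotensor X Y)

lemma weakEquivalence_whiskerLeft (hC : IsSimplyConnected C) {Y Z : Comod C} (f : Y ⟶ Z) :
    letI := modelCategory C hC
    ∀ [IsFibrant Y] [IsFibrant Z] [WeakEquivalence f] (X : Comod C), WeakEquivalence (X ◁ f) := by
  let := modelCategory C hC
  intro _ _ _ X
  have := weakEquivalence_whiskerRight hC f X
  have e : X ◁ f = (β_ X Y).hom ≫ f ▷ X ≫ (β_ Z X).hom := by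
    rw [← BraidedCategory.braiding_naturality_right_assoc, SymmetricCategory.symmetry,
      Category.comp_id]
  rw [e]
  infer_instance

/-- Comodules over a simply connected cocommutative coalgebra form a symmetric comonoidal model
category. -/
lemma symmetricComonoidalModelCategory (hC : IsSimplyConnected C) :
    letI := modelCategory C hC
    SymmetricComonoidalModelCategory (Comod C) := by
  let := modelCategory C hC
  have := isFibrant_unit hC
  exact
    { isFibrant_tensor := fun X Y hX hY => isFibrant_tensor hC X Y hX hY
      weakEquivalence_whiskerLeft := fun X _ _ _ _ _ f _ => weakEquivalence_whiskerLeft hC f X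
      weakEquivalence_whiskerRight := fun X _ _ _ _ _ f _ => weakEquivalence_whiskerRight hC f X
      -- Since the unit is itself fibrant, `i` is a weak equivalence between fibrant objects.
      weakEquivalence_unit := fun i _ X _ => by
        have := weakEquivalence_whiskerRight hC i X
        infer_instance }

end Comonoidal

end DGComod

theorem theorem4 (k : Type u) [CommRing k] [DGComod.IsFiniteProductOfFields k]
    (C : ChainComplex (ModuleCat.{u} k) ℕ) [ComonObj C] [IsCommComonObj C]
    (hC : DGComod.IsSimplyConnected C) :
    ∃ M : HomotopicalAlgebra.ModelCategory (DGComod.Comod C),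
      (∀ {X Y : DGComod.Comod C} (f : X ⟶ Y),
        HomotopicalAlgebra.WeakEquivalence f ↔ QuasiIso f.f) ∧
      (∀ {X Y : DGComod.Comod C} (f : X ⟶ Y),
        HomotopicalAlgebra.Cofibration f ↔ Mono f.f) ∧
      DGComod.SymmetricComonoidalModelCategory (DGComod.Comod C) ∧
      HomotopicalAlgebra.IsFibrant (𝟙_ (DGComod.Comod C)) := by
  let := DGComod.modelCategory C hC
  exact ⟨this, fun f => HomotopicalAlgebra.weakEquivalence_iff f,
    fun f => HomotopicalAlgebra.cofibration_iff f,
    DGComod.symmetricComonoidalModelCategory hC, DGComod.isFibrant_unit hC⟩
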